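/- **Setting.** Let $(\Omega,\mathcal F,(\mathcal F_t)_{t\ge 0},\mathbb P)$ carry a $d$-dimensional Brownian motion $W$ relative to $(\mathcal F_t)$. Let $D\subseteq\mathbb R^d$ be open (for example $D=\mathbb R^d$), and let the factor process $X$ be a continuous time-homogeneous Markov process in $D$ that solves $$dX_t=\mu(X_t)\,dt+\sigma(X_t)\,dW_t ,$$ with generator $\mathcal L=\tfrac12\operatorname{trace}[\sigma\sigma^*\nabla\nabla^*]+\mu^*\nabla$ and transition operators $e^{\mathcal Lt}g(x)=\mathbb E[g(X_t)\mid X_0=x]$. Assume that there is a unique invariant probability density $\omega$ on $D$ (preserved by the transition operators and with $\int (\mathcal Lg)\,\omega\,dx=0$ for all test functions $g\in C_c^\infty(D)$), and that $X$ is stationary with $X_t\sim\omega(x)\,dx$. Write $\langle g\rangle=\int g(x)\omega(x)\,dx$. Assume that $\mathcal L$ is symmetric, $\langle g_1\mathcal Lg_2\rangle=\langle g_2\mathcal Lg_1\rangle$ for all test functions, and has a spectral gap: for some $\lambda>0$, $\langle(e^{\mathcal Lt}g)^2\rangle\le e^{-\lambda t}\langle g^2\rangle$ for all $t\ge0$ and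 all $g$ with $\langle g\rangle=0$ and $\langle g^2\rangle<\infty$. A market model gives the price $F_{t,T}$ at time $t\le T$ of the VIX future with maturity $T$; it satisfies $F_{t,T}=\mathbb E[F_{T,T}\mid\mathcal F_t]$ and $dF_{t,T}/F_{t,T}=\nu(t,T)\,dW_t$. Assume that it is time-homogeneous and Markovian with the same factor process: there are functions $f_\theta$ (roll yields) and $\nu_\theta$ (volatilities), $\theta\ge0$, with $\nu(t,t+\theta)=\nu_\theta(X_t)$ and $$\frac{dF_{t,t+\theta}}{F_{t,t+\theta}}=f_\theta(X_t)\,dt+\nu_\theta(X_t)\,dW_t\qquad(\theta\ge0).$$ (All equations $dF/F=\dots$ are understood as $dF=F\cdot(\dots)$, and this equation holds jointly with that for $X$.) Let $\mathrm{VIX}_t=h(X_t)$, and assume inter-model consistency: $F_{t,t+\theta}=\mathbb E[h(X_{t+\theta})\mid\mathcal F_t]$ almost surely for all $t,\theta\ge0$. Let $\tau>0$, let $h^2$ be twice continuously differentiable on $D$, and assume $\langle h^4\rangle<\infty$ and $\langle(\mathcal Lh^2)^2\rangle<\infty$. Write $f=f_0$ and $\nu=\nu_0$. **Theorem.** The function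 $(2f+\|\nu\|^2)h^2$ is integrable with respect to $\omega(x)\,dx$. The inverse problem $$h^2(x)=\mathbb E\Big[\frac1\tau\int_0^\tau v^2(X_u)\,du\,\Big|\,X_0=x\Big]\qquad\text{for }\omega\text{-almost every }x$$ has a solution $v^2$ (a real-valued function, not required to be non-negative) with $\langle (v^2)^2\rangle<\infty$ if and only if $$\big\langle(2f+\|\nu\|^2)h^2\big\rangle=0 .$$ Any two square-integrable solutions agree $\omega$-almost everywhere. Every such solution has the form $v^2=\langle h^2\rangle+\xi$ with $\langle\xi\rangle=0$, and $$\langle\xi^2\rangle\le\Big(\frac{\tau}{1-e^{-\lambda\tau/2}}\Big)^2\big\langle(\mathcal Lh^2)^2\big\rangle .$$ -/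

import Mathlib

open MeasureTheory ProbabilityTheory
open scoped NNReal ENNReal

noncomputable section

namespace VIXInverse

/-- The Euclidean space `ℝ^d`, with its Euclidean norm. -/
abbrev Vec (d : ℕ) : Type := EuclideanSpace ℝ (Fin d)

/-! ### Brownian motion and stochastic differential equations -/

section Stochastic

variable {Ω : Type*} [MeasurableSpace Ω] {d : ℕ}

/-- `W` is a standard `d`-dimensional Brownian motion relative to the filtration `𝓕`:
continuous and adapted, started at `0`, and `W t - W s` is Gaussian with covariance
`(t - s) • 1` and independent of `𝓕 s` for all `s ≤ t`. -/
structure IsBrownianMotion (P : Measure Ω) (𝓕 : Filtration ℝ≥0 ‹MeasurableSpace Ω›)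
    (W : ℝ≥0 → Ω → Vec d) : Prop where
  adapted : StronglyAdapted 𝓕 W
  continuous_paths : ∀ ω, Continuous fun t => W t ω
  start : ∀ᵐ ω ∂P, W 0 ω = 0
  law_increment : ∀ s t : ℝ≥0, s ≤ t →
    P.map (fun ω => W t ω - W s ω) =
      multivariateGaussian (0 : Vec d) (((t : ℝ) - (s : ℝ)) • (1 : Matrix (Fin d) (Fin d) ℝ))
  indep_increment : ∀ s t : ℝ≥0, s ≤ t →
    Indep (MeasurableSpace.comap (fun ω => W t ω - W s ω) inferInstance) (𝓕 s) P

/-- A local martingale: a process that satisfies the martingale property locally, along a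
localizing sequence of stopping times. -/
def IsLocalMartingale (P : Measure Ω) (𝓕 : Filtration ℝ≥0 ‹MeasurableSpace Ω›)
    (M : ℝ≥0 → Ω → ℝ) : Prop :=
  Locally (fun N : ℝ≥0 → Ω → ℝ => Martingale N 𝓕 P) 𝓕 M P

variable {V : Type*} [NormedAddCommGroup V] [NormedSpace ℝ V]

/-- The drift that Itô's formula attaches to `φ (W_t, Z_t)` when `dZ = b dt + ∑ i, s i dW^i`:
`Dφ(p)(0, b) + (1/2) ∑ i, D²φ(p)((e_i, s i), (e_i, s i))`. -/
def itoDrift (φ : Vec d × V → ℝ) (p : Vec d × V) (b : V) (s : Fin d → V) : ℝ :=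
  fderiv ℝ φ p (0, b) +
    (1 / 2) * ∑ i, iteratedFDeriv ℝ 2 φ p (fun _ => (EuclideanSpace.single i (1 : ℝ), s i))

/-- `Z` is a continuous adapted process in the open set `U` that satisfies
`dZ_t = b_t dt + ∑ i, s_t^i dW_t^i` for the given Brownian motion `W`. The equation is expressed
by the martingale problem for the pair `(W, Z)`: for every compactly supported `C²` test function
`φ` on `ℝ^d × U`, the process `φ (W_t, Z_t) - ∫_0^t itoDrift φ` is a local martingale. Since the
driving noise is part of the pair, the solution is one with respect to this very `W`. -/
structure IsItoProcess (P : Measure Ω) (𝓕 : Filtration ℝ≥0 ‹MeasurableSpace Ω›)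
    (W : ℝ≥0 → Ω → Vec d) (U : Set V) (Z : ℝ≥0 → Ω → V)
    (b : ℝ≥0 → Ω → V) (s : ℝ≥0 → Ω → Fin d → V) : Prop where
  adapted : StronglyAdapted 𝓕 Z
  continuous_paths : ∀ ω, Continuous fun t => Z t ω
  mem_domain : ∀ t ω, Z t ω ∈ U
  progressive_drift : IsStronglyProgressive 𝓕 b
  progressive_dispersion : IsStronglyProgressive 𝓕 s
  integrable_coefficients : ∀ᵐ ω ∂P, ∀ t : ℝ≥0,
    IntervalIntegrable
      (fun r : ℝ => ‖b r.toNNReal ω‖ + ∑ i, ‖s r.toNNReal ω i‖ ^ 2) volume 0 t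
  martingale_problem : ∀ φ : Vec d × V → ℝ, ContDiff ℝ 2 φ → HasCompactSupport φ →
    tsupport φ ⊆ Set.univ ×ˢ U →
    IsLocalMartingale P 𝓕 fun t ω =>
      φ (W t ω, Z t ω) -
        ∫ r in (0 : ℝ)..t,
          itoDrift φ (W r.toNNReal ω, Z r.toNNReal ω) (b r.toNNReal ω) (s r.toNNReal ω)

end Stochastic

/-! ### The factor diffusion, its generator and its semigroup -/

section Factor

variable {d : ℕ}

/-- The Hessian matrix of `g` at `x`. -/
def hessian (g : Vec d → ℝ) (x : Vec d) : Matrix (Fin d) (Fin d) ℝ :=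
  Matrix.of fun j k =>
    iteratedFDeriv ℝ 2 g x ![EuclideanSpace.single j (1 : ℝ), EuclideanSpace.single k (1 : ℝ)]

/-- The infinitesimal generator `(1/2) trace (σ σᵀ ∇∇ᵀ) + μᵀ ∇`. -/
def generator (μ : Vec d → Vec d) (σ : Vec d → Matrix (Fin d) (Fin d) ℝ)
    (g : Vec d → ℝ) (x : Vec d) : ℝ :=
  (1 / 2) * (σ x * (σ x).transpose * hessian g x).trace + fderiv ℝ g x (μ x)

/-- The `i`-th column of a matrix, as a vector. -/
def column (A : Matrix (Fin d) (Fin d) ℝ) (i : Fin d) : Vec d :=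
  WithLp.toLp 2 fun j => A j i

/-- The operator `e^{ℒt}`: `(e^{ℒt} g)(x) = E[g(X_t) | X_0 = x]`, where `κ t x` is the law of `X_t`
given `X_0 = x`. -/
def semigroup (κ : ℝ≥0 → Kernel (Vec d) (Vec d)) (t : ℝ≥0) (g : Vec d → ℝ) (x : Vec d) : ℝ :=
  ∫ y, g y ∂(κ t x)

/-- The factor process: a time-homogeneous Markov process `X` with continuous paths in the open
set `D`, with transition kernels `κ`, that solves `dX_t = μ(X_t) dt + σ(X_t) dW_t`. -/
structure IsFactorDiffusion {Ω : Type*} [MeasurableSpace Ω] (P : Measure Ω)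
    (𝓕 : Filtration ℝ≥0 ‹MeasurableSpace Ω›) (W : ℝ≥0 → Ω → Vec d) (D : Set (Vec d))
    (μ : Vec d → Vec d) (σ : Vec d → Matrix (Fin d) (Fin d) ℝ)
    (κ : ℝ≥0 → Kernel (Vec d) (Vec d)) (X : ℝ≥0 → Ω → Vec d) : Prop where
  isOpen_domain : IsOpen D
  measurable_drift : Measurable μ
  measurable_dispersion : ∀ j k, Measurable fun x => σ x j k
  brownian : IsBrownianMotion P 𝓕 W
  sde : IsItoProcess P 𝓕 W D X (fun t ω => μ (X t ω)) (fun t ω i => column (σ (X t ω)) i)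
  markovKernel : ∀ t, IsMarkovKernel (κ t)
  markov : ∀ (s t : ℝ≥0) (A : Set (Vec d)), MeasurableSet A →
    P[(X (t + s) ⁻¹' A).indicator (fun _ => (1 : ℝ)) | 𝓕 t]
      =ᵐ[P] fun ω => (κ s (X t ω)).real A

/-- The bracket `⟨g⟩ = ∫ g(x) ϖ(x) dx`. -/
def bracket (ϖ : Vec d → ℝ) (g : Vec d → ℝ) : ℝ := ∫ x, g x * ϖ x

/-- The measure `ϖ(x) dx`. -/
def densityMeasure (ϖ : Vec d → ℝ) : Measure (Vec d) :=
  volume.withDensity fun x => ENNReal.ofReal (ϖ x)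

/-- Test functions on `D`: smooth with compact support in `D`. -/
structure IsTestFunction (D : Set (Vec d)) (g : Vec d → ℝ) : Prop where
  smooth : ContDiff ℝ ((⊤ : ℕ∞) : WithTop ℕ∞) g
  compact_support : HasCompactSupport g
  support_subset : tsupport g ⊆ D

/-- `ϖ` is an invariant probability density of the factor process on `D`: `ϖ(x) dx` is
preserved by the transition kernels, and `ℒ^* ϖ = 0`, that is, `⟨ℒ g⟩ = 0` for all test
functions `g`. -/
structure IsInvariantDensity (D : Set (Vec d)) (μ : Vec d → Vec d)
    (σ : Vec d → Matrix (Fin d) (Fin d) ℝ) (κ : ℝ≥0 → Kernel (Vec d) (Vec d))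
    (ϖ : Vec d → ℝ) : Prop where
  measurable : Measurable ϖ
  nonneg : ∀ x, 0 ≤ ϖ x
  eq_zero : ∀ x, x ∉ D → ϖ x = 0
  integrable : Integrable ϖ
  integral_eq_one : ∫ x, ϖ x = 1
  invariant : ∀ t, (κ t).Invariant (densityMeasure ϖ)
  adjoint_eq_zero : ∀ g, IsTestFunction D g →
    Integrable (fun x => generator μ σ g x * ϖ x) ∧ bracket ϖ (generator μ σ g) = 0

/-- `ϖ` is the unique invariant density (up to null sets). -/
def IsUniqueInvariantDensity (D : Set (Vec d)) (μ : Vec d → Vec d)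
    (σ : Vec d → Matrix (Fin d) (Fin d) ℝ) (κ : ℝ≥0 → Kernel (Vec d) (Vec d))
    (ϖ : Vec d → ℝ) : Prop :=
  IsInvariantDensity D μ σ κ ϖ ∧
    ∀ ϖ' : Vec d → ℝ, IsInvariantDensity D μ σ κ ϖ' → ϖ' =ᵐ[volume] ϖ

/-- The process `X` is stationary, and its law at each time has density `ϖ`. -/
def IsStationaryWithDensity {Ω : Type*} [MeasurableSpace Ω] (P : Measure Ω)
    (X : ℝ≥0 → Ω → Vec d) (ϖ : Vec d → ℝ) : Prop :=
  ∀ t, P.map (X t) = densityMeasure ϖ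

/-- The generator is symmetric with respect to the bracket, and there is a spectral gap `gap`. -/
structure HasSpectralGap (D : Set (Vec d)) (μ : Vec d → Vec d)
    (σ : Vec d → Matrix (Fin d) (Fin d) ℝ) (κ : ℝ≥0 → Kernel (Vec d) (Vec d))
    (ϖ : Vec d → ℝ) (gap : ℝ) : Prop where
  symmetric : ∀ g₁ g₂, IsTestFunction D g₁ → IsTestFunction D g₂ →
    bracket ϖ (fun x => g₁ x * generator μ σ g₂ x) =
      bracket ϖ (fun x => g₂ x * generator μ σ g₁ x)
  gap_pos : 0 < gap
  decay : ∀ (t : ℝ≥0) (g : Vec d → ℝ), Measurable g →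
    Integrable (fun x => g x ^ 2 * ϖ x) → bracket ϖ g = 0 →
    bracket ϖ (fun x => semigroup κ t g x ^ 2) ≤
      Real.exp (-gap * t) * bracket ϖ (fun x => g x ^ 2)

end Factor

/-! ### Market models for VIX futures -/

section Market

variable {Ω : Type*} [MeasurableSpace Ω] {d : ℕ}

/-- A market model: `F t T` is the price at time `t ≤ T` of the VIX future with maturity `T`.
It is a martingale in `t`, and satisfies `dF_{t,T} / F_{t,T} = vol(t,T) dW_t` on `[0, T]`. -/
structure IsMarketModel (P : Measure Ω) (𝓕 : Filtration ℝ≥0 ‹MeasurableSpace Ω›)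
    (W : ℝ≥0 → Ω → Vec d) (F : ℝ≥0 → ℝ≥0 → Ω → ℝ) (vol : ℝ≥0 → ℝ≥0 → Ω → Vec d) : Prop where
  integrable : ∀ T, Integrable (F T T) P
  martingale : ∀ t T : ℝ≥0, t ≤ T → F t T =ᵐ[P] P[F T T | 𝓕 t]
  sde : ∀ T : ℝ≥0, IsItoProcess P 𝓕 W (Set.univ : Set ℝ) (fun t ω => F (min t T) T ω)
    (fun _ _ => 0) (fun t ω i => if t ≤ T then F t T ω * vol t T ω i else 0)

/-- The market model is time-homogeneous and Markovian, driven by the factor process `X`: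
`vol(t, t + θ) = ν_θ(X_t)`, and the constant maturity futures follow, jointly with `X` and with
the same Brownian motion, `dF_{t,t+θ} / F_{t,t+θ} = f_θ(X_t) dt + ν_θ(X_t) dW_t`. -/
structure IsMarkovianMarketModel (P : Measure Ω) (𝓕 : Filtration ℝ≥0 ‹MeasurableSpace Ω›)
    (W : ℝ≥0 → Ω → Vec d) (D : Set (Vec d)) (μ : Vec d → Vec d)
    (σ : Vec d → Matrix (Fin d) (Fin d) ℝ) (X : ℝ≥0 → Ω → Vec d)
    (F : ℝ≥0 → ℝ≥0 → Ω → ℝ) (vol : ℝ≥0 → ℝ≥0 → Ω → Vec d)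
    (f : ℝ≥0 → Vec d → ℝ) (ν : ℝ≥0 → Vec d → Vec d) : Prop where
  measurable_rollYield : ∀ θ, Measurable (f θ)
  measurable_volatility : ∀ θ, Measurable (ν θ)
  volatility_eq : ∀ t θ : ℝ≥0, ∀ᵐ ω ∂P, vol t (t + θ) ω = ν θ (X t ω)
  cmf_sde : ∀ θ : ℝ≥0, IsItoProcess P 𝓕 W (D ×ˢ (Set.univ : Set ℝ))
    (fun t ω => (X t ω, F t (t + θ) ω))
    (fun t ω => (μ (X t ω), F t (t + θ) ω * f θ (X t ω)))
    (fun t ω i => (column (σ (X t ω)) i, F t (t + θ) ω * ν θ (X t ω) i))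

/-- Inter-model consistency, where the VIX is `h(X_t)`: the constant maturity futures of the
market model agree with those of the stochastic volatility model,
`F_{t,t+θ} = E[VIX_{t+θ} | 𝓕_t]` for all `t, θ ≥ 0`. -/
def InterModelConsistent (P : Measure Ω) (𝓕 : Filtration ℝ≥0 ‹MeasurableSpace Ω›)
    (X : ℝ≥0 → Ω → Vec d) (F : ℝ≥0 → ℝ≥0 → Ω → ℝ) (h : Vec d → ℝ) : Prop :=
  ∀ t θ : ℝ≥0, F t (t + θ) =ᵐ[P] P[fun ω => h (X (t + θ) ω) | 𝓕 t]

/-- `w` (the unknown `v²`, of either sign) is a square-integrable solution of the inverse problem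
`h²(x) = E[(1/τ) ∫_0^τ w(X_u) du | X_0 = x]`. -/
structure IsSquareIntegrableSolution (P : Measure Ω) (X : ℝ≥0 → Ω → Vec d) (ϖ : Vec d → ℝ)
    (τ : ℝ) (h w : Vec d → ℝ) : Prop where
  measurable : Measurable w
  square_integrable : Integrable fun x => w x ^ 2 * ϖ x
  inverse_problem : (fun ω => h (X 0 ω) ^ 2) =ᵐ[P]
    P[fun ω => (1 / τ) * ∫ u in (0 : ℝ)..τ, w (X u.toNNReal ω) |
      MeasurableSpace.comap (X 0) inferInstance]

end Market

end VIXInverse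

end

open VIXInverse

namespace VIXInverse

open Filter Topology

/-! Write g = h², q = ℒg and P_t = e^{ℒt}. The inverse problem is τ g = ∫_0^τ P_r w dr, and applying
ℒ gives τ q = P_τ w − w. The right side has mean zero under the invariant measure, so ⟨q⟩ = 0 is
necessary. On mean-zero functions P_τ has L² norm at most e^{-λτ/2} < 1, so 1 − P_τ is invertible
there. This gives uniqueness (every solution has mean ⟨g⟩), the constant τ/(1 − e^{-λτ/2}), and,
when ⟨q⟩ = 0, the solution w = ⟨g⟩ − τ ∑_k P_{kτ} q.

The market enters through the identity (2f + ‖ν‖²)h² = ℒh² almost everywhere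
(`ae_rollYield_eq_generator`). Consistency at zero time to maturity gives F_{t,t}² = h²(X_t). The
test function y² − g(x), cut off to compact support, then vanishes along the path (X, F), so the
integral of its drift is a local martingale of finite variation. Such a process is constant
(`localMartingale_eq_of_finite_variation`, from the discrete estimate `martingale_variation_bound`),
so the two drifts agree.

The delicate point is that g is only C² and has no compact support, so the pointwise ℒg is not known
in advance to be the derivative of P_t g. What Itô's formula yields is Dynkin's formula stopped at
exits from compact sets (`IsFactorDiffusion.integral_exitTime`). Since g ≥ 0, Fatou's lemma turns it
into an inequality: g(X_t) − ∫_0^t q(X_r) dr has non-positive mean increments from time 0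
(`IsFactorDiffusion.setIntegral_sub_le`). This inequality is used twice. If ⟨q⟩ = 0, stationarity
makes the total mean of the increment zero, so the inequality is an equality on every event of 𝓕_0
(`IsFactorDiffusion.integral_mul_sub_eq`). Summing Dynkin's formula over blocks of length τ and
using mixing shows that the Neumann series solves the problem (`exists_isWeakSolution`). Conversely,
a solution w makes g(X_t) − ∫_0^t u(X_r) dr a martingale with u = (P_τ w − w)/τ, by the Markov
property (`hasCenteredIncrements_of_isWeakSolution`). Comparison with the inequality gives q ≥ u.
Stopping this martingale at the same exit times and using Fatou again gives ⟨q − u⟩ ≤ 0, hence q = u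
almost everywhere (`IsFactorDiffusion.ae_generator_eq`). -/

theorem integrable_and_integral_comp_measure {α β : Type*} [MeasurableSpace α] [MeasurableSpace β]
    {μ : Measure α} {κ : Kernel α β} {f : β → ℝ} (hf : Integrable f (κ ∘ₘ μ)) :
    Integrable (fun x => ∫ y, f y ∂(κ x)) μ ∧
      ∫ y, f y ∂(κ ∘ₘ μ) = ∫ x, ∫ y, f y ∂(κ x) ∂μ := by
  have h : κ ∘ₘ μ = (κ ∘ₖ Kernel.const Unit μ) () := by
    rw [Kernel.comp_const, Kernel.const_apply]
  rw [h] at hf ⊢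
  exact ⟨hf.integral_comp, Kernel.integral_comp hf⟩

/-- A stationary time-homogeneous Markov process with continuous paths, transition kernels `κ`
and marginal law `π`. -/
structure IsStationaryMarkov {Ω : Type*} [MeasurableSpace Ω] {d : ℕ} (P : Measure Ω)
    (𝓕 : Filtration ℝ≥0 ‹MeasurableSpace Ω›) (κ : ℝ≥0 → Kernel (Vec d) (Vec d))
    (X : ℝ≥0 → Ω → Vec d) (π : Measure (Vec d)) : Prop where
  adapted : ∀ t, Measurable[𝓕 t] (X t)
  continuous_paths : ∀ ω, Continuous fun t => X t ω
  law : ∀ t, P.map (X t) = π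
  isMarkovKernel : ∀ t, IsMarkovKernel (κ t)
  markov : ∀ (s t : ℝ≥0) (A : Set (Vec d)), MeasurableSet A →
    P[(X (t + s) ⁻¹' A).indicator (fun _ => (1 : ℝ)) | 𝓕 t]
      =ᵐ[P] fun ω => (κ s (X t ω)).real A

/-! ### Stationary Markov processes: the Markov property, stationarity and Fubini -/

namespace IsStationaryMarkov

variable {Ω : Type*} [MeasurableSpace Ω] {d : ℕ} {P : Measure Ω} [IsProbabilityMeasure P]
  {𝓕 : Filtration ℝ≥0 ‹MeasurableSpace Ω›} {κ : ℝ≥0 → Kernel (Vec d) (Vec d)}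
  {X : ℝ≥0 → Ω → Vec d} {π : Measure (Vec d)}

theorem measurable (hX : IsStationaryMarkov P 𝓕 κ X π) (t : ℝ≥0) : Measurable (X t) :=
  (hX.adapted t).mono (𝓕.le t) le_rfl

theorem isProbabilityMeasure (hX : IsStationaryMarkov P 𝓕 κ X π) : IsProbabilityMeasure π := by
  rw [← hX.law 0]
  exact Measure.isProbabilityMeasure_map (hX.measurable 0).aemeasurable

theorem measurePreserving (hX : IsStationaryMarkov P 𝓕 κ X π) (t : ℝ≥0) :
    MeasurePreserving (X t) P π :=
  ⟨hX.measurable t, hX.law t⟩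

theorem integrable_comp (hX : IsStationaryMarkov P 𝓕 κ X π) (t : ℝ≥0) {q : Vec d → ℝ}
    (hq : Integrable q π) : Integrable (fun ω => q (X t ω)) P :=
  (hX.measurePreserving t).integrable_comp_of_integrable hq

theorem integral_comp (hX : IsStationaryMarkov P 𝓕 κ X π) (t : ℝ≥0) {q : Vec d → ℝ}
    (hq : Integrable q π) : ∫ ω, q (X t ω) ∂P = ∫ x, q x ∂π := by
  rw [← hX.law t] at hq ⊢
  exact (integral_map (hX.measurable t).aemeasurable hq.aestronglyMeasurable).symm

/-- The Markov property for indicators, integrated over a past event `A`, is an identity between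
measures of sets. As an identity of measures it extends at once to all integrable functions, without
approximation by simple functions. -/
theorem map_restrict_eq_comp (hX : IsStationaryMarkov P 𝓕 κ X π) (s r : ℝ≥0) {A : Set Ω}
    (hA : MeasurableSet[𝓕 s] A) :
    (P.restrict A).map (X (s + r)) = (κ r) ∘ₘ ((P.restrict A).map (X s)) := by
  have := hX.isMarkovKernel r
  ext B hB
  have hB' : MeasurableSet (X (s + r) ⁻¹' B) := hX.measurable _ hB
  rw [Measure.bind_apply hB (κ r).measurable.aemeasurable, Measure.map_apply (hX.measurable _) hB,
    lintegral_map ((κ r).measurable_coe hB) (hX.measurable s)]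
  have h1 : ∫ ω in A, (X (s + r) ⁻¹' B).indicator (fun _ => (1 : ℝ)) ω ∂P
      = ∫ ω in A, (κ r (X s ω)).real B ∂P := by
    rw [← setIntegral_condExp (𝓕.le s) ((integrable_const (1 : ℝ)).indicator hB') hA]
    exact setIntegral_congr_ae (𝓕.le s _ hA) ((hX.markov r s B hB).mono fun ω h _ => h)
  rw [integral_indicator hB', integral_const] at h1
  have h2 : ∫ ω in A, (κ r (X s ω)).real B ∂P
      = (∫⁻ ω in A, κ r (X s ω) B ∂P).toReal := by
    refine integral_toReal ?_ ?_
    · exact (((κ r).measurable_coe hB).comp (hX.measurable s)).aemeasurable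
    · exact Filter.Eventually.of_forall fun ω => measure_lt_top _ _
  rw [h2] at h1
  have h3 : ∫⁻ ω in A, κ r (X s ω) B ∂P ≠ ∞ := by
    refine ((lintegral_mono fun ω => prob_le_one).trans_lt ?_).ne
    simp
  rw [← ENNReal.toReal_eq_toReal_iff' (measure_ne_top _ _) h3, ← h1]
  simp [Measure.real]

theorem measurable_semigroup (_ : IsStationaryMarkov P 𝓕 κ X π) (r : ℝ≥0) {q : Vec d → ℝ}
    (hq : Measurable q) : Measurable (semigroup κ r q) :=
  hq.stronglyMeasurable.integral_kernel.measurable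

theorem invariant (hX : IsStationaryMarkov P 𝓕 κ X π) (r : ℝ≥0) : (κ r) ∘ₘ π = π := by
  have := hX.map_restrict_eq_comp 0 r (A := Set.univ) MeasurableSet.univ
  rwa [Measure.restrict_univ, hX.law, hX.law, eq_comm] at this

theorem integrable_semigroup (hX : IsStationaryMarkov P 𝓕 κ X π) (r : ℝ≥0) {q : Vec d → ℝ}
    (hq : Integrable q π) : Integrable (semigroup κ r q) π := by
  have := hX.isMarkovKernel r
  exact (integrable_and_integral_comp_measure (κ := κ r) (by rwa [hX.invariant r])).1

/-- The Markov property for integrable functions. -/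
theorem condExp_comp (hX : IsStationaryMarkov P 𝓕 κ X π) (s r : ℝ≥0) {q : Vec d → ℝ}
    (hqm : Measurable q) (hq : Integrable q π) :
    P[fun ω => q (X (s + r) ω) | 𝓕 s] =ᵐ[P] fun ω => semigroup κ r q (X s ω) := by
  have := hX.isMarkovKernel r
  have hm := hX.measurable_semigroup r hqm
  refine (ae_eq_condExp_of_forall_setIntegral_eq (𝓕.le s) (hX.integrable_comp _ hq) ?_ ?_ ?_).symm
  · intro A hA _
    exact (hX.integrable_comp s (hX.integrable_semigroup r hq)).integrableOn
  · intro A hA _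
    have h1 := hX.map_restrict_eq_comp s r hA
    have h2 : ∫ ω in A, q (X (s + r) ω) ∂P = ∫ x, q x ∂((P.restrict A).map (X (s + r))) :=
      (integral_map (hX.measurable _).aemeasurable hqm.aestronglyMeasurable).symm
    have h3 : ∫ ω in A, semigroup κ r q (X s ω) ∂P
        = ∫ x, semigroup κ r q x ∂((P.restrict A).map (X s)) :=
      (integral_map (hX.measurable _).aemeasurable hm.aestronglyMeasurable).symm
    rw [h2, h3, h1]
    refine (integrable_and_integral_comp_measure ?_).2.symm
    rw [← h1, integrable_map_measure hqm.aestronglyMeasurable (hX.measurable _).aemeasurable]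
    exact (hX.integrable_comp _ hq).integrableOn
  · exact (hm.comp (hX.adapted s)).aestronglyMeasurable

/-- Condition on `𝓕 s` and pull out `Z`. This unconditional form of the Markov property is the one
used in all later computations. -/
theorem integral_mul_comp (hX : IsStationaryMarkov P 𝓕 κ X π) (s r : ℝ≥0) {Z : Ω → ℝ}
    (hZ : Measurable[𝓕 s] Z) {C : ℝ} (hZC : ∀ ω, |Z ω| ≤ C) {q : Vec d → ℝ}
    (hqm : Measurable q) (hq : Integrable q π) :
    ∫ ω, Z ω * q (X (s + r) ω) ∂P = ∫ ω, Z ω * semigroup κ r q (X s ω) ∂P := by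
  have hi := hX.integrable_comp (s + r) hq
  have hi' : Integrable (Z * fun ω => q (X (s + r) ω)) P :=
    hi.bdd_mul (c := C) (hZ.mono (𝓕.le s) le_rfl).aestronglyMeasurable
      (Filter.Eventually.of_forall hZC)
  have h1 := condExp_mul_of_stronglyMeasurable_left (m := 𝓕 s) hZ.stronglyMeasurable hi' hi
  have h2 := integral_condExp (𝓕.le s) (f := Z * fun ω => q (X (s + r) ω)) (μ := P)
  change ∫ ω, (Z * fun ω => q (X (s + r) ω)) ω ∂P = _
  rw [← h2]
  refine integral_congr_ae ?_
  filter_upwards [h1, hX.condExp_comp s r hqm hq] with ω ha hb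
  rw [ha, Pi.mul_apply, hb]

/-- A bounded weight known at time `s` acts on the future after `s` as a function of the state
at time `0` does on the future after `0`. -/
theorem exists_weight (hX : IsStationaryMarkov P 𝓕 κ X π) (s : ℝ≥0) {Z : Ω → ℝ}
    (hZ : Measurable[𝓕 s] Z) (hZ0 : ∀ ω, 0 ≤ Z ω) (hZ1 : ∀ ω, Z ω ≤ 1) :
    ∃ ρ : Vec d → ℝ, Measurable ρ ∧ (∀ x, 0 ≤ ρ x) ∧ (∀ x, ρ x ≤ 1) ∧
      ∀ q : Vec d → ℝ, Measurable q → Integrable q π → ∀ r,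
        ∫ ω, Z ω * q (X (s + r) ω) ∂P = ∫ ω, ρ (X 0 ω) * q (X r ω) ∂P := by
  have hZi : Integrable Z P := by
    refine Integrable.of_bound (hZ.mono (𝓕.le s) le_rfl).aestronglyMeasurable 1 ?_
    exact Filter.Eventually.of_forall fun ω => by
      rw [Real.norm_eq_abs, abs_of_nonneg (hZ0 ω)]; exact hZ1 ω
  obtain ⟨ρ, hρ, hρe⟩ := (stronglyMeasurable_condExp (f := Z) (μ := P) (m := MeasurableSpace.comap (X s) inferInstance)).measurable
    |>.exists_eq_measurable_comp
  have hb0 : 0 ≤ᵐ[P] P[Z | MeasurableSpace.comap (X s) inferInstance] := condExp_nonneg (Filter.Eventually.of_forall hZ0)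
  have hb1 : P[Z | MeasurableSpace.comap (X s) inferInstance] ≤ᵐ[P] fun _ => 1 := by
    have := condExp_mono (m := MeasurableSpace.comap (X s) inferInstance) hZi (integrable_const (1 : ℝ)) (Filter.Eventually.of_forall hZ1)
    rwa [condExp_const (hX.measurable s).comap_le] at this
  -- The weight is E[Z | X_s] written as a function of the state. It lies in [0, 1] only almost
  -- everywhere, so it is clipped.
  refine ⟨fun x => max 0 (min 1 (ρ x)), measurable_const.max (measurable_const.min hρ),
    fun x => le_max_left _ _, fun x => max_le zero_le_one (min_le_left _ _), fun q hqm hq r => ?_⟩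
  have hsm := hX.measurable_semigroup r hqm
  have hsi := hX.integrable_semigroup r hq
  have habs : ∀ x : ℝ, |max 0 (min 1 x)| ≤ 1 := fun x => by
    rw [abs_of_nonneg (le_max_left _ _)]; exact max_le zero_le_one (min_le_left _ _)
  have e1 : ∫ ω, Z ω * q (X (s + r) ω) ∂P = ∫ ω, Z ω * semigroup κ r q (X s ω) ∂P :=
    hX.integral_mul_comp s r hZ (C := 1)
      (fun ω => by rw [abs_of_nonneg (hZ0 ω)]; exact hZ1 ω) hqm hq
  have e2 : ∫ ω, Z ω * semigroup κ r q (X s ω) ∂P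
      = ∫ ω, max 0 (min 1 (ρ (X s ω))) * semigroup κ r q (X s ω) ∂P := by
    have hi := hX.integrable_comp s hsi
    have hi' : Integrable (Z * fun ω => semigroup κ r q (X s ω)) P :=
      hi.bdd_mul (c := 1) hZi.aestronglyMeasurable (Filter.Eventually.of_forall fun ω => by
        rw [Real.norm_eq_abs, abs_of_nonneg (hZ0 ω)]; exact hZ1 ω)
    have h1 := condExp_mul_of_stronglyMeasurable_right (m := MeasurableSpace.comap (X s) inferInstance)
      (g := fun ω => semigroup κ r q (X s ω)) (f := Z)
      (hsm.comp (comap_measurable (X s))).stronglyMeasurable hi' hZi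
    change ∫ ω, (Z * fun ω => semigroup κ r q (X s ω)) ω ∂P = _
    rw [← integral_condExp (hX.measurable s).comap_le]
    refine integral_congr_ae ?_
    filter_upwards [h1, hb0, hb1] with ω ha hb hc
    rw [ha, Pi.mul_apply]
    have : P[Z | MeasurableSpace.comap (X s) inferInstance] ω = ρ (X s ω) := congrFun hρe ω
    rw [this] at hb hc ⊢
    simp only [Pi.zero_apply] at hb
    rw [min_eq_right hc, max_eq_right hb]
  -- By stationarity the integral depends only on the law of the state, so time `s` may be exchanged
  -- for time `0`.
  have e3 : ∀ t, ∫ ω, max 0 (min 1 (ρ (X t ω))) * semigroup κ r q (X t ω) ∂P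
      = ∫ x, max 0 (min 1 (ρ x)) * semigroup κ r q x ∂π := fun t =>
    hX.integral_comp t (q := fun x => max 0 (min 1 (ρ x)) * semigroup κ r q x)
      (hsi.bdd_mul (c := 1) (measurable_const.max (measurable_const.min hρ)).aestronglyMeasurable
        (Filter.Eventually.of_forall fun x => habs _))
  have e4 := hX.integral_mul_comp 0 r (Z := fun ω => max 0 (min 1 (ρ (X 0 ω))))
    (measurable_const.max (measurable_const.min (hρ.comp (hX.adapted 0)))) (C := 1)
    (fun ω => habs _) hqm hq
  rw [e1, e2, e3, ← e3 0, ← e4, zero_add]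

theorem measurable_uncurry (hX : IsStationaryMarkov P 𝓕 κ X π) {q : Vec d → ℝ}
    (hq : Measurable q) : Measurable (Function.uncurry fun (r : ℝ) ω => q (X r.toNNReal ω)) := by
  have h : Measurable (Function.uncurry X) :=
    measurable_uncurry_of_continuous_of_measurable hX.continuous_paths hX.measurable
  exact hq.comp (h.comp ((measurable_real_toNNReal.comp measurable_fst).prodMk measurable_snd))

/-- By stationarity the inner integral of |q(X_r)| does not depend on r, so only the length of the
time interval matters. -/
theorem integrable_uncurry (hX : IsStationaryMarkov P 𝓕 κ X π) {q : Vec d → ℝ}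
    (hqm : Measurable q) (hq : Integrable q π) (a b : ℝ) :
    Integrable (Function.uncurry fun (r : ℝ) ω => q (X r.toNNReal ω))
      ((volume.restrict (Set.uIoc a b)).prod P) := by
  rw [integrable_prod_iff (hX.measurable_uncurry hqm).aestronglyMeasurable]
  refine ⟨Filter.Eventually.of_forall fun r => hX.integrable_comp r.toNNReal hq, ?_⟩
  have : (fun r : ℝ => ∫ ω, ‖Function.uncurry (fun (r : ℝ) ω => q (X r.toNNReal ω)) (r, ω)‖ ∂P)
      = fun _ => ∫ x, ‖q x‖ ∂π := by
    ext r
    exact hX.integral_comp r.toNNReal hq.norm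
  rw [this]
  have : IsFiniteMeasure (volume.restrict (Set.uIoc a b)) :=
    ⟨by rw [Measure.restrict_apply_univ, Set.uIoc, Real.volume_Ioc]; exact ENNReal.ofReal_lt_top⟩
  exact integrable_const _

/-- The exceptional null set is the same for all intervals, because the countably many intervals
[-n, n] suffice. Random endpoints such as exit times are therefore allowed. -/
theorem ae_intervalIntegrable (hX : IsStationaryMarkov P 𝓕 κ X π) {q : Vec d → ℝ}
    (hqm : Measurable q) (hq : Integrable q π) :
    ∀ᵐ ω ∂P, ∀ a b : ℝ, IntervalIntegrable (fun r : ℝ => q (X r.toNNReal ω)) volume a b := by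
  have h : ∀ᵐ ω ∂P, ∀ n : ℕ,
      IntervalIntegrable (fun r : ℝ => q (X r.toNNReal ω)) volume (-n) n := by
    rw [ae_all_iff]
    intro n
    have := (integrable_prod_iff' (hX.measurable_uncurry hqm).aestronglyMeasurable).1
      (hX.integrable_uncurry hqm hq (-n) n)
    filter_upwards [this.1] with ω hω
    rw [intervalIntegrable_iff]
    exact hω
  filter_upwards [h] with ω hω a b
  obtain ⟨n, hn⟩ := exists_nat_ge (max |a| |b|)
  refine (hω n).mono_set ?_
  have ha := abs_le.1 ((le_max_left _ _).trans hn)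
  have hb := abs_le.1 ((le_max_right _ _).trans hn)
  rw [Set.uIcc_of_le (by linarith : -(n : ℝ) ≤ n)]
  exact Set.uIcc_subset_Icc ⟨ha.1, ha.2⟩ ⟨hb.1, hb.2⟩

theorem integrable_intervalIntegral (hX : IsStationaryMarkov P 𝓕 κ X π) {q : Vec d → ℝ}
    (hqm : Measurable q) (hq : Integrable q π) (a b : ℝ) :
    Integrable (fun ω => ∫ r in a..b, q (X r.toNNReal ω)) P := by
  have := (hX.integrable_uncurry hqm hq a b).integral_prod_right
  simp_rw [intervalIntegral.intervalIntegral_eq_integral_uIoc, smul_eq_mul]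
  exact this.const_mul _

theorem integral_mul_intervalIntegral (hX : IsStationaryMarkov P 𝓕 κ X π) {q : Vec d → ℝ}
    (hqm : Measurable q) (hq : Integrable q π) {Z : Ω → ℝ} (hZ : Measurable Z) {C : ℝ}
    (hZC : ∀ ω, |Z ω| ≤ C) (a b : ℝ) :
    ∫ ω, Z ω * (∫ r in a..b, q (X r.toNNReal ω)) ∂P
      = ∫ r in a..b, ∫ ω, Z ω * q (X r.toNNReal ω) ∂P := by
  simp_rw [← intervalIntegral.integral_const_mul]
  refine (intervalIntegral_integral_swap ?_).symm
  exact (hX.integrable_uncurry hqm hq a b).bdd_mul (c := C)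
    (f := fun p : ℝ × Ω => Z p.2) (hZ.comp measurable_snd).aestronglyMeasurable
    (Filter.Eventually.of_forall fun p => hZC p.2)

theorem intervalIntegrable_integral_mul (hX : IsStationaryMarkov P 𝓕 κ X π) {q : Vec d → ℝ}
    (hqm : Measurable q) (hq : Integrable q π) {Z : Ω → ℝ} (hZ : Measurable Z) {C : ℝ}
    (hZC : ∀ ω, |Z ω| ≤ C) (a b : ℝ) :
    IntervalIntegrable (fun r : ℝ => ∫ ω, Z ω * q (X r.toNNReal ω) ∂P) volume a b := by
  rw [intervalIntegrable_iff]
  exact ((hX.integrable_uncurry hqm hq a b).bdd_mul (c := C)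
    (f := fun p : ℝ × Ω => Z p.2) (hZ.comp measurable_snd).aestronglyMeasurable
    (Filter.Eventually.of_forall fun p => hZC p.2)).integral_prod_left

/-- Conditional expectation contracts L², and `semigroup κ r q (X 0)` is the conditional expectation
of q(X_r); the law of `X 0` carries this back to `π`. -/
theorem memLp_semigroup (hX : IsStationaryMarkov P 𝓕 κ X π) (r : ℝ≥0) {q : Vec d → ℝ}
    (hqm : Measurable q) (hq : MemLp q 2 π) : MemLp (semigroup κ r q) 2 π := by
  have := hX.isProbabilityMeasure
  have h1 : MemLp (fun ω => q (X (0 + r) ω)) 2 P := hq.comp_measurePreserving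
    (hX.measurePreserving _)
  have h2 := (memLp_congr_ae (hX.condExp_comp 0 r hqm (hq.integrable one_le_two))).1
    (h1.condExp (m := 𝓕 0) one_le_two)
  have h3 := (memLp_map_measure_iff (hX.measurable_semigroup r hqm).aestronglyMeasurable
    (hX.measurable 0).aemeasurable).2 h2
  rwa [hX.law] at h3

theorem integral_semigroup (hX : IsStationaryMarkov P 𝓕 κ X π) (r : ℝ≥0) {q : Vec d → ℝ}
    (hqm : Measurable q) (hq : Integrable q π) :
    ∫ x, semigroup κ r q x ∂π = ∫ x, q x ∂π := by
  have := hX.integral_mul_comp 0 r (Z := fun _ => 1) measurable_const (C := 1) (by simp) hqm hq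
  simp only [one_mul] at this
  rw [hX.integral_comp _ hq, hX.integral_comp _ (hX.integrable_semigroup r hq)] at this
  exact this.symm

end IsStationaryMarkov

namespace IsStationaryMarkov

variable {Ω : Type*} [MeasurableSpace Ω] {d : ℕ} {P : Measure Ω} [IsProbabilityMeasure P]
  {𝓕 : Filtration ℝ≥0 ‹MeasurableSpace Ω›} {κ : ℝ≥0 → Kernel (Vec d) (Vec d)}
  {X : ℝ≥0 → Ω → Vec d} {π : Measure (Vec d)}

/-- For bounded continuous functions this is continuity of paths with dominated convergence. A
general q is approximated in L¹(π), and stationarity makes the approximation error uniform in r. -/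
theorem tendsto_integral_mul_zero (hX : IsStationaryMarkov P 𝓕 κ X π) {q : Vec d → ℝ}
    (hq : Integrable q π) {Z : Ω → ℝ} (hZ : Measurable Z) (hZC : ∀ ω, |Z ω| ≤ 1) :
    Tendsto (fun r : ℝ≥0 => ∫ ω, Z ω * q (X r ω) ∂P) (𝓝 0) (𝓝 (∫ ω, Z ω * q (X 0 ω) ∂P)) := by
  have := hX.isProbabilityMeasure
  have hbd : ∀ {k : Ω → ℝ}, Integrable k P → Integrable (fun ω => Z ω * k ω) P := fun hk =>
    hk.bdd_mul (c := 1) hZ.aestronglyMeasurable (Eventually.of_forall hZC)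
  have hle : ∀ {k : Vec d → ℝ}, Integrable k π → ∀ r,
      |∫ ω, Z ω * k (X r ω) ∂P| ≤ ∫ x, |k x| ∂π := by
    intro k hk r
    rw [← hX.integral_comp r hk.abs]
    refine (abs_integral_le_integral_abs).trans ?_
    refine integral_mono (hbd (hX.integrable_comp r hk)).abs (hX.integrable_comp r hk.abs) fun ω => ?_
    simp only [abs_mul]
    exact mul_le_of_le_one_left (abs_nonneg _) (hZC ω)
  rw [Metric.tendsto_nhds]
  intro ε hε
  obtain ⟨φ, hφ, hφi⟩ := hq.exists_boundedContinuous_integral_sub_le (ε := ε / 4) (by linarith)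
  have hφt : Tendsto (fun r : ℝ≥0 => ∫ ω, Z ω * φ (X r ω) ∂P) (𝓝 0)
      (𝓝 (∫ ω, Z ω * φ (X 0 ω) ∂P)) := by
    refine tendsto_integral_filter_of_dominated_convergence (fun _ => ‖φ‖) ?_ ?_
      (integrable_const _) ?_
    · exact Eventually.of_forall fun r =>
        (hZ.mul (φ.continuous.measurable.comp (hX.measurable r))).aestronglyMeasurable
    · refine Eventually.of_forall fun r => Eventually.of_forall fun ω => ?_
      rw [norm_mul]
      exact (mul_le_of_le_one_left (norm_nonneg _) (hZC ω)).trans (φ.norm_coe_le_norm _)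
    · refine Eventually.of_forall fun ω => ?_
      exact ((φ.continuous.comp (hX.continuous_paths ω)).tendsto 0).const_mul (Z ω)
  filter_upwards [Metric.tendsto_nhds.1 hφt (ε / 4) (by linarith)] with r hr
  rw [Real.dist_eq] at hr ⊢
  have hsub : ∀ s, (∫ ω, Z ω * q (X s ω) ∂P) - ∫ ω, Z ω * φ (X s ω) ∂P
      = ∫ ω, Z ω * (q - φ) (X s ω) ∂P := by
    intro s
    rw [← integral_sub (hbd (hX.integrable_comp s hq)) (hbd (hX.integrable_comp s hφi))]
    simp [mul_sub]
  have h1 := hle (hq.sub hφi) r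
  have h2 := hle (hq.sub hφi) 0
  rw [← hsub] at h1 h2
  have h3 : ∫ x, |(q - φ) x| ∂π ≤ ε / 4 := hφ
  rw [abs_le] at h1 h2
  rw [abs_lt] at hr ⊢
  constructor <;> linarith

/-- If the integral of q over some `B` were negative, the integrand in r would be negative on a
short interval after 0, by continuity at 0, and so would its time integral. -/
theorem nonneg_of_integral_nonneg (hX : IsStationaryMarkov P 𝓕 κ X π) {q : Vec d → ℝ}
    (hqm : Measurable q) (hq : Integrable q π)
    (h : ∀ (B : Set (Vec d)), MeasurableSet B → ∀ t : ℝ≥0,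
      0 ≤ ∫ r in (0 : ℝ)..t, ∫ ω, (X 0 ⁻¹' B).indicator 1 ω * q (X r.toNNReal ω) ∂P) :
    0 ≤ᵐ[π] q := by
  refine ae_nonneg_of_forall_setIntegral_nonneg hq fun B hB _ => ?_
  have hB' : MeasurableSet (X 0 ⁻¹' B) := hX.measurable 0 hB
  set Z : Ω → ℝ := (X 0 ⁻¹' B).indicator 1 with hZdef
  have hZ : Measurable Z := measurable_one.indicator hB'
  have hZC : ∀ ω, |Z ω| ≤ 1 := fun ω => by
    by_cases hω : ω ∈ X 0 ⁻¹' B <;> simp [hZdef, hω]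
  have e : ∫ x in B, q x ∂π = ∫ ω, Z ω * q (X 0 ω) ∂P := by
    rw [← integral_indicator hB, ← hX.integral_comp 0 (hq.indicator hB)]
    refine integral_congr_ae (Eventually.of_forall fun ω => ?_)
    by_cases hω : X 0 ω ∈ B <;> simp [hZdef, hω]
  rw [e]
  by_contra! hneg
  have ht := hX.tendsto_integral_mul_zero hq hZ hZC
  obtain ⟨δ, hδ, hδ'⟩ := Metric.eventually_nhds_iff.1 (ht.eventually_lt_const hneg)
  have hlt : ∫ r in (0 : ℝ)..(δ / 2), ∫ ω, Z ω * q (X r.toNNReal ω) ∂P < 0 := by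
    have hI := hX.intervalIntegrable_integral_mul hqm hq hZ hZC 0 (δ / 2)
    have := intervalIntegral.intervalIntegral_pos_of_pos_on (hI.neg) (fun r hr => ?_)
      (by linarith : (0 : ℝ) < δ / 2)
    · simp only [Pi.neg_apply, intervalIntegral.integral_neg] at this
      linarith
    · have : dist r.toNNReal 0 < δ := by
        rw [NNReal.dist_eq, NNReal.coe_zero, sub_zero, Real.coe_toNNReal r hr.1.le,
          abs_of_pos hr.1]
        linarith [hr.2]
      simpa using hδ' this
  have := h B hB ⟨δ / 2, by linarith⟩
  exact absurd this (not_le.2 hlt)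

end IsStationaryMarkov

/-! ### Stopping on dyadic grids -/

/-- The `i`-th point of the dyadic grid of level `m` on `[0, t]`. -/
noncomputable def gridPoint (t : ℝ≥0) (m i : ℕ) : ℝ≥0 := t * i / 2 ^ m

theorem gridPoint_mono (t : ℝ≥0) (m : ℕ) : Monotone (gridPoint t m) := fun i j h => by
  unfold gridPoint
  gcongr

@[simp] theorem gridPoint_zero (t : ℝ≥0) (m : ℕ) : gridPoint t m 0 = 0 := by simp [gridPoint]

@[simp] theorem gridPoint_last (t : ℝ≥0) (m : ℕ) : gridPoint t m (2 ^ m) = t := by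
  simp [gridPoint]

theorem gridPoint_succ_two_mul (t : ℝ≥0) (m i : ℕ) :
    gridPoint t (m + 1) (2 * i) = gridPoint t m i := by
  unfold gridPoint
  rw [pow_succ]
  push_cast
  rw [mul_left_comm, mul_comm (2 ^ m : ℝ≥0) 2, mul_div_mul_left _ _ two_ne_zero]

section Exit

variable {V : Type*} (Z : ℝ≥0 → V) (K : Set V) (t : ℝ≥0) (m : ℕ)

/-- The first alternative makes the search stop at the last grid point, which caps the exit time at
`t`. -/
theorem exists_exit_index : ∃ i : ℕ, 2 ^ m ≤ i ∨ Z (gridPoint t m i) ∉ K := ⟨2 ^ m, Or.inl le_rfl⟩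

open Classical in
/-- The first index of the grid of level `m` at which the path `Z` is outside of `K`. -/
noncomputable def exitIndex : ℕ := Nat.find (exists_exit_index Z K t m)

/-- The first time on the grid of level `m` at which the path `Z` is outside of `K`, or `t`. -/
noncomputable def gridExit : ℝ≥0 := gridPoint t m (exitIndex Z K t m)

variable {Z K t m}

theorem lt_exitIndex_iff {i : ℕ} :
    i < exitIndex Z K t m ↔ ∀ j ≤ i, j < 2 ^ m ∧ Z (gridPoint t m j) ∈ K := by
  classical
  unfold exitIndex
  rw [Nat.lt_find_iff]
  simp only [not_or, not_le, not_not]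

theorem exitIndex_le : exitIndex Z K t m ≤ 2 ^ m := by
  classical
  exact Nat.find_min' _ (Or.inl le_rfl)

theorem gridExit_le : gridExit Z K t m ≤ t := by
  conv_rhs => rw [← gridPoint_last t m]
  exact gridPoint_mono t m exitIndex_le

/-- Point i of level m is point 2i of level m + 1, so a finer grid can only notice an exit earlier.
-/
theorem gridExit_succ_le : gridExit Z K t (m + 1) ≤ gridExit Z K t m := by
  classical
  unfold gridExit
  rw [← gridPoint_succ_two_mul t m]
  refine gridPoint_mono t _ ?_
  unfold exitIndex
  refine Nat.find_min' _ ?_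
  rw [gridPoint_succ_two_mul]
  rcases Nat.find_spec (exists_exit_index Z K t m) with h | h
  · left; rw [pow_succ, mul_comm]; gcongr
  · exact Or.inr h

theorem gridExit_antitone : Antitone (gridExit Z K t) :=
  antitone_nat_of_succ_le fun _ => gridExit_succ_le

variable (Z K t)

/-- The limit of the exit times from `K` along the dyadic grids on `[0, t]`. -/
noncomputable def exitTime : ℝ≥0 := ⨅ m, gridExit Z K t m

theorem tendsto_gridExit : Tendsto (gridExit Z K t) atTop (𝓝 (exitTime Z K t)) :=
  tendsto_atTop_ciInf gridExit_antitone (OrderBot.bddBelow _)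

variable {Z K t}

theorem exitTime_le_gridExit (m : ℕ) : exitTime Z K t ≤ gridExit Z K t m :=
  ciInf_le (OrderBot.bddBelow _) m

theorem exitTime_le : exitTime Z K t ≤ t := (exitTime_le_gridExit 0).trans gridExit_le

theorem exitTime_eq (h : ∀ s ≤ t, Z s ∈ K) : exitTime Z K t = t := by
  classical
  refine le_antisymm exitTime_le (le_ciInf fun m => ?_)
  have : exitIndex Z K t m = 2 ^ m := by
    refine le_antisymm exitIndex_le ?_
    by_contra! hlt
    unfold exitIndex at hlt
    rcases Nat.find_spec (exists_exit_index Z K t m) with h' | h'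
    · exact absurd hlt (not_lt.2 h')
    · refine h' (h _ ?_)
      conv_rhs => rw [← gridPoint_last t m]
      exact gridPoint_mono t m hlt.le
  rw [gridExit, this, gridPoint_last]

/-- The last grid point of level m before `s` precedes the exit on that grid, so the path is in `K`
there. These points tend to `s`, and `K` is closed. -/
theorem mem_of_lt_exitTime [TopologicalSpace V] (hZ : Continuous Z) (hK : IsClosed K) {s : ℝ≥0}
    (hs : s < exitTime Z K t) : Z s ∈ K := by
  have ht : 0 < t := (zero_le).trans_lt (hs.trans_le exitTime_le)
  let i : ℕ → ℕ := fun m => ⌊s * 2 ^ m / t⌋₊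
  have hle : ∀ m, gridPoint t m (i m) ≤ s := fun m => by
    have h1 : ((i m : ℕ) : ℝ≥0) ≤ s * 2 ^ m / t := Nat.floor_le zero_le
    unfold gridPoint
    rw [div_le_iff₀ (by positivity)]
    rw [le_div_iff₀ ht] at h1
    rwa [mul_comm]
  have hlt : ∀ m, s ≤ gridPoint t m (i m) + t / 2 ^ m := fun m => by
    have h1 : s * 2 ^ m / t < (i m : ℕ) + 1 := Nat.lt_floor_add_one _
    unfold gridPoint
    rw [div_lt_iff₀ ht] at h1
    rw [← add_div, le_div_iff₀ (by positivity)]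
    refine h1.le.trans (le_of_eq ?_)
    ring
  have hmem : ∀ m, Z (gridPoint t m (i m)) ∈ K := fun m => by
    have h1 : gridPoint t m (i m) < gridPoint t m (exitIndex Z K t m) :=
      (hle m).trans_lt (hs.trans_le (exitTime_le_gridExit m))
    have h2 : i m < exitIndex Z K t m := by
      by_contra! h
      exact absurd h1 (not_lt.2 (gridPoint_mono t m h))
    exact (lt_exitIndex_iff.1 h2 _ le_rfl).2
  have hlim : Tendsto (fun m => gridPoint t m (i m)) atTop (𝓝 s) := by
    have h0 : Tendsto (fun m : ℕ => s - t / 2 ^ m) atTop (𝓝 s) := by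
      have : Tendsto (fun m : ℕ => t / 2 ^ m) atTop (𝓝 0) := by
        have := (tendsto_pow_atTop_nhds_zero_of_lt_one (r := (1 / 2 : ℝ≥0)) zero_le
          (by rw [div_lt_one] <;> norm_num)).const_mul t
        simpa [div_eq_mul_inv] using this
      simpa using tendsto_const_nhds.sub this
    exact tendsto_of_tendsto_of_tendsto_of_le_of_le h0 tendsto_const_nhds
      (fun m => tsub_le_iff_right.2 (hlt m)) hle
  exact hK.mem_of_tendsto ((hZ.tendsto s).comp hlim) (Eventually.of_forall hmem)

/-- The exit time 0 has to be excluded: the path may then start outside of `K`. -/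
theorem mem_of_le_exitTime [TopologicalSpace V] (hZ : Continuous Z) (hK : IsClosed K) {s : ℝ≥0}
    (hs : s ≤ exitTime Z K t) (h0 : exitTime Z K t ≠ 0) : Z s ∈ K := by
  rcases hs.lt_or_eq with h | rfl
  · exact mem_of_lt_exitTime hZ hK h
  · have hne : (𝓝[<] (exitTime Z K t)).NeBot := by
      apply nhdsLT_neBot_of_exists_lt
      exact ⟨0, pos_of_ne_zero h0⟩
    exact hK.mem_of_tendsto (b := 𝓝[<] (exitTime Z K t))
      ((hZ.tendsto _).mono_left nhdsWithin_le_nhds)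
      (by filter_upwards [self_mem_nhdsWithin] with r hr using mem_of_lt_exitTime hZ hK hr)

end Exit

/-- A real process whose increments after any time `s ≤ t` have mean zero given the past. -/
def HasCenteredIncrements {Ω : Type*} [MeasurableSpace Ω] (P : Measure Ω)
    (𝓕 : Filtration ℝ≥0 ‹MeasurableSpace Ω›) (t : ℝ≥0) (Y : ℝ≥0 → Ω → ℝ) : Prop :=
  (∀ s, s ≤ t → Integrable (Y s) P) ∧ ∀ s s', s ≤ s' → s' ≤ t →
    ∀ A, MeasurableSet[𝓕 s] A → ∫ ω in A, (Y s' ω - Y s ω) ∂P = 0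

section Stopping

variable {Ω : Type*} [MeasurableSpace Ω] {P : Measure Ω}
  {𝓕 : Filtration ℝ≥0 ‹MeasurableSpace Ω›} {V : Type*} [TopologicalSpace V] [MeasurableSpace V]
  [BorelSpace V] {Z : ℝ≥0 → Ω → V} {K : Set V} {t : ℝ≥0} {Y : ℝ≥0 → Ω → ℝ}

/-- The decision to continue past grid point i uses only the path up to that point. This is what
makes optional stopping on the grid a finite sum of centered increments. -/
theorem measurableSet_lt_exitIndex (hZ : ∀ s, Measurable[𝓕 s] (Z s)) (hK : IsClosed K)
    (m i : ℕ) : MeasurableSet[𝓕 (gridPoint t m i)] {ω | i < exitIndex (Z · ω) K t m} := by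
  have : {ω | i < exitIndex (Z · ω) K t m}
      = ⋂ j ∈ Set.Iic i, {ω | j < 2 ^ m ∧ Z (gridPoint t m j) ω ∈ K} := by
    ext ω
    simp [lt_exitIndex_iff]
  rw [this]
  refine MeasurableSet.biInter (Set.to_countable _) fun j hj => ?_
  have h1 : MeasurableSet[𝓕 (gridPoint t m i)] (Z (gridPoint t m j) ⁻¹' K) :=
    𝓕.mono (gridPoint_mono t m hj) _ (hZ _ hK.measurableSet)
  exact (MeasurableSet.const (j < 2 ^ m)).inter h1

theorem gridExit_sub_eq_sum (m : ℕ) (ω : Ω) :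
    Y (gridExit (Z · ω) K t m) ω - Y 0 ω = ∑ i ∈ Finset.range (2 ^ m),
      {ω | i < exitIndex (Z · ω) K t m}.indicator
        (fun ω => Y (gridPoint t m (i + 1)) ω - Y (gridPoint t m i) ω) ω := by
  set J := exitIndex (Z · ω) K t m with hJ
  have h1 : Y (gridExit (Z · ω) K t m) ω - Y 0 ω
      = ∑ i ∈ Finset.range J, (Y (gridPoint t m (i + 1)) ω - Y (gridPoint t m i) ω) := by
    rw [Finset.sum_range_sub (fun i => Y (gridPoint t m i) ω), gridPoint_zero, gridExit]
  rw [h1, ← Finset.sum_subset (Finset.range_mono (exitIndex_le : J ≤ 2 ^ m))]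
  · refine Finset.sum_congr rfl fun i hi => ?_
    rw [Set.indicator_of_mem]
    exact Finset.mem_range.1 hi
  · intro i _ hi
    rw [Set.indicator_of_notMem]
    exact fun h => hi (Finset.mem_range.2 h)

/-- In the telescoped sum each increment is restricted to an event known at its left endpoint, so
each term has integral zero. No domination is needed on a finite grid. -/
theorem HasCenteredIncrements.gridExit (hY : HasCenteredIncrements P 𝓕 t Y)
    (hZ : ∀ s, Measurable[𝓕 s] (Z s)) (hK : IsClosed K) (m : ℕ) {A : Set Ω}
    (hA : MeasurableSet[𝓕 0] A) :
    Integrable (fun ω => Y (gridExit (Z · ω) K t m) ω - Y 0 ω) P ∧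
      ∫ ω in A, (Y (gridExit (Z · ω) K t m) ω - Y 0 ω) ∂P = 0 := by
  have hle : ∀ i, i ≤ 2 ^ m → gridPoint t m i ≤ t := fun i hi => by
    conv_rhs => rw [← gridPoint_last t m]
    exact gridPoint_mono t m hi
  have hS := fun i => measurableSet_lt_exitIndex (t := t) hZ hK m i
  have hint : ∀ i ∈ Finset.range (2 ^ m), Integrable
      ({ω | i < exitIndex (Z · ω) K t m}.indicator
        (fun ω => Y (gridPoint t m (i + 1)) ω - Y (gridPoint t m i) ω)) P := by
    intro i hi
    have hi := Finset.mem_range.1 hi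
    exact ((hY.1 _ (hle _ hi)).sub (hY.1 _ (hle _ hi.le))).indicator (𝓕.le _ _ (hS i))
  simp_rw [gridExit_sub_eq_sum]
  refine ⟨integrable_finsetSum _ hint, ?_⟩
  rw [integral_finsetSum _ fun i hi => (hint i hi).integrableOn]
  refine Finset.sum_eq_zero fun i hi => ?_
  have hi := Finset.mem_range.1 hi
  rw [setIntegral_indicator (𝓕.le _ _ (hS i))]
  exact hY.2 _ _ (gridPoint_mono t m i.le_succ) (hle _ hi) _
    ((𝓕.mono zero_le _ hA).inter (hS i))

/-- Optional stopping at exit times, for processes dominated by an integrable variable. -/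
theorem HasCenteredIncrements.exitTime (hY : HasCenteredIncrements P 𝓕 t Y)
    (hZ : ∀ s, Measurable[𝓕 s] (Z s)) (hK : IsClosed K)
    (hYc : ∀ᵐ ω ∂P, ContinuousOn (fun s => Y s ω) (Set.Iic t)) {G : Ω → ℝ} (hG : Integrable G P)
    (hYG : ∀ᵐ ω ∂P, ∀ s ≤ t, |Y s ω| ≤ G ω) {A : Set Ω} (hA : MeasurableSet[𝓕 0] A) :
    Integrable (fun ω => Y (exitTime (Z · ω) K t) ω - Y 0 ω) P ∧
      ∫ ω in A, (Y (exitTime (Z · ω) K t) ω - Y 0 ω) ∂P = 0 := by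
  have hlim : ∀ᵐ ω ∂P, Tendsto (fun m => Y (VIXInverse.gridExit (Z · ω) K t m) ω - Y 0 ω) atTop
      (𝓝 (Y (VIXInverse.exitTime (Z · ω) K t) ω - Y 0 ω)) := by
    filter_upwards [hYc] with ω hω
    refine Tendsto.sub_const ?_ _
    have h1 := hω _ (exitTime_le : VIXInverse.exitTime (Z · ω) K t ≤ t)
    refine h1.tendsto.comp (tendsto_nhdsWithin_iff.2 ⟨tendsto_gridExit _ _ _, ?_⟩)
    exact Eventually.of_forall fun m => gridExit_le
  have hm := fun m => (hY.gridExit hZ hK m hA).1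
  have hb : ∀ (s : Ω → ℝ≥0), (∀ ω, s ω ≤ t) → ∀ᵐ ω ∂P, ‖Y (s ω) ω - Y 0 ω‖ ≤ 2 * G ω := by
    intro s hs
    filter_upwards [hYG] with ω hω
    rw [Real.norm_eq_abs]
    have h1 := hω _ (hs ω)
    have h2 := hω 0 zero_le
    rw [abs_le] at *
    constructor <;> linarith
  have hsm : AEStronglyMeasurable
      (fun ω => Y (VIXInverse.exitTime (Z · ω) K t) ω - Y 0 ω) P :=
    aestronglyMeasurable_of_tendsto_ae atTop (fun m => (hm m).aestronglyMeasurable) hlim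
  refine ⟨Integrable.mono' (hG.const_mul 2) hsm (hb _ fun ω => exitTime_le), ?_⟩
  have hl := tendsto_integral_of_dominated_convergence (μ := P.restrict A) (fun ω => 2 * G ω)
    (fun m => (hm m).aestronglyMeasurable.restrict) (hG.const_mul 2).integrableOn
    (fun m => ae_restrict_of_ae (hb _ fun ω => gridExit_le)) (ae_restrict_of_ae hlim)
  simp_rw [fun m => (hY.gridExit hZ hK m hA).2] at hl
  exact (tendsto_nhds_unique hl tendsto_const_nhds)

end Stopping

/-! ### Martingales of finite variation -/

/-- The remainder of the first-order Taylor expansion of `√(1 + x²)`. -/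
theorem sqrt_one_add_sq_remainder (a b : ℝ) :
    √(1 + b ^ 2) - √(1 + a ^ 2) - a / √(1 + a ^ 2) * (b - a) ≤ min ((b - a) ^ 2 / 2) (2 * |b - a|) := by
  have ha : 1 ≤ √(1 + a ^ 2) := Real.one_le_sqrt.2 (by nlinarith [sq_nonneg a])
  have hb : 1 ≤ √(1 + b ^ 2) := Real.one_le_sqrt.2 (by nlinarith [sq_nonneg b])
  have ha2 : √(1 + a ^ 2) ^ 2 = 1 + a ^ 2 := Real.sq_sqrt (by positivity)
  have hb2 : √(1 + b ^ 2) ^ 2 = 1 + b ^ 2 := Real.sq_sqrt (by positivity)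
  set u := √(1 + a ^ 2)
  set v := √(1 + b ^ 2)
  have hu : 0 < u := by linarith
  have e : v - u - a / u * (b - a) = (u * v - 1 - a * b) / u := by
    field_simp
    linear_combination (-1 : ℝ) * ha2
  refine le_min ?_ ?_
  -- From 2uv ≤ u² + v² = 2 + a² + b² the numerator is at most (b − a)²/2, and u ≥ 1.
  · rw [e, div_le_iff₀ hu]
    nlinarith [sq_nonneg (u - v), sq_nonneg (b - a)]
  · have h1 : v - u ≤ |b - a| := by
      have h3 : v ≤ u + |b - a| := by
        refine abs_le_of_sq_le_sq' ?_ (by positivity) |>.2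
        have h4 : a * (b - a) ≤ u * |b - a| := by
          have : |a| ≤ u := abs_le_of_sq_le_sq (by rw [ha2]; linarith) hu.le
          calc a * (b - a) ≤ |a * (b - a)| := le_abs_self _
            _ = |a| * |b - a| := abs_mul _ _
            _ ≤ _ := by gcongr
        nlinarith [sq_abs (b - a)]
      linarith
    have h2 : -(a / u * (b - a)) ≤ |b - a| := by
      refine (neg_le_abs _).trans ?_
      rw [abs_mul, abs_div, abs_of_pos hu]
      refine mul_le_of_le_one_left (abs_nonneg _) ?_
      rw [div_le_one hu]
      exact abs_le_of_sq_le_sq (by rw [ha2]; linarith) hu.le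
    linarith

section Discrete

variable (x : ℕ → ℝ)

/-- The variation of a sequence up to the index `n`. -/
def seqVariation (n : ℕ) : ℝ := ∑ i ∈ Finset.range n, |x (i + 1) - x i|

theorem seqVariation_succ (n : ℕ) : seqVariation x (n + 1) = seqVariation x n + |x (n + 1) - x n| :=
  Finset.sum_range_succ _ _

theorem seqVariation_mono : Monotone (seqVariation x) :=
  monotone_nat_of_le_succ fun n => by
    rw [seqVariation_succ]; linarith [abs_nonneg (x (n + 1) - x n)]

theorem abs_le_seqVariation (h0 : x 0 = 0) (n : ℕ) : |x n| ≤ seqVariation x n := by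
  induction n with
  | zero => simp [h0, seqVariation]
  | succ n ih =>
    rw [seqVariation_succ]
    calc |x (n + 1)| = |x n + (x (n + 1) - x n)| := by ring_nf
      _ ≤ |x n| + |x (n + 1) - x n| := abs_add_le _ _
      _ ≤ _ := by linarith

open Classical in
-- Only steps that begin while the variation is at most `K` count, so the sum can overshoot `K` by
-- at most one small step. The induction carries the minimum of this bound and the variation itself.
theorem sum_small_le {K δ : ℝ} (hδ : 0 ≤ δ) (hK : 0 ≤ K) (n : ℕ) :
    ∑ i ∈ Finset.range n, (if seqVariation x i ≤ K ∧ |x (i + 1) - x i| ≤ δ then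
      |x (i + 1) - x i| else 0) ≤ K + δ := by
  have key : ∀ n, ∑ i ∈ Finset.range n, (if seqVariation x i ≤ K ∧ |x (i + 1) - x i| ≤ δ then
      |x (i + 1) - x i| else 0) ≤ min (seqVariation x n) (K + δ) := by
    intro n
    induction n with
    | zero => simp [seqVariation]; linarith
    | succ n ih =>
      have h1 := ih.trans (min_le_left _ _)
      have h2 := ih.trans (min_le_right _ _)
      have h3 := abs_nonneg (x (n + 1) - x n)
      rw [Finset.sum_range_succ, seqVariation_succ]
      split_ifs with h
      · exact le_min (by linarith) (by linarith [h.1, h.2])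
      · exact le_min (by linarith) (by linarith)
  exact (key n).trans (min_le_right _ _)

open Classical in
-- Every large step uses up more than `δ` of the variation, so at most `K / δ + 1` of them can begin
-- before the variation exceeds `K`.
theorem sum_big_le {K δ : ℝ} (hδ : 0 < δ) (hK : 0 ≤ K) (n : ℕ) :
    ∑ i ∈ Finset.range n, (if seqVariation x i ≤ K ∧ δ < |x (i + 1) - x i| then (1 : ℝ) else 0)
      ≤ (K / δ + 1) * (if ∃ i < n, δ < |x (i + 1) - x i| then 1 else 0) := by
  by_cases hB : ∃ i < n, δ < |x (i + 1) - x i|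
  · rw [if_pos hB, mul_one]
    have key : ∀ n, ∑ i ∈ Finset.range n, (if seqVariation x i ≤ K ∧ δ < |x (i + 1) - x i| then
        (1 : ℝ) else 0) ≤ min (seqVariation x n / δ) (K / δ + 1) := by
      intro n
      induction n with
      | zero => simp [seqVariation]; positivity
      | succ n ih =>
        have h1 := ih.trans (min_le_left _ _)
        have h2 := ih.trans (min_le_right _ _)
        have h3 : 0 ≤ |x (n + 1) - x n| / δ := by positivity
        rw [Finset.sum_range_succ, seqVariation_succ, add_div]
        split_ifs with h
        · have h4 : 1 ≤ |x (n + 1) - x n| / δ := (one_le_div hδ).2 h.2.le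
          have h5 : seqVariation x n / δ ≤ K / δ := by gcongr; exact h.1
          exact le_min (by linarith) (by linarith)
        · exact le_min (by linarith) (by linarith)
    exact (key n).trans (min_le_right _ _)
  · rw [if_neg hB, mul_zero]
    refine le_of_eq (Finset.sum_eq_zero fun i hi => if_neg fun h => hB ⟨i, Finset.mem_range.1 hi, h.2⟩)

end Discrete

section Martingale

variable {Ω : Type*} [MeasurableSpace Ω] {P : Measure Ω} [IsProbabilityMeasure P]

theorem martingale_seqVariation_measurable {𝓖 : Filtration ℕ ‹MeasurableSpace Ω›} {M : ℕ → Ω → ℝ}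
    (hM : Martingale M 𝓖 P) (i : ℕ) : Measurable[𝓖 i] fun ω => seqVariation (M · ω) i := by
  refine Finset.measurable_sum _ fun j hj => ?_
  have hj := Finset.mem_range.1 hj
  have h1 : Measurable[𝓖 i] (M (j + 1)) :=
    ((hM.stronglyAdapted (j + 1)).mono (𝓖.mono hj)).measurable
  have h2 : Measurable[𝓖 i] (M j) := ((hM.stronglyAdapted j).mono (𝓖.mono hj.le)).measurable
  exact continuous_abs.measurable.comp (h1.sub h2)

/-- The function √(1 + x²) − 1 has linear growth, so no second moments are needed, and its
derivative is bounded. The first-order Taylor term is a bounded known factor times a martingale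
increment and averages to zero on the event known at step i. These events decrease in i, so passing
to the next one only lowers the integral of a non-negative function. -/
theorem martingale_sqrt_bound {𝓖 : Filtration ℕ ‹MeasurableSpace Ω›} {M : ℕ → Ω → ℝ}
    (hM : Martingale M 𝓖 P) (h0 : ∀ ω, M 0 ω = 0) (K : ℝ) (n : ℕ) :
    ∫ ω in {ω | seqVariation (M · ω) n ≤ K}, (√(1 + M n ω ^ 2) - 1) ∂P ≤
      ∑ i ∈ Finset.range n, ∫ ω in {ω | seqVariation (M · ω) i ≤ K},
        min ((M (i + 1) ω - M i ω) ^ 2 / 2) (2 * |M (i + 1) ω - M i ω|) ∂P := by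
  have hmeas : ∀ i, Measurable (M i) := fun i =>
    ((hM.stronglyAdapted i).mono (𝓖.le i)).measurable
  have hE : ∀ i, MeasurableSet[𝓖 i] {ω | seqVariation (M · ω) i ≤ K} := fun i =>
    (martingale_seqVariation_measurable hM i) measurableSet_Iic
  have hψ0 : ∀ x : ℝ, 0 ≤ √(1 + x ^ 2) - 1 := fun x => by
    rw [sub_nonneg]; exact Real.one_le_sqrt.2 (by nlinarith [sq_nonneg x])
  have hψi : ∀ i, Integrable (fun ω => √(1 + M i ω ^ 2) - 1) P := fun i => by
    refine (hM.integrable i).abs.mono' ?_ (Eventually.of_forall fun ω => ?_)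
    · exact ((((hmeas i).pow_const 2).const_add 1).sqrt.sub_const 1).aestronglyMeasurable
    · rw [Real.norm_eq_abs, abs_of_nonneg (hψ0 _), sub_le_iff_le_add, Real.sqrt_le_left (by positivity)]
      nlinarith [sq_abs (M i ω), abs_nonneg (M i ω)]
  have hd : ∀ i, Integrable (fun ω => M (i + 1) ω - M i ω) P := fun i =>
    (hM.integrable _).sub (hM.integrable _)
  have hmin : ∀ i, Integrable (fun ω =>
      min ((M (i + 1) ω - M i ω) ^ 2 / 2) (2 * |M (i + 1) ω - M i ω|)) P := fun i => by
    refine ((hd i).abs.const_mul 2).mono' ?_ (Eventually.of_forall fun ω => ?_)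
    · have := (hmeas (i + 1)).sub (hmeas i)
      exact (((this.pow_const 2).div_const 2).min (this.abs.const_mul 2)).aestronglyMeasurable
    · rw [Real.norm_eq_abs, abs_of_nonneg (le_min (by positivity) (by positivity))]
      exact min_le_right _ _
  have hφm : ∀ i, Measurable[𝓖 i] fun ω => M i ω / √(1 + M i ω ^ 2) := fun i => by
    have := (hM.stronglyAdapted i).measurable
    exact this.div ((this.pow_const 2).const_add 1).sqrt
  have hφb : ∀ i ω, |M i ω / √(1 + M i ω ^ 2)| ≤ 1 := fun i ω => by
    rw [abs_div, abs_of_nonneg (Real.sqrt_nonneg _)]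
    exact div_le_one_of_le₀ (Real.le_sqrt_of_sq_le (by rw [sq_abs]; linarith)) (Real.sqrt_nonneg _)
  have hzi : ∀ i, Integrable (fun ω => M i ω / √(1 + M i ω ^ 2) * (M (i + 1) ω - M i ω)) P :=
    fun i => (hd i).bdd_mul (c := 1) ((hφm i).mono (𝓖.le i) le_rfl).aestronglyMeasurable
      (Eventually.of_forall (hφb i))
  have hz : ∀ i, ∫ ω in {ω | seqVariation (M · ω) i ≤ K},
      M i ω / √(1 + M i ω ^ 2) * (M (i + 1) ω - M i ω) ∂P = 0 := by
    intro i
    rw [← setIntegral_condExp (𝓖.le i) (hzi i) (hE i)]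
    have h1 := condExp_mul_of_stronglyMeasurable_left (m := 𝓖 i) (hφm i).stronglyMeasurable
      (hzi i) (hd i)
    have h2 : P[fun ω => M (i + 1) ω - M i ω | 𝓖 i] =ᵐ[P] 0 := by
      have h3 := condExp_sub (hM.integrable (i + 1)) (hM.integrable i) (𝓖 i)
      refine h3.trans ?_
      filter_upwards [hM.condExp_ae_eq i.le_succ, hM.condExp_ae_eq (le_refl i)] with ω ha hb
      simp [ha, hb]
    refine setIntegral_eq_zero_of_ae_eq_zero ?_
    filter_upwards [h1, h2] with ω ha hb _
    change (P[(fun ω => M i ω / √(1 + M i ω ^ 2)) * fun ω => M (i + 1) ω - M i ω | 𝓖 i]) ω = 0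
    rw [ha, Pi.mul_apply, hb, Pi.zero_apply, mul_zero]
  induction n with
  | zero => simp [h0]
  | succ n ih =>
    rw [Finset.sum_range_succ]
    have hsub : {ω | seqVariation (M · ω) (n + 1) ≤ K} ⊆ {ω | seqVariation (M · ω) n ≤ K} :=
      fun ω h => (seqVariation_mono (M · ω) n.le_succ).trans h
    calc ∫ ω in {ω | seqVariation (M · ω) (n + 1) ≤ K}, (√(1 + M (n + 1) ω ^ 2) - 1) ∂P
        ≤ ∫ ω in {ω | seqVariation (M · ω) n ≤ K}, (√(1 + M (n + 1) ω ^ 2) - 1) ∂P :=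
          setIntegral_mono_set (hψi _).integrableOn (Eventually.of_forall fun ω => hψ0 _)
            (Eventually.of_forall hsub)
      _ ≤ ∫ ω in {ω | seqVariation (M · ω) n ≤ K}, ((√(1 + M n ω ^ 2) - 1)
            + min ((M (n + 1) ω - M n ω) ^ 2 / 2) (2 * |M (n + 1) ω - M n ω|)
            + M n ω / √(1 + M n ω ^ 2) * (M (n + 1) ω - M n ω)) ∂P := by
          refine integral_mono (hψi _).integrableOn
            (((hψi _).add (hmin _)).add (hzi _)).integrableOn fun ω => ?_
          have := sqrt_one_add_sq_remainder (M n ω) (M (n + 1) ω)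
          simp only
          linarith
      _ = ∫ ω in {ω | seqVariation (M · ω) n ≤ K}, (√(1 + M n ω ^ 2) - 1) ∂P
            + ∫ ω in {ω | seqVariation (M · ω) n ≤ K},
              min ((M (n + 1) ω - M n ω) ^ 2 / 2) (2 * |M (n + 1) ω - M n ω|) ∂P := by
          refine (integral_add ((hψi n).add (hmin n)).integrableOn (hzi n).integrableOn).trans ?_
          rw [hz, add_zero]
          exact integral_add (hψi n).integrableOn (hmin n).integrableOn
      _ ≤ _ := by linarith

open Classical in
/-- A quantitative bound for discrete martingales: the martingale is small on the event that its
variation is at most `K`, up to increments larger than `δ`. -/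
theorem martingale_variation_bound {𝓖 : Filtration ℕ ‹MeasurableSpace Ω›} {M : ℕ → Ω → ℝ}
    (hM : Martingale M 𝓖 P) (h0 : ∀ ω, M 0 ω = 0) {K δ : ℝ} (hK : 0 ≤ K) (hδ : 0 < δ) (n : ℕ) :
    ∫ ω in {ω | seqVariation (M · ω) n ≤ K}, (√(1 + M n ω ^ 2) - 1) ∂P ≤
      δ / 2 * (K + δ) + 2 * (K / δ + 1) *
        ∫ ω in {ω | ∃ i < n, δ < |M (i + 1) ω - M i ω|}, (K + |M n ω|) ∂P := by
  have hmeas : ∀ i, Measurable (M i) := fun i =>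
    ((hM.stronglyAdapted i).mono (𝓖.le i)).measurable
  have hE : ∀ i, MeasurableSet[𝓖 i] {ω | seqVariation (M · ω) i ≤ K} := fun i =>
    (martingale_seqVariation_measurable hM i) measurableSet_Iic
  have hB : ∀ i, MeasurableSet[𝓖 (i + 1)] {ω | δ < |M (i + 1) ω - M i ω|} := fun i => by
    have h1 := (hM.stronglyAdapted (i + 1)).measurable
    have h2 := ((hM.stronglyAdapted i).mono (𝓖.mono i.le_succ)).measurable
    exact (continuous_abs.measurable.comp (h1.sub h2)) measurableSet_Ioi
  have hS : ∀ i, MeasurableSet[𝓖 (i + 1)]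
      {ω | seqVariation (M · ω) i ≤ K ∧ δ < |M (i + 1) ω - M i ω|} := fun i =>
    (𝓖.mono i.le_succ _ (hE i)).inter (hB i)
  have hs : ∀ i, MeasurableSet
      {ω | seqVariation (M · ω) i ≤ K ∧ |M (i + 1) ω - M i ω| ≤ δ} := fun i =>
    (𝓖.le _ _ (hE i)).inter (((hmeas _).sub (hmeas _)).abs measurableSet_Iic)
  have hd : ∀ i, Integrable (fun ω => |M (i + 1) ω - M i ω|) P := fun i =>
    ((hM.integrable _).sub (hM.integrable _)).abs
  have hKi : ∀ i, Integrable (fun ω => K + |M i ω|) P := fun i =>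
    (integrable_const K).add (hM.integrable i).abs
  -- Small increments use the quadratic branch of the minimum, with one factor bounded by `δ`. Large
  -- ones use the linear branch, with |M_i| bounded by the variation and so by `K`.
  have hstep : ∀ i < n, ∫ ω in {ω | seqVariation (M · ω) i ≤ K},
      min ((M (i + 1) ω - M i ω) ^ 2 / 2) (2 * |M (i + 1) ω - M i ω|) ∂P ≤
      ∫ ω, (δ / 2 * {ω | seqVariation (M · ω) i ≤ K ∧ |M (i + 1) ω - M i ω| ≤ δ}.indicator
          (fun ω => |M (i + 1) ω - M i ω|) ω +
        2 * {ω | seqVariation (M · ω) i ≤ K ∧ δ < |M (i + 1) ω - M i ω|}.indicator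
          (fun ω => K + |M n ω|) ω) ∂P := by
    intro i hi
    have hi1 := ((hd i).indicator (hs i)).const_mul (δ / 2)
    have hi2 := ((hKi n).indicator (𝓖.le _ _ (hS i))).const_mul 2
    have hi3 := ((hKi (i + 1)).indicator (𝓖.le _ _ (hS i))).const_mul 2
    calc _ ≤ ∫ ω, (δ / 2 * {ω | seqVariation (M · ω) i ≤ K ∧ |M (i + 1) ω - M i ω| ≤ δ}.indicator
          (fun ω => |M (i + 1) ω - M i ω|) ω +
        2 * {ω | seqVariation (M · ω) i ≤ K ∧ δ < |M (i + 1) ω - M i ω|}.indicator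
          (fun ω => K + |M (i + 1) ω|) ω) ∂P := by
          rw [← integral_indicator (𝓖.le _ _ (hE i))]
          refine integral_mono_of_nonneg (Eventually.of_forall fun ω => ?_) (hi1.add hi3)
            (Eventually.of_forall fun ω => ?_)
          · exact Set.indicator_nonneg (fun ω _ => le_min (by positivity) (by positivity)) _
          · simp only [Set.indicator_apply, Set.mem_ofPred_eq]
            by_cases h1 : seqVariation (M · ω) i ≤ K
            · rcases le_or_gt (|M (i + 1) ω - M i ω|) δ with h2 | h2
              · simp only [h1, h2, and_self, if_true, not_lt.2 h2, and_false, if_false, mul_zero,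
                  add_zero]
                refine (min_le_left _ _).trans ?_
                rw [← sq_abs]
                nlinarith [abs_nonneg (M (i + 1) ω - M i ω)]
              · simp only [h1, h2, and_self, if_true, not_le.2 h2, and_false, if_false, mul_zero,
                  zero_add]
                refine (min_le_right _ _).trans ?_
                have h3 := abs_le_seqVariation (M · ω) (h0 ω) i
                have h4 := abs_sub (M (i + 1) ω) (M i ω)
                linarith
            · simp [h1]
      _ ≤ _ := by
          rw [integral_add hi1 hi3, integral_add hi1 hi2, integral_const_mul, integral_const_mul,
            integral_const_mul, integral_indicator (𝓖.le _ _ (hS i)),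
            integral_indicator (𝓖.le _ _ (hS i))]
          -- The event is known at step i + 1, so the submartingale property of |M| replaces
          -- |M_{i+1}| by the terminal |M_n|. All large increments then carry one common weight,
          -- which can be counted with `sum_big_le`.
          have h5 : ∫ ω in {ω | seqVariation (M · ω) i ≤ K ∧ δ < |M (i + 1) ω - M i ω|},
              |M (i + 1) ω| ∂P ≤
              ∫ ω in {ω | seqVariation (M · ω) i ≤ K ∧ δ < |M (i + 1) ω - M i ω|}, |M n ω| ∂P := by
            refine le_trans (le_of_eq ?_) (setIntegral_abs_condExp_le (m := 𝓖 (i + 1)) (hS i) (M n))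
            refine setIntegral_congr_ae (𝓖.le _ _ (hS i)) ?_
            filter_upwards [hM.condExp_ae_eq (Nat.succ_le_of_lt hi)] with ω hω _
            rw [hω]
          have h6 : ∀ k, ∫ ω in {ω | seqVariation (M · ω) i ≤ K ∧ δ < |M (i + 1) ω - M i ω|},
              (K + |M k ω|) ∂P
              = ∫ ω in {ω | seqVariation (M · ω) i ≤ K ∧ δ < |M (i + 1) ω - M i ω|}, K ∂P
              + ∫ ω in {ω | seqVariation (M · ω) i ≤ K ∧ δ < |M (i + 1) ω - M i ω|}, |M k ω| ∂P :=
            fun k => integral_add (integrable_const K).integrableOn (hM.integrable k).abs.integrableOn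
          rw [h6, h6]
          linarith
  refine (martingale_sqrt_bound hM h0 K n).trans
    ((Finset.sum_le_sum fun i hi => hstep i (Finset.mem_range.1 hi)).trans ?_)
  have hBn : MeasurableSet {ω | ∃ i < n, δ < |M (i + 1) ω - M i ω|} := by
    have : {ω | ∃ i < n, δ < |M (i + 1) ω - M i ω|}
        = ⋃ i ∈ Set.Iio n, {ω | δ < |M (i + 1) ω - M i ω|} := by ext ω; simp
    rw [this]
    exact MeasurableSet.biUnion (Set.to_countable _) fun i _ => 𝓖.le _ _ (hB i)
  refine (integral_finsetSum _ fun i _ => (((hd i).indicator (hs i)).const_mul (δ / 2)).add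
    (((hKi n).indicator (𝓖.le _ _ (hS i))).const_mul 2)).symm.le.trans ?_
  rw [← integral_indicator hBn, ← integral_const_mul]
  have hr : Integrable (fun ω => 2 * (K / δ + 1) *
      {ω | ∃ i < n, δ < |M (i + 1) ω - M i ω|}.indicator (fun ω => K + |M n ω|) ω) P :=
    ((hKi n).indicator hBn).const_mul _
  have hc : δ / 2 * (K + δ) = ∫ _ω, δ / 2 * (K + δ) ∂P := by simp
  rw [hc, ← integral_add (integrable_const _) hr]
  refine integral_mono_of_nonneg (Eventually.of_forall fun ω => ?_) ((integrable_const _).add hr)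
    (Eventually.of_forall fun ω => ?_)
  · refine Finset.sum_nonneg fun i _ => add_nonneg (mul_nonneg (by positivity) ?_)
      (mul_nonneg (by positivity) ?_)
    · exact Set.indicator_nonneg (fun ω _ => abs_nonneg _) _
    · exact Set.indicator_nonneg (fun ω _ => by positivity) _
  · simp only [Pi.add_apply, Finset.sum_add_distrib, ← Finset.mul_sum]
    have h1 := sum_small_le (M · ω) hδ.le hK n
    have h2 := sum_big_le (M · ω) hδ hK n
    refine add_le_add ?_ ?_
    · gcongr
      simpa only [Set.indicator_apply, Set.mem_ofPred_eq] using h1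
    · rw [mul_assoc]
      gcongr
      have h3 : ∀ i, {ω | seqVariation (M · ω) i ≤ K ∧ δ < |M (i + 1) ω - M i ω|}.indicator
          (fun ω => K + |M n ω|) ω = (if seqVariation (M · ω) i ≤ K ∧ δ < |M (i + 1) ω - M i ω|
            then (1 : ℝ) else 0) * (K + |M n ω|) := fun i => by
        simp only [Set.indicator_apply, Set.mem_ofPred_eq, ite_mul, one_mul, zero_mul]
      simp only [h3, ← Finset.sum_mul]
      refine (mul_le_mul_of_nonneg_right h2 (by positivity)).trans (le_of_eq ?_)
      simp only [Set.indicator_apply, Set.mem_ofPred_eq, mul_assoc, ite_mul, one_mul, zero_mul]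

end Martingale

/-- The discrete bound is applied on dyadic grids, on the event that all grid variations are at most
`K`. Refining the grid removes the large increments, then `δ` tends to 0, so M_T = 0 on that event.
Since A(T) − A(0) bounds every grid variation, these events exhaust the space up to a null set as
`K` grows. -/
theorem martingale_eq_zero_of_finite_variation {Ω : Type*} [MeasurableSpace Ω] {P : Measure Ω}
    [IsProbabilityMeasure P] {𝓕 : Filtration ℝ≥0 ‹MeasurableSpace Ω›} {M : ℝ≥0 → Ω → ℝ}
    (hM : Martingale M 𝓕 P) (h0 : ∀ ω, M 0 ω = 0)
    (hA : ∀ᵐ ω ∂P, ∃ A : ℝ≥0 → ℝ, Continuous A ∧ Monotone A ∧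
      ∀ s t, s ≤ t → |M t ω - M s ω| ≤ A t - A s) (T : ℝ≥0) : M T =ᵐ[P] 0 := by
  have hMm : ∀ t, Measurable (M t) := fun t => ((hM.stronglyAdapted t).mono (𝓕.le t)).measurable
  let 𝓖 : ℕ → Filtration ℕ ‹MeasurableSpace Ω› := fun m =>
    ⟨fun i => 𝓕 (gridPoint T m i), fun i j h => 𝓕.mono (gridPoint_mono T m h), fun i => 𝓕.le _⟩
  have hG : ∀ m, Martingale (fun i => M (gridPoint T m i)) (𝓖 m) P := fun m =>
    ⟨fun i => hM.stronglyAdapted _, fun i j h => hM.condExp_ae_eq (gridPoint_mono T m h)⟩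
  let V : ℕ → Ω → ℝ := fun m ω => seqVariation (fun i => M (gridPoint T m i) ω) (2 ^ m)
  have hVm : ∀ m, Measurable (V m) := fun m =>
    (martingale_seqVariation_measurable (hG m) (2 ^ m)).mono ((𝓖 m).le _) le_rfl
  let B : ℝ → ℕ → Set Ω := fun δ m =>
    {ω | ∃ i < 2 ^ m, δ < |M (gridPoint T m (i + 1)) ω - M (gridPoint T m i) ω|}
  have hBm : ∀ δ m, MeasurableSet (B δ m) := fun δ m => by
    have : B δ m = ⋃ i ∈ Set.Iio (2 ^ m),
        {ω | δ < |M (gridPoint T m (i + 1)) ω - M (gridPoint T m i) ω|} := by ext ω; simp [B]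
    rw [this]
    exact MeasurableSet.biUnion (Set.to_countable _) fun i _ =>
      ((hMm _).sub (hMm _)).abs measurableSet_Ioi
  have hψ0 : ∀ x : ℝ, 0 ≤ √(1 + x ^ 2) - 1 := fun x => by
    rw [sub_nonneg]; exact Real.one_le_sqrt.2 (by nlinarith [sq_nonneg x])
  have hψi : Integrable (fun ω => √(1 + M T ω ^ 2) - 1) P := by
    refine (hM.integrable T).abs.mono' ?_ (Eventually.of_forall fun ω => ?_)
    · exact ((((hMm T).pow_const 2).const_add 1).sqrt.sub_const 1).aestronglyMeasurable
    · rw [Real.norm_eq_abs, abs_of_nonneg (hψ0 _), sub_le_iff_le_add, Real.sqrt_le_left (by positivity)]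
      nlinarith [sq_abs (M T ω), abs_nonneg (M T ω)]
  -- Uniform continuity of `A` on [0, T] rules out increments above `δ` once the mesh is small,
  -- pathwise; the integrals vanish by dominated convergence.
  have hbig : ∀ δ > 0, ∀ K : ℝ, Tendsto (fun m => ∫ ω in B δ m, (K + |M T ω|) ∂P) atTop (𝓝 0) := by
    intro δ hδ K
    have hKi : Integrable (fun ω => K + |M T ω|) P :=
      (integrable_const K).add (hM.integrable T).abs
    have := tendsto_integral_of_dominated_convergence (μ := P)
      (F := fun m => (B δ m).indicator fun ω => K + |M T ω|) (f := fun _ => 0)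
      (fun ω => ‖K + |M T ω|‖) (fun m => (hKi.indicator (hBm δ m)).aestronglyMeasurable) hKi.norm
      (fun m => Eventually.of_forall fun ω => norm_indicator_le_norm_self _ _) ?_
    · simp only [integral_zero] at this
      simpa only [integral_indicator (hBm δ _)] using this
    · filter_upwards [hA] with ω ⟨A, hAc, hAm, hAb⟩
      have huc : UniformContinuousOn A (Set.Icc 0 T) :=
        isCompact_Icc.uniformContinuousOn_of_continuous hAc.continuousOn
      obtain ⟨η, hη, hη'⟩ := Metric.uniformContinuousOn_iff.1 huc δ hδ
      have hmesh : ∀ᶠ m : ℕ in atTop, (T : ℝ) / 2 ^ m < η := by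
        have h1 : Tendsto (fun m : ℕ => (T : ℝ) * (1 / 2) ^ m) atTop (𝓝 ((T : ℝ) * 0)) :=
          (tendsto_pow_atTop_nhds_zero_of_lt_one (by norm_num) (by norm_num)).const_mul _
        rw [mul_zero] at h1
        filter_upwards [h1.eventually_lt_const hη] with m hm
        simpa [div_eq_mul_inv] using hm
      refine tendsto_const_nhds.congr' ?_
      filter_upwards [hmesh] with m hm
      rw [Set.indicator_of_notMem]
      rintro ⟨i, hi, hlt⟩
      have hle := hAb _ _ (gridPoint_mono T m i.le_succ)
      have hT : ∀ j ≤ 2 ^ m, gridPoint T m j ∈ Set.Icc 0 T := fun j hj =>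
        ⟨zero_le, by conv_rhs => rw [← gridPoint_last T m]
                     exact gridPoint_mono T m hj⟩
      have hd : dist (gridPoint T m (i + 1)) (gridPoint T m i) < η := by
        refine lt_of_eq_of_lt ?_ hm
        rw [NNReal.dist_eq]
        unfold gridPoint
        push_cast
        rw [← sub_div, ← mul_sub, add_sub_cancel_left, mul_one, abs_of_nonneg (by positivity)]
      have := hη' _ (hT _ hi) _ (hT _ hi.le) hd
      rw [Real.dist_eq] at this
      have h3 := le_abs_self (A (gridPoint T m (i + 1)) - A (gridPoint T m i))
      simp only [Nat.succ_eq_add_one] at hle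
      linarith
  have hS : ∀ K : ℕ, ∀ᵐ ω ∂P, (∀ m, V m ω ≤ K) → M T ω = 0 := by
    intro K
    have hSm : MeasurableSet {ω | ∀ m, V m ω ≤ K} := by
      rw [Set.ofPred_forall]
      exact MeasurableSet.iInter fun m => hVm m measurableSet_Iic
    have hle : ∀ δ > 0, ∫ ω in {ω | ∀ m, V m ω ≤ K}, (√(1 + M T ω ^ 2) - 1) ∂P
        ≤ δ / 2 * (K + δ) := by
      intro δ hδ
      have hlim : Tendsto (fun m => δ / 2 * (K + δ) + 2 * (K / δ + 1) *
          ∫ ω in B δ m, (K + |M T ω|) ∂P) atTop (𝓝 (δ / 2 * (K + δ))) := by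
        simpa using ((hbig δ hδ K).const_mul (2 * (K / δ + 1))).const_add (δ / 2 * (K + δ))
      refine ge_of_tendsto hlim (Eventually.of_forall fun m => ?_)
      have h1 := martingale_variation_bound (hG m) (by simp [h0]) (K := K) K.cast_nonneg hδ (2 ^ m)
      simp only [gridPoint_last] at h1
      refine le_trans ?_ h1
      exact setIntegral_mono_set hψi.integrableOn (Eventually.of_forall fun ω => hψ0 _)
        (Eventually.of_forall fun ω (h : ∀ m, V m ω ≤ K) => h m)
    have hzero : ∫ ω in {ω | ∀ m, V m ω ≤ K}, (√(1 + M T ω ^ 2) - 1) ∂P = 0 := by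
      refine le_antisymm ?_ (integral_nonneg fun ω => hψ0 _)
      have hlim : Tendsto (fun δ : ℝ => δ / 2 * (K + δ)) (𝓝[>] 0) (𝓝 (0 / 2 * (K + 0))) :=
        ((by fun_prop : Continuous fun δ : ℝ => δ / 2 * (K + δ)).tendsto 0).mono_left
          nhdsWithin_le_nhds
      rw [zero_div, zero_mul] at hlim
      exact ge_of_tendsto hlim (by filter_upwards [self_mem_nhdsWithin] with δ hδ using hle δ hδ)
    rw [setIntegral_eq_zero_iff_of_nonneg_ae (Eventually.of_forall fun ω => hψ0 _)
      hψi.integrableOn] at hzero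
    have h4 := (ae_restrict_iff' hSm).1 hzero
    filter_upwards [h4] with ω hω hV
    have h5 : √(1 + M T ω ^ 2) - 1 = 0 := hω hV
    have h6 : √(1 + M T ω ^ 2) = 1 := by linarith
    rw [Real.sqrt_eq_one] at h6
    exact pow_eq_zero_iff two_ne_zero |>.1 (by linarith)
  filter_upwards [ae_all_iff.2 hS, hA] with ω hω ⟨A, hAc, hAm, hAb⟩
  obtain ⟨K, hK⟩ := exists_nat_ge (A T - A 0)
  refine hω K fun m => le_trans ?_ hK
  calc V m ω ≤ ∑ i ∈ Finset.range (2 ^ m),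
        (A (gridPoint T m (i + 1)) - A (gridPoint T m i)) :=
        Finset.sum_le_sum fun i _ => hAb _ _ (gridPoint_mono T m i.le_succ)
    _ = A T - A 0 := by
        rw [Finset.sum_range_sub (fun i => A (gridPoint T m i)), gridPoint_last, gridPoint_zero]

/-- A martingale whose paths are continuous and of finite variation is constant. -/
theorem martingale_eq_of_finite_variation {Ω : Type*} [MeasurableSpace Ω] {P : Measure Ω}
    [IsProbabilityMeasure P] {𝓕 : Filtration ℝ≥0 ‹MeasurableSpace Ω›} {M : ℝ≥0 → Ω → ℝ}
    (hM : Martingale M 𝓕 P)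
    (hA : ∀ᵐ ω ∂P, ∃ A : ℝ≥0 → ℝ, Continuous A ∧ Monotone A ∧
      ∀ s t, s ≤ t → |M t ω - M s ω| ≤ A t - A s) (T : ℝ≥0) : M T =ᵐ[P] M 0 := by
  have h0 : Martingale (fun _ => M 0 : ℝ≥0 → Ω → ℝ) 𝓕 P := by
    refine ⟨fun t => (hM.stronglyAdapted 0).mono (𝓕.mono zero_le), fun s t _ => ?_⟩
    rw [condExp_of_stronglyMeasurable (𝓕.le s) ((hM.stronglyAdapted 0).mono (𝓕.mono zero_le))
      (hM.integrable 0)]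
  have := martingale_eq_zero_of_finite_variation (hM.sub h0) (fun ω => by simp) ?_ T
  · filter_upwards [this] with ω hω
    simpa [sub_eq_zero] using hω
  · filter_upwards [hA] with ω ⟨A, hAc, hAm, hAb⟩
    exact ⟨A, hAc, hAm, fun s t hst => by simpa using hAb s t hst⟩

/-- A local martingale whose paths are continuous and of finite variation is constant. -/
theorem localMartingale_eq_of_finite_variation {Ω : Type*} [MeasurableSpace Ω] {P : Measure Ω}
    [IsProbabilityMeasure P] {𝓕 : Filtration ℝ≥0 ‹MeasurableSpace Ω›} {N : ℝ≥0 → Ω → ℝ}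
    (hN : IsLocalMartingale P 𝓕 N)
    (hA : ∀ᵐ ω ∂P, ∃ A : ℝ≥0 → ℝ, Continuous A ∧ Monotone A ∧
      ∀ s t, s ≤ t → |N t ω - N s ω| ≤ A t - A s) (T : ℝ≥0) : N T =ᵐ[P] N 0 := by
  obtain ⟨τ, hτ, hmart⟩ := hN
  have h1 : ∀ n, stoppedProcess (fun i => {ω | ⊥ < τ n ω}.indicator (N i)) (τ n) T =ᵐ[P]
      stoppedProcess (fun i => {ω | ⊥ < τ n ω}.indicator (N i)) (τ n) 0 := by
    intro n
    refine martingale_eq_of_finite_variation (hmart n) ?_ T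
    -- Stopping freezes the path and the indicator at most sets it to zero, so the same `A` controls
    -- the stopped path.
    · filter_upwards [hA] with ω ⟨A, hAc, hAm, hAb⟩
      refine ⟨A, hAc, hAm, fun s t hst => ?_⟩
      have hA0 : 0 ≤ A t - A s := sub_nonneg.2 (hAm hst)
      rcases le_total (τ n ω) s with h | h
      · have h' : τ n ω ≤ t := h.trans (by exact_mod_cast hst)
        rw [stoppedProcess_eq_of_ge h, stoppedProcess_eq_of_ge h', sub_self, abs_zero]
        exact hA0
      · rw [stoppedProcess_eq_of_le h]
        rcases le_total (τ n ω) t with h' | h'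
        · rw [stoppedProcess_eq_of_ge h']
          obtain ⟨u, hu⟩ := WithTop.ne_top_iff_exists.1 (ne_top_of_le_ne_top WithTop.coe_ne_top h')
          rw [← hu] at h h' ⊢
          have h2 : s ≤ u := by exact_mod_cast h
          have h3 : u ≤ t := by exact_mod_cast h'
          simp only [Set.indicator_apply]
          split_ifs
          · exact (hAb s u h2).trans (by linarith [hAm h3])
          · simpa using hA0
        · rw [stoppedProcess_eq_of_le h']
          simp only [Set.indicator_apply]
          split_ifs
          · exact hAb s t hst
          · simpa using hA0
  filter_upwards [ae_all_iff.2 h1, hτ.tendsto_top] with ω hω htop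
  have h2 : ∀ᶠ n in atTop, ((T + 1 : ℝ≥0) : WithTop ℝ≥0) < τ n ω :=
    htop.eventually (lt_mem_nhds (WithTop.coe_lt_top _))
  obtain ⟨n, hn⟩ := h2.exists
  have h3 := hω n
  have h4 : ((T : ℝ≥0) : WithTop ℝ≥0) ≤ τ n ω :=
    le_trans (by exact_mod_cast (le_self_add : T ≤ T + 1)) hn.le
  have h5 : ω ∈ {ω | ⊥ < τ n ω} := bot_le.trans_lt hn
  rwa [stoppedProcess_eq_of_le h4, stoppedProcess_eq_of_le (by exact bot_le),
    Set.indicator_of_mem h5, Set.indicator_of_mem h5] at h3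

/-! ### Smooth cutoffs and second derivatives -/

section Cutoff

variable {E : Type*} [NormedAddCommGroup E] [NormedSpace ℝ E] [FiniteDimensional ℝ E]

theorem exists_compact_exhaustion_of_isOpen {U : Set E} (hU : IsOpen U) :
    ∃ K : ℕ → Set E, (∀ n, IsCompact (K n)) ∧ (∀ n, K n ⊆ U) ∧ Monotone K ∧
      ∀ C, IsCompact C → C ⊆ U → ∃ n, C ⊆ K n := by
  have : ProperSpace E := FiniteDimensional.proper_real E
  have : LocallyCompactSpace U := hU.locallyCompactSpace
  have : SigmaCompactSpace U := inferInstance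
  let K := CompactExhaustion.choice U
  refine ⟨fun n => Subtype.val '' (K n), fun n => (K.isCompact n).image continuous_subtype_val,
    fun n => by rintro _ ⟨x, -, rfl⟩; exact x.2,
    fun m n h => Set.image_mono (K.subset h), fun C hC hCU => ?_⟩
  have hC' : IsCompact ((Subtype.val : U → E) ⁻¹' C) := by
    rw [Subtype.isCompact_iff, Set.image_preimage_eq_inter_range, Subtype.range_coe]
    rwa [Set.inter_eq_left.2 hCU]
  obtain ⟨n, hn⟩ := K.exists_superset_of_isCompact hC'
  exact ⟨n, fun x hx => ⟨⟨x, hCU hx⟩, hn hx, rfl⟩⟩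

theorem exists_smooth_cutoff {K U : Set E} (hK : IsCompact K) (hU : IsOpen U) (hKU : K ⊆ U) :
    ∃ χ : E → ℝ, ContDiff ℝ ((⊤ : ℕ∞) : WithTop ℕ∞) χ ∧ HasCompactSupport χ ∧ tsupport χ ⊆ U ∧
      ∀ x ∈ K, χ =ᶠ[𝓝 x] 1 := by
  have : ProperSpace E := FiniteDimensional.proper_real E
  obtain ⟨L, hL, hKL, hLU⟩ := exists_compact_between hK hU hKU
  obtain ⟨f, h1, h0, -⟩ := exists_contMDiffMap_one_nhds_of_subset_interior (modelWithCornersSelf ℝ E)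
    (n := (⊤ : ℕ∞)) hK.isClosed hKL
  have hsupp : tsupport f ⊆ L := closure_minimal (fun x hx => by
    by_contra h
    exact hx (h0 x h)) hL.isClosed
  refine ⟨f, f.contMDiff.contDiff, hL.of_isClosed_subset (isClosed_tsupport _) hsupp,
    hsupp.trans hLU, fun x hx => ?_⟩
  exact (eventually_nhdsSet_iff_forall.1 h1 x hx)

/-- Off the support of χ the product is locally zero, so the behaviour of g outside `U` is
irrelevant. -/
theorem contDiff_cutoff_mul {χ g : E → ℝ} {U : Set E} (hU : IsOpen U) {n : WithTop ℕ∞}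
    (hχ : ContDiff ℝ n χ) (hχU : tsupport χ ⊆ U) (hg : ContDiffOn ℝ n g U) :
    ContDiff ℝ n fun x => χ x * g x := by
  rw [contDiff_iff_contDiffAt]
  intro x
  by_cases hx : x ∈ tsupport χ
  · exact hχ.contDiffAt.mul (hg.contDiffAt (hU.mem_nhds (hχU hx)))
  · have h0 : (fun x => χ x * g x) =ᶠ[𝓝 x] fun _ => 0 := by
      filter_upwards [notMem_tsupport_iff_eventuallyEq.1 hx] with y hy
      simp [hy]
    exact contDiffAt_const.congr_of_eventuallyEq h0

end Cutoff

section SecondDerivative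

variable {E F : Type*} [NormedAddCommGroup E] [NormedSpace ℝ E] [NormedAddCommGroup F]
  [NormedSpace ℝ F]

theorem iteratedFDeriv_two_comp_clm {k : F → ℝ} (L : E →L[ℝ] F) {p : E}
    (hk : ContDiffAt ℝ 2 k (L p)) (v w : E) :
    fderiv ℝ (fun y => k (L y)) p v = fderiv ℝ k (L p) (L v) ∧
      fderiv ℝ (fderiv ℝ fun y => k (L y)) p v w = fderiv ℝ (fderiv ℝ k) (L p) (L v) (L w) := by
  have hev : ∀ᶠ y in 𝓝 p, ContDiffAt ℝ 2 k (L y) :=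
    (L.continuous.tendsto p).eventually (hk.eventually (by simp))
  have h1 : ∀ y, ContDiffAt ℝ 2 k (L y) →
      fderiv ℝ (fun y => k (L y)) y = (fderiv ℝ k (L y)).comp L := fun y hy => by
    have := fderiv_comp y (hy.differentiableAt (by norm_num)) L.differentiableAt
    rw [L.fderiv] at this
    exact this
  refine ⟨by rw [h1 p hk]; rfl, ?_⟩
  have h2 : (fderiv ℝ fun y => k (L y)) =ᶠ[𝓝 p] fun y => (fderiv ℝ k (L y)).comp L :=
    hev.mono h1
  rw [h2.fderiv_eq]
  have hd : DifferentiableAt ℝ (fderiv ℝ k) (L p) :=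
    (hk.fderiv_right (m := 1) (by norm_num)).differentiableAt (by norm_num)
  have h3 : HasFDerivAt (fun y => (fderiv ℝ k (L y)).comp L)
      ((ContinuousLinearMap.compL ℝ E F ℝ).flip L ∘L (fderiv ℝ (fderiv ℝ k) (L p) ∘L L)) p :=
    ((ContinuousLinearMap.compL ℝ E F ℝ).flip L).hasFDerivAt.comp p
      (hd.hasFDerivAt.comp p L.hasFDerivAt)
  rw [h3.fderiv]
  rfl

theorem fderiv_fderiv_sub {k l : E → ℝ} {p : E} (hk : ContDiffAt ℝ 2 k p) (hl : ContDiffAt ℝ 2 l p)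
    (v w : E) : fderiv ℝ (fderiv ℝ fun y => k y - l y) p v w
      = fderiv ℝ (fderiv ℝ k) p v w - fderiv ℝ (fderiv ℝ l) p v w := by
  have h : (fderiv ℝ fun y => k y - l y) =ᶠ[𝓝 p] fun y => fderiv ℝ k y - fderiv ℝ l y := by
    filter_upwards [hk.eventually (by simp), hl.eventually (by simp)] with y h1 h2
    exact fderiv_fun_sub (h1.differentiableAt (by norm_num)) (h2.differentiableAt (by norm_num))
  have hd : ∀ {k : E → ℝ}, ContDiffAt ℝ 2 k p → DifferentiableAt ℝ (fderiv ℝ k) p := fun hk =>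
    (hk.fderiv_right (m := 1) (by norm_num)).differentiableAt (by norm_num)
  rw [h.fderiv_eq, fderiv_fun_sub (hd hk) (hd hl)]
  rfl

theorem fderiv_fderiv_sq (y v w : ℝ) :
    fderiv ℝ (fun y : ℝ => y ^ 2) y v = 2 * y * v ∧
      fderiv ℝ (fderiv ℝ fun y : ℝ => y ^ 2) y v w = 2 * v * w := by
  have h1 : (fderiv ℝ fun y : ℝ => y ^ 2)
      = fun y => (1 : ℝ →L[ℝ] ℝ).smulRight ((2 : ℝ) • (1 : ℝ →L[ℝ] ℝ)) y := by
    ext y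
    simp [mul_comm]
  rw [h1, ContinuousLinearMap.fderiv]
  constructor
  · simp only [ContinuousLinearMap.smulRight_apply, one_apply_eq_self, smul_apply,
      smul_eq_mul]
    ring
  · simp only [ContinuousLinearMap.smulRight_apply, one_apply_eq_self, smul_apply,
      smul_eq_mul]
    ring

end SecondDerivative

section Drift

variable {d : ℕ} {V : Type*} [NormedAddCommGroup V] [NormedSpace ℝ V]

theorem itoDrift_eq (φ : Vec d × V → ℝ) (p : Vec d × V) (b : V) (s : Fin d → V) :
    itoDrift φ p b s = fderiv ℝ φ p (0, b) + (1 / 2) * ∑ i, fderiv ℝ (fderiv ℝ φ) p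
      (EuclideanSpace.single i (1 : ℝ), s i) (EuclideanSpace.single i (1 : ℝ), s i) := by
  simp [itoDrift, iteratedFDeriv_two_apply]

theorem itoDrift_congr {φ φ' : Vec d × V → ℝ} {p : Vec d × V} (h : φ =ᶠ[𝓝 p] φ') (b : V)
    (s : Fin d → V) : itoDrift φ p b s = itoDrift φ' p b s := by
  rw [itoDrift_eq, itoDrift_eq, h.fderiv_eq, h.fderiv.fderiv_eq]

theorem itoDrift_comp_snd {k : V → ℝ} {p : Vec d × V} (hk : ContDiffAt ℝ 2 k p.2) (b : V)
    (s : Fin d → V) : itoDrift (fun q => k q.2) p b s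
      = fderiv ℝ k p.2 b + (1 / 2) * ∑ i, fderiv ℝ (fderiv ℝ k) p.2 (s i) (s i) := by
  rw [itoDrift_eq]
  have h := iteratedFDeriv_two_comp_clm (ContinuousLinearMap.snd ℝ (Vec d) V) (p := p) hk
  simp only [ContinuousLinearMap.coe_snd'] at h
  rw [(h (0, b) 0).1]
  simp only [fun v w => (h v w).2]

theorem itoDrift_eq_zero {φ : Vec d × V → ℝ} {p : Vec d × V} (hp : p ∉ tsupport φ) (b : V)
    (s : Fin d → V) : itoDrift φ p b s = 0 := by
  rw [itoDrift_congr (notMem_tsupport_iff_eventuallyEq.1 hp), itoDrift_eq]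
  simp [Pi.zero_def]

theorem exists_fderiv_bound {E F : Type*} [NormedAddCommGroup E] [NormedSpace ℝ E]
    [NormedAddCommGroup F] [NormedSpace ℝ F] {φ : E → F} (hφ : ContDiff ℝ 1 φ)
    (hc : HasCompactSupport φ) : ∃ C, 0 ≤ C ∧ ∀ p, ‖fderiv ℝ φ p‖ ≤ C := by
  have hc' : HasCompactSupport (fderiv ℝ φ) := hc.fderiv (𝕜 := ℝ)
  obtain ⟨C, hC⟩ := hc'.exists_bound_of_continuous (hφ.continuous_fderiv one_ne_zero)
  exact ⟨C, (norm_nonneg _).trans (hC 0), hC⟩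

theorem exists_derivative_bounds {E : Type*} [NormedAddCommGroup E] [NormedSpace ℝ E]
    {φ : E → ℝ} (hφ : ContDiff ℝ 2 φ) (hc : HasCompactSupport φ) : ∃ C, 0 ≤ C ∧ ∀ p v,
      |fderiv ℝ φ p v| ≤ C * ‖v‖ ∧ |fderiv ℝ (fderiv ℝ φ) p v v| ≤ C * ‖v‖ ^ 2 := by
  obtain ⟨C₁, h₀, h₁⟩ := exists_fderiv_bound (hφ.of_le one_le_two) hc
  have hc' : HasCompactSupport (fderiv ℝ φ) := hc.fderiv (𝕜 := ℝ)
  have hφ' : ContDiff ℝ 1 (fderiv ℝ φ) := hφ.fderiv_right (by norm_num)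
  obtain ⟨C₂, -, h₂⟩ := exists_fderiv_bound hφ' hc'
  refine ⟨max C₁ C₂, le_max_of_le_left h₀, fun p v => ⟨?_, ?_⟩⟩
  · exact (fderiv ℝ φ p).le_of_opNorm_le ((h₁ p).trans (le_max_left _ _)) v
  · have h3 : ‖fderiv ℝ (fderiv ℝ φ) p v v‖ ≤ ‖fderiv ℝ (fderiv ℝ φ) p‖ * ‖v‖ * ‖v‖ :=
      ContinuousLinearMap.le_opNorm₂ _ _ _
    rw [Real.norm_eq_abs, mul_assoc, ← sq] at h3
    exact h3.trans (mul_le_mul_of_nonneg_right ((h₂ p).trans (le_max_right C₁ C₂)) (by positivity))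

/-- The 1 accounts for the unit vectors in the direction of the Brownian motion; the remainder is
the quantity whose local integrability belongs to the definition of an Itô process. -/
theorem exists_itoDrift_bound {φ : Vec d × V → ℝ} (hφ : ContDiff ℝ 2 φ)
    (hc : HasCompactSupport φ) : ∃ C, 0 ≤ C ∧ ∀ p b (s : Fin d → V),
      |itoDrift φ p b s| ≤ C * (1 + (‖b‖ + ∑ i, ‖s i‖ ^ 2)) := by
  obtain ⟨C, hC, h⟩ := exists_derivative_bounds hφ hc
  refine ⟨C * (d + 1), by positivity, fun p b s => ?_⟩
  rw [itoDrift_eq]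
  have e1 : |fderiv ℝ φ p (0, b)| ≤ C * ‖b‖ := by
    have := (h p (0, b)).1
    rwa [Prod.norm_def, norm_zero, max_eq_right (norm_nonneg b)] at this
  have e2 : ∀ i, |fderiv ℝ (fderiv ℝ φ) p (EuclideanSpace.single i (1 : ℝ), s i)
      (EuclideanSpace.single i (1 : ℝ), s i)| ≤ C * (1 + ‖s i‖ ^ 2) := fun i => by
    refine (h p _).2.trans (mul_le_mul_of_nonneg_left ?_ hC)
    rw [Prod.norm_def, PiLp.norm_single, norm_one]
    rcases max_cases 1 ‖s i‖ with h | h <;> rw [h.1] <;> nlinarith [norm_nonneg (s i)]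
  have e3 : |∑ i, fderiv ℝ (fderiv ℝ φ) p (EuclideanSpace.single i (1 : ℝ), s i)
      (EuclideanSpace.single i (1 : ℝ), s i)| ≤ C * (d + ∑ i, ‖s i‖ ^ 2) := by
    refine (Finset.abs_sum_le_sum_abs _ _).trans ((Finset.sum_le_sum fun i _ => e2 i).trans ?_)
    rw [← Finset.mul_sum, Finset.sum_add_distrib]
    simp
  have hS : 0 ≤ ∑ i, ‖s i‖ ^ 2 := Finset.sum_nonneg fun i _ => by positivity
  have hd : (0 : ℝ) ≤ d := d.cast_nonneg
  have hB := norm_nonneg b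
  generalize ∑ i, ‖s i‖ ^ 2 = S at *
  generalize ‖b‖ = B at *
  generalize (∑ i, fderiv ℝ (fderiv ℝ φ) p (EuclideanSpace.single i (1 : ℝ), s i)
      (EuclideanSpace.single i (1 : ℝ), s i)) = Y at *
  refine (abs_add_le _ _).trans ?_
  rw [abs_mul, abs_of_pos (by norm_num : (0 : ℝ) < 1 / 2), mul_assoc]
  have h6 : C * B + C * (d + S) ≤ C * ((d + 1) * (1 + (B + S))) := by
    rw [← mul_add]
    refine mul_le_mul_of_nonneg_left ?_ hC
    nlinarith [mul_nonneg hd hS, mul_nonneg hd hB]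
  linarith [abs_nonneg Y]

theorem column_eq_sum (A : Matrix (Fin d) (Fin d) ℝ) (i : Fin d) :
    column A i = ∑ j, A j i • EuclideanSpace.single j (1 : ℝ) := by
  ext l
  simp [column, Finset.sum_apply, Pi.single_apply]

/-- Expanding the trace along the columns of σ puts the generator in the form of `itoDrift`, which
makes the two comparable. -/
theorem generator_eq (μ : Vec d → Vec d) (σ : Vec d → Matrix (Fin d) (Fin d) ℝ)
    (g : Vec d → ℝ) (x : Vec d) : generator μ σ g x = fderiv ℝ g x (μ x)
      + (1 / 2) * ∑ i, fderiv ℝ (fderiv ℝ g) x (column (σ x) i) (column (σ x) i) := by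
  rw [generator, add_comm]
  congr 2
  simp only [column_eq_sum, map_sum, map_smul, FunLike.coe_sum, Finset.sum_apply,
    FunLike.coe_smul, Pi.smul_apply, smul_eq_mul, Matrix.trace, Matrix.diag,
    Matrix.mul_apply, Matrix.transpose_apply, hessian, Matrix.of_apply, iteratedFDeriv_two_apply,
    Matrix.cons_val_zero, Matrix.cons_val_one, Finset.sum_mul, Finset.mul_sum]
  rw [Finset.sum_comm (γ := Fin d) (t := Finset.univ) (f := fun x_1 x_2 => ∑ i, σ x x_2 x_1 *
    (σ x i x_1 * fderiv ℝ (fderiv ℝ g) x (EuclideanSpace.single i 1) (EuclideanSpace.single x_2 1)))]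
  refine Finset.sum_congr rfl fun i _ => ?_
  rw [Finset.sum_comm]
  exact Finset.sum_congr rfl fun j _ => Finset.sum_congr rfl fun l _ => mul_assoc _ _ _

/-- The function y² − g(x) separates its variables, so no mixed derivative and no covariation
between the factor and the price appears. -/
theorem itoDrift_sq_sub {g : Vec d → ℝ} {p : Vec d × (Vec d × ℝ)} (hg : ContDiffAt ℝ 2 g p.2.1)
    (b : Vec d × ℝ) (s : Fin d → Vec d × ℝ) :
    itoDrift (fun q : Vec d × (Vec d × ℝ) => q.2.2 ^ 2 - g q.2.1) p b s
      = (2 * p.2.2 * b.2 + ∑ i, (s i).2 ^ 2) - (fderiv ℝ g p.2.1 b.1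
        + (1 / 2) * ∑ i, fderiv ℝ (fderiv ℝ g) p.2.1 (s i).1 (s i).1) := by
  have hsq : ∀ y : ℝ, ContDiffAt ℝ 2 (fun y : ℝ => y ^ 2) y := fun y => by fun_prop
  have h1 := iteratedFDeriv_two_comp_clm (ContinuousLinearMap.snd ℝ (Vec d) ℝ) (p := p.2)
    (hsq p.2.2)
  have h2 := iteratedFDeriv_two_comp_clm (ContinuousLinearMap.fst ℝ (Vec d) ℝ) (p := p.2) hg
  have c1 : ContDiffAt ℝ 2 (fun z : Vec d × ℝ => z.2 ^ 2) p.2 := by fun_prop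
  have c2 : ContDiffAt ℝ 2 (fun z : Vec d × ℝ => g z.1) p.2 := hg.comp p.2 contDiffAt_fst
  rw [itoDrift_comp_snd (k := fun z : Vec d × ℝ => z.2 ^ 2 - g z.1) (c1.sub c2),
    fderiv_fun_sub (c1.differentiableAt (by norm_num)) (c2.differentiableAt (by norm_num))]
  simp only [ContinuousLinearMap.coe_snd', ContinuousLinearMap.coe_fst'] at h1 h2
  simp only [fderiv_fderiv_sub c1 c2, (h1 _ _).2, (h2 _ _).2, (fderiv_fderiv_sq _ _ _).2,
    sub_apply, (h1 b 0).1, (h2 b 0).1, (fderiv_fderiv_sq _ _ 0).1,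
    Finset.sum_sub_distrib, mul_sub]
  have : (1 / 2 : ℝ) * ∑ i, 2 * (s i).2 * (s i).2 = ∑ i, (s i).2 ^ 2 := by
    rw [Finset.mul_sum]
    exact Finset.sum_congr rfl fun i _ => by ring
  rw [this]
  ring

end Drift

/-! ### The invariant measure -/

section Density

variable {d : ℕ} {ϖ : Vec d → ℝ}

theorem integrable_densityMeasure_iff (hm : Measurable ϖ) (h0 : ∀ x, 0 ≤ ϖ x) {g : Vec d → ℝ} :
    Integrable g (densityMeasure ϖ) ↔ Integrable fun x => g x * ϖ x := by
  unfold densityMeasure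
  rw [integrable_withDensity_iff_integrable_smul' hm.ennreal_ofReal
    (Eventually.of_forall fun _ => ENNReal.ofReal_lt_top)]
  simp only [ENNReal.toReal_ofReal (h0 _), smul_eq_mul, mul_comm]

theorem integral_densityMeasure (hm : Measurable ϖ) (h0 : ∀ x, 0 ≤ ϖ x) (g : Vec d → ℝ) :
    ∫ x, g x ∂(densityMeasure ϖ) = bracket ϖ g := by
  unfold densityMeasure bracket
  rw [integral_withDensity_eq_integral_toReal_smul hm.ennreal_ofReal
    (Eventually.of_forall fun _ => ENNReal.ofReal_lt_top)]
  simp only [ENNReal.toReal_ofReal (h0 _), smul_eq_mul, mul_comm]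

end Density

section LocalIntegrability

variable {d : ℕ} {D : Set (Vec d)} {μ : Vec d → Vec d} {σ : Vec d → Matrix (Fin d) (Fin d) ℝ}
  {κ : ℝ≥0 → Kernel (Vec d) (Vec d)} {ϖ : Vec d → ℝ}

theorem generator_congr {g g' : Vec d → ℝ} {x : Vec d} (h : g =ᶠ[𝓝 x] g') :
    generator μ σ g x = generator μ σ g' x := by
  rw [generator_eq, generator_eq, h.fderiv_eq, h.fderiv.fderiv_eq]

theorem generator_coord (j : Fin d) (x : Vec d) :
    generator μ σ (fun x => x j) x = μ x j := by
  have h := iteratedFDeriv_two_comp_clm (k := fun y : ℝ => y)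
    (EuclideanSpace.proj j : Vec d →L[ℝ] ℝ) (p := x) contDiffAt_id
  simp only [PiLp.proj_apply] at h
  rw [generator_eq]
  have h2 : (fderiv ℝ fun y : ℝ => y) = fun _ => ContinuousLinearMap.id ℝ ℝ :=
    funext fun _ => fderiv_fun_id
  simp [(h _ _).2, (h _ 0).1, h2, -fderiv_eq_smul_deriv]

theorem generator_coord_sq (j : Fin d) (x : Vec d) :
    generator μ σ (fun x => x j ^ 2) x = 2 * x j * μ x j + ∑ i, σ x j i ^ 2 := by
  have h := iteratedFDeriv_two_comp_clm (k := fun y : ℝ => y ^ 2)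
    (EuclideanSpace.proj j : Vec d →L[ℝ] ℝ) (p := x) (by fun_prop)
  simp only [PiLp.proj_apply] at h
  rw [generator_eq]
  simp only [(h _ _).2, (h _ 0).1, (fderiv_fderiv_sq _ _ _).2, (fderiv_fderiv_sq _ _ 0).1]
  congr 1
  rw [Finset.mul_sum]
  exact Finset.sum_congr rfl fun i _ => by simp [column]; ring

/-- A cutoff equal to 1 near `K` makes g a test function without changing ℒg on `K`; integrability
for test functions is part of invariance. -/
theorem IsInvariantDensity.integrableOn_generator (h : IsInvariantDensity D μ σ κ ϖ)
    (hD : IsOpen D) {K : Set (Vec d)} (hK : IsCompact K) (hKD : K ⊆ D) {g : Vec d → ℝ}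
    (hg : ContDiff ℝ ((⊤ : ℕ∞) : WithTop ℕ∞) g) :
    IntegrableOn (generator μ σ g) K (densityMeasure ϖ) := by
  obtain ⟨χ, hχ, hc, hs, h1⟩ := exists_smooth_cutoff hK hD hKD
  have ht : IsTestFunction D fun x => χ x * g x :=
    ⟨hχ.mul hg, hc.mul_right, (tsupport_mul_subset_left).trans hs⟩
  have hi := (integrable_densityMeasure_iff h.measurable h.nonneg).2 (h.adjoint_eq_zero _ ht).1
  refine hi.integrableOn.congr_fun (fun x hx => ?_) hK.measurableSet
  refine generator_congr ?_
  filter_upwards [h1 x hx] with y hy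
  simp [hy]

/-- The coefficients are recovered from ℒx_j = μ_j and ℒ(x_j²) = 2 x_j μ_j + ∑_i σ_{ji}². Local
integrability supplies the integrable majorant in Dynkin's formula. -/
theorem IsInvariantDensity.integrableOn_coefficients (h : IsInvariantDensity D μ σ κ ϖ)
    (hD : IsOpen D) (hμ : Measurable μ) {K : Set (Vec d)} (hK : IsCompact K)
    (hKD : K ⊆ D) :
    IntegrableOn (fun x => 1 + (‖μ x‖ + ∑ i, ‖column (σ x) i‖ ^ 2)) K (densityMeasure ϖ) := by
  have hfin : IsFiniteMeasure (densityMeasure ϖ) := by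
    refine ⟨?_⟩
    unfold densityMeasure
    rw [withDensity_apply _ MeasurableSet.univ, Measure.restrict_univ]
    exact h.integrable.lintegral_lt_top
  have hμj : ∀ j, IntegrableOn (fun x => μ x j) K (densityMeasure ϖ) := fun j => by
    have := h.integrableOn_generator hD hK hKD (g := fun x => x j) (by fun_prop)
    rwa [show generator μ σ (fun x : Vec d => x j) = fun x => μ x j from
      funext (generator_coord j)] at this
  have hx : ∀ j, IntegrableOn (fun x => 2 * x j * μ x j) K (densityMeasure ϖ) := fun j => by
    obtain ⟨C, hC⟩ := hK.exists_bound_of_continuousOn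
      (f := fun x : Vec d => 2 * x j) (by fun_prop)
    refine (hμj j).bdd_mul (c := C) (by fun_prop) ?_
    filter_upwards [ae_restrict_mem hK.measurableSet] with x hx using hC x hx
  have hσ : ∀ j, IntegrableOn (fun x => ∑ i, σ x j i ^ 2) K (densityMeasure ϖ) := fun j => by
    have := (h.integrableOn_generator hD hK hKD (g := fun x => x j ^ 2) (by fun_prop)).sub (hx j)
    refine this.congr (Eventually.of_forall fun x => ?_)
    simp [generator_coord_sq]
  have e : ∀ x, ∑ i, ‖column (σ x) i‖ ^ 2 = ∑ j, ∑ i, σ x j i ^ 2 := fun x => by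
    rw [Finset.sum_comm]
    exact Finset.sum_congr rfl fun i _ => by
      simp [EuclideanSpace.norm_sq_eq, column]
  refine (integrable_const (1 : ℝ)).add (Integrable.add ?_ ?_)
  · refine (integrable_finsetSum Finset.univ fun j _ => (hμj j).norm).mono'
      hμ.norm.aestronglyMeasurable (Eventually.of_forall fun x => ?_)
    rw [norm_norm, EuclideanSpace.norm_eq]
    refine Real.sqrt_le_left (Finset.sum_nonneg fun _ _ => norm_nonneg _) |>.2 ?_
    exact Finset.sum_sq_le_sq_sum_of_nonneg fun i _ => norm_nonneg _
  · simp only [e]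
    exact integrable_finsetSum _ fun j _ => hσ j

/-- No regularity of g is required, since `fderiv` of an arbitrary function is measurable here. -/
theorem measurable_generator (hμ : Measurable μ) (hσ : ∀ j k, Measurable fun x => σ x j k)
    (g : Vec d → ℝ) : Measurable (generator μ σ g) := by
  have hc : ∀ i, Measurable fun x => column (σ x) i := fun i =>
    (WithLp.measurable_toLp 2 _).comp (measurable_pi_lambda _ fun j => hσ j i)
  have h1 : Measurable (fderiv ℝ g) := measurable_fderiv ℝ g
  have h2 : Measurable (fderiv ℝ (fderiv ℝ g)) := measurable_fderiv ℝ _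
  have e : generator μ σ g = fun x => fderiv ℝ g x (μ x)
      + (1 / 2) * ∑ i, fderiv ℝ (fderiv ℝ g) x (column (σ x) i) (column (σ x) i) :=
    funext fun x => generator_eq μ σ g x
  rw [e]
  refine Measurable.add ?_ (measurable_const.mul (Finset.measurable_sum _ fun i _ => ?_))
  · exact ContinuousLinearMap.measurable_apply₂.comp (h1.prodMk hμ)
  · have h3 : Measurable fun x => fderiv ℝ (fderiv ℝ g) x (column (σ x) i) :=
      ContinuousLinearMap.measurable_apply₂.comp (h2.prodMk (hc i))
    exact ContinuousLinearMap.measurable_apply₂.comp (h3.prodMk (hc i))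

end LocalIntegrability

/-! ### Itô processes and the martingale problem -/

theorem measurable_itoDrift {d : ℕ} {V : Type*} [NormedAddCommGroup V] [NormedSpace ℝ V]
    [FiniteDimensional ℝ V] [MeasurableSpace V] [BorelSpace V] {α : Type*} [MeasurableSpace α]
    (φ : Vec d × V → ℝ) {p : α → Vec d × V} (hp : Measurable p) {b : α → V} (hb : Measurable b)
    {s : α → Fin d → V} (hs : ∀ i, Measurable fun a => s a i) :
    Measurable fun a => itoDrift φ (p a) (b a) (s a) := by
  have : ProperSpace V := FiniteDimensional.proper_real V
  have h1 : Measurable fun a => fderiv ℝ φ (p a) := (measurable_fderiv ℝ φ).comp hp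
  have h2 : Measurable fun a => fderiv ℝ (fderiv ℝ φ) (p a) := (measurable_fderiv ℝ _).comp hp
  simp only [itoDrift_eq]
  refine Measurable.add ?_ (measurable_const.mul (Finset.measurable_sum _ fun i _ => ?_))
  · exact ContinuousLinearMap.measurable_apply₂.comp (h1.prodMk (measurable_const.prodMk hb))
  · have hv : Measurable fun a => ((EuclideanSpace.single i (1 : ℝ) : Vec d), s a i) :=
      measurable_const.prodMk (hs i)
    have h3 : Measurable fun a => fderiv ℝ (fderiv ℝ φ) (p a)
        (EuclideanSpace.single i (1 : ℝ), s a i) :=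
      ContinuousLinearMap.measurable_apply₂.comp (h2.prodMk hv)
    exact ContinuousLinearMap.measurable_apply₂.comp (h3.prodMk hv)

theorem continuous_primitive_nnreal {f : ℝ → ℝ}
    (h : ∀ t : ℝ≥0, IntervalIntegrable f volume 0 t) :
    Continuous fun t : ℝ≥0 => ∫ r in (0 : ℝ)..t, f r := by
  rw [continuous_iff_continuousAt]
  intro t
  have h1 := intervalIntegral.continuousOn_primitive_interval' (h (t + 1)) Set.left_mem_uIcc
  have h0 : (0 : ℝ) ≤ ((t + 1 : ℝ≥0) : ℝ) := NNReal.coe_nonneg _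
  rw [Set.uIcc_of_le h0] at h1
  have h2 : ContinuousOn (fun s : ℝ≥0 => ∫ r in (0 : ℝ)..s, f r) (Set.Iio (t + 1)) :=
    h1.comp NNReal.continuous_coe.continuousOn fun s hs =>
      ⟨s.2, NNReal.coe_le_coe.2 (le_of_lt hs)⟩
  exact h2.continuousAt (isOpen_Iio.mem_nhds (lt_add_one t))

section Ito

variable {Ω : Type*} [MeasurableSpace Ω] {P : Measure Ω} {𝓕 : Filtration ℝ≥0 ‹MeasurableSpace Ω›}

/-- Domination up to time t carries the martingale identity through the localizing sequence.
Non-negativity of `G` covers the paths that the localization sets to zero. -/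
theorem IsLocalMartingale.hasCenteredIncrements [IsProbabilityMeasure P] {N : ℝ≥0 → Ω → ℝ}
    (hN : IsLocalMartingale P 𝓕 N) {t : ℝ≥0} {G : Ω → ℝ} (hG : Integrable G P)
    (hNG : ∀ᵐ ω ∂P, ∀ s ≤ t, |N s ω| ≤ G ω) (hG0 : ∀ᵐ ω ∂P, 0 ≤ G ω) :
    HasCenteredIncrements P 𝓕 t N := by
  obtain ⟨τ, hτ, hmart⟩ := hN
  set M : ℕ → ℝ≥0 → Ω → ℝ := fun n =>
    stoppedProcess (fun i => {ω | ⊥ < τ n ω}.indicator (N i)) (τ n) with hM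
  have hb : ∀ n, ∀ s ≤ t, ∀ᵐ ω ∂P, ‖M n s ω‖ ≤ G ω := by
    intro n s hs
    filter_upwards [hNG, hG0] with ω hω h0
    simp only [hM, Real.norm_eq_abs]
    rcases le_total (s : WithTop ℝ≥0) (τ n ω) with h | h
    · rw [stoppedProcess_eq_of_le h, Set.indicator_apply]
      split_ifs
      · exact hω s hs
      · simpa using h0
    · rw [stoppedProcess_eq_of_ge h]
      obtain ⟨u, hu⟩ := WithTop.ne_top_iff_exists.1 (ne_top_of_le_ne_top WithTop.coe_ne_top h)
      rw [← hu] at h ⊢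
      have h3 : u ≤ s := by exact_mod_cast h
      rw [Set.indicator_apply]
      split_ifs
      · exact hω u (h3.trans hs)
      · simpa using h0
  have hlim : ∀ s, ∀ᵐ ω ∂P, Tendsto (fun n => M n s ω) atTop (𝓝 (N s ω)) := by
    intro s
    filter_upwards [hτ.tendsto_top] with ω htop
    have h2 : ∀ᶠ n in atTop, ((s + 1 : ℝ≥0) : WithTop ℝ≥0) < τ n ω :=
      htop.eventually (lt_mem_nhds (WithTop.coe_lt_top _))
    refine tendsto_const_nhds.congr' ?_
    filter_upwards [h2] with n hn
    have h4 : ((s : ℝ≥0) : WithTop ℝ≥0) ≤ τ n ω :=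
      le_trans (by exact_mod_cast (le_self_add : s ≤ s + 1)) hn.le
    have h5 : ω ∈ {ω | ⊥ < τ n ω} := bot_le.trans_lt hn
    simp only [hM]
    rw [stoppedProcess_eq_of_le h4, Set.indicator_of_mem h5]
  have hMm : ∀ n s, AEStronglyMeasurable (M n s) P := fun n s =>
    ((hmart n).integrable s).aestronglyMeasurable
  have hlimint : ∀ s ≤ t, ∀ A : Set Ω,
      Tendsto (fun n => ∫ ω in A, M n s ω ∂P) atTop (𝓝 (∫ ω in A, N s ω ∂P)) := fun s hs A =>
    tendsto_integral_of_dominated_convergence G (fun n => (hMm n s).restrict) hG.integrableOn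
      (fun n => ae_restrict_of_ae (hb n s hs)) (ae_restrict_of_ae (hlim s))
  have hNi : ∀ s ≤ t, Integrable (N s) P := fun s hs =>
    hG.mono' (aestronglyMeasurable_of_tendsto_ae atTop (fun n => hMm n s) (hlim s))
      (by filter_upwards [hNG] with ω hω using hω s hs)
  refine ⟨hNi, fun s s' hss' hs' A hA => ?_⟩
  rw [integral_sub (hNi s' hs').integrableOn (hNi s (hss'.trans hs')).integrableOn, sub_eq_zero]
  refine tendsto_nhds_unique (hlimint s' hs' A) ?_
  refine (hlimint s (hss'.trans hs') A).congr fun n => ?_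
  exact (hmart n).setIntegral_eq hss' hA

theorem IsItoProcess.ae_intervalIntegrable_itoDrift {d : ℕ} {V : Type*} [NormedAddCommGroup V]
    [NormedSpace ℝ V] [FiniteDimensional ℝ V] [MeasurableSpace V] [BorelSpace V]
    {W : ℝ≥0 → Ω → Vec d} {U : Set V} {Z : ℝ≥0 → Ω → V} {b : ℝ≥0 → Ω → V}
    {s : ℝ≥0 → Ω → Fin d → V} (hZ : IsItoProcess P 𝓕 W U Z b s)
    (hW : ∀ ω, Continuous fun t => W t ω) (hb : ∀ ω, Measurable fun t => b t ω)
    (hs : ∀ ω i, Measurable fun t => s t ω i) {φ : Vec d × V → ℝ} (hφ : ContDiff ℝ 2 φ)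
    (hc : HasCompactSupport φ) : ∀ᵐ ω ∂P, ∀ t : ℝ≥0, IntervalIntegrable
      (fun r : ℝ => itoDrift φ (W r.toNNReal ω, Z r.toNNReal ω) (b r.toNNReal ω)
        (s r.toNNReal ω)) volume 0 t := by
  have : ProperSpace V := FiniteDimensional.proper_real V
  obtain ⟨C, hC, hbd⟩ := exists_itoDrift_bound hφ hc
  filter_upwards [hZ.integrable_coefficients] with ω hω t
  refine (((intervalIntegrable_const (c := (1 : ℝ))).add (hω t)).const_mul C).mono_fun ?_ ?_
  · have hp : Measurable fun r : ℝ => (W r.toNNReal ω, Z r.toNNReal ω) :=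
      (((hW ω).measurable.prodMk (hZ.continuous_paths ω).measurable)).comp measurable_real_toNNReal
    exact (measurable_itoDrift φ hp ((hb ω).comp measurable_real_toNNReal)
      (fun i => (hs ω i).comp measurable_real_toNNReal)).aestronglyMeasurable
  · refine Eventually.of_forall fun r => ?_
    exact (hbd _ _ _).trans (le_abs_self _)

end Ito

/-! ### Dynkin's formula up to the exit from a compact set -/

section Dynkin

variable {Ω : Type*} [MeasurableSpace Ω] {P : Measure Ω} [IsProbabilityMeasure P]
  {𝓕 : Filtration ℝ≥0 ‹MeasurableSpace Ω›} {d : ℕ} {W : ℝ≥0 → Ω → Vec d} {D : Set (Vec d)}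
  {μ : Vec d → Vec d} {σ : Vec d → Matrix (Fin d) (Fin d) ℝ}
  {κ : ℝ≥0 → Kernel (Vec d) (Vec d)} {X : ℝ≥0 → Ω → Vec d} {ϖ : Vec d → ℝ}

theorem measurable_column (hσ : ∀ j k, Measurable fun x => σ x j k) (i : Fin d) :
    Measurable fun x => column (σ x) i :=
  (WithLp.measurable_toLp 2 _).comp (measurable_pi_lambda _ fun j => hσ j i)

theorem IsFactorDiffusion.isStationaryMarkov (hX : IsFactorDiffusion P 𝓕 W D μ σ κ X)
    (hstat : IsStationaryWithDensity P X ϖ) :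
    IsStationaryMarkov P 𝓕 κ X (densityMeasure ϖ) where
  adapted t := (hX.sde.adapted t).measurable
  continuous_paths := hX.sde.continuous_paths
  law := hstat
  isMarkovKernel := hX.markovKernel
  markov := hX.markov

/-- Dynkin's formula for the factor process stopped upon leaving a compact set. -/
theorem IsFactorDiffusion.integral_exitTime (hX : IsFactorDiffusion P 𝓕 W D μ σ κ X)
    (hϖ : IsInvariantDensity D μ σ κ ϖ) (hM : IsStationaryMarkov P 𝓕 κ X (densityMeasure ϖ))
    {g q : Vec d → ℝ} (hg : ContDiffOn ℝ 2 g D) (hqg : ∀ x ∈ D, q x = generator μ σ g x)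
    {K : Set (Vec d × Vec d)} (hK : IsCompact K) (hKD : K ⊆ Set.univ ×ˢ D) (t : ℝ≥0)
    {A : Set Ω} (hA : MeasurableSet[𝓕 0] A) :
    Integrable (fun ω => g (X (exitTime (fun s => (W s ω, X s ω)) K t) ω) - g (X 0 ω)
      - ∫ r in (0 : ℝ)..exitTime (fun s => (W s ω, X s ω)) K t, q (X r.toNNReal ω)) P ∧
    ∫ ω in A, (g (X (exitTime (fun s => (W s ω, X s ω)) K t) ω) - g (X 0 ω)
      - ∫ r in (0 : ℝ)..exitTime (fun s => (W s ω, X s ω)) K t, q (X r.toNNReal ω)) ∂P = 0 := by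
  have hU : IsOpen (Set.univ ×ˢ D : Set (Vec d × Vec d)) := isOpen_univ.prod hX.isOpen_domain
  obtain ⟨χ, hχ, hχc, hχs, hχ1⟩ := exists_smooth_cutoff hK hU hKD
  have hg2 : ContDiffOn ℝ 2 (fun p : Vec d × Vec d => g p.2) (Set.univ ×ˢ D) :=
    hg.comp contDiffOn_snd fun p hp => hp.2
  -- The martingale problem asks for compact support in both variables. The cutoff therefore acts on
  -- the pair (W, X), and it is the pair that is stopped.
  let φ : Vec d × Vec d → ℝ := fun p => χ p * g p.2
  have hφ : ContDiff ℝ 2 φ :=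
    contDiff_cutoff_mul hU (contDiff_infty.1 hχ 2) hχs hg2
  have hφc : HasCompactSupport φ := hχc.mul_right
  have hφs : tsupport φ ⊆ Set.univ ×ˢ D := (tsupport_mul_subset_left).trans hχs
  have hφg : ∀ p ∈ K, φ =ᶠ[𝓝 p] fun p => g p.2 := fun p hp => by
    filter_upwards [hχ1 p hp] with y hy
    simp [φ, hy]
  let a : ℝ → Ω → ℝ := fun r ω => itoDrift φ (W r.toNNReal ω, X r.toNNReal ω)
    (μ (X r.toNNReal ω)) fun i => column (σ (X r.toNNReal ω)) i
  let Φ : ℝ≥0 → Ω → ℝ := fun s ω => φ (W s ω, X s ω) - ∫ r in (0 : ℝ)..s, a r ω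
  have hmart : IsLocalMartingale P 𝓕 Φ := hX.sde.martingale_problem φ hφ hφc hφs
  obtain ⟨C, hC, hbd⟩ := exists_itoDrift_bound hφ hφc
  obtain ⟨C₀, hC₀⟩ := hφc.exists_bound_of_continuous hφ.continuous
  have hC₀' : 0 ≤ C₀ := (norm_nonneg _).trans (hC₀ 0)
  let K' : Set (Vec d) := Prod.snd '' tsupport φ
  have hK' : IsCompact K' := hφc.image continuous_snd
  have hK'D : K' ⊆ D := by rintro _ ⟨p, hp, rfl⟩; exact (hφs hp).2
  -- A majorant of the drift of φ depending on the state alone: it lives on the projection of the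
  -- support of φ, where the coefficients are integrable. By stationarity its time integral is an
  -- integrable bound.
  let β : Vec d → ℝ := K'.indicator fun x => C * (1 + (‖μ x‖ + ∑ i, ‖column (σ x) i‖ ^ 2))
  have hcol := measurable_column hX.measurable_dispersion
  have hβm : Measurable β := by
    refine Measurable.indicator ?_ hK'.measurableSet
    have := Finset.measurable_sum Finset.univ fun i _ => (hcol i).norm.pow_const 2
    exact ((hX.measurable_drift.norm.add this).const_add 1).const_mul C
  have hβi : Integrable β (densityMeasure ϖ) := by
    rw [integrable_indicator_iff hK'.measurableSet]
    exact (hϖ.integrableOn_coefficients hX.isOpen_domain hX.measurable_drift hK' hK'D).const_mul C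
  have hβ0 : ∀ x, 0 ≤ β x := fun x => Set.indicator_nonneg (fun x _ => by positivity) x
  have haβ : ∀ r ω, ‖a r ω‖ ≤ β (X r.toNNReal ω) := fun r ω => by
    by_cases h : X r.toNNReal ω ∈ K'
    · rw [Real.norm_eq_abs]
      simp only [β, Set.indicator_of_mem h]
      exact hbd _ _ _
    · have : (W r.toNNReal ω, X r.toNNReal ω) ∉ tsupport φ := fun h' => h ⟨_, h', rfl⟩
      simp only [a, itoDrift_eq_zero this, norm_zero]
      exact hβ0 _
  have hai : ∀ᵐ ω ∂P, ∀ s : ℝ≥0, IntervalIntegrable (fun r => a r ω) volume 0 s := by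
    refine hX.sde.ae_intervalIntegrable_itoDrift hX.brownian.continuous_paths ?_ ?_ hφ hφc
    · exact fun ω => hX.measurable_drift.comp (hX.sde.continuous_paths ω).measurable
    · exact fun ω i => (hcol i).comp (hX.sde.continuous_paths ω).measurable
  let G : Ω → ℝ := fun ω => C₀ + ∫ r in (0 : ℝ)..t, β (X r.toNNReal ω)
  have hG : Integrable G P :=
    (integrable_const C₀).add (hM.integrable_intervalIntegral hβm hβi 0 t)
  have hG0 : ∀ᵐ ω ∂P, 0 ≤ G ω := Eventually.of_forall fun ω =>
    add_nonneg hC₀' (intervalIntegral.integral_nonneg t.2 fun r _ => hβ0 _)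
  have hΦG : ∀ᵐ ω ∂P, ∀ s ≤ t, |Φ s ω| ≤ G ω := by
    filter_upwards [hM.ae_intervalIntegrable hβm hβi] with ω hω s hs
    refine (abs_sub _ _).trans (add_le_add (hC₀ _) ?_)
    have h1 : ‖∫ r in (0 : ℝ)..s, a r ω‖ ≤ ∫ r in (0 : ℝ)..s, β (X r.toNNReal ω) :=
      intervalIntegral.norm_integral_le_of_norm_le s.2
        (Eventually.of_forall fun r _ => haβ r ω) (hω _ _)
    refine h1.trans ?_
    exact intervalIntegral.integral_mono_interval le_rfl s.2 (NNReal.coe_le_coe.2 hs)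
      (Eventually.of_forall fun r => hβ0 _) (hω _ _)
  have hcent := hmart.hasCenteredIncrements hG hΦG hG0
  have hΦc : ∀ᵐ ω ∂P, ContinuousOn (fun s => Φ s ω) (Set.Iic t) := by
    filter_upwards [hai] with ω hω
    refine Continuous.continuousOn (Continuous.sub ?_ (continuous_primitive_nnreal hω))
    exact hφ.continuous.comp
      ((hX.brownian.continuous_paths ω).prodMk (hX.sde.continuous_paths ω))
  have hZm : ∀ s, Measurable[𝓕 s] fun ω => (W s ω, X s ω) := fun s =>
    ((hX.brownian.adapted s).measurable).prodMk (hM.adapted s)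
  have hfinal := hcent.exitTime hZm hK.isClosed hΦc hG hΦG hA
  have heq : ∀ ω, Φ (exitTime (fun s => (W s ω, X s ω)) K t) ω - Φ 0 ω
      = g (X (exitTime (fun s => (W s ω, X s ω)) K t) ω) - g (X 0 ω)
      - ∫ r in (0 : ℝ)..exitTime (fun s => (W s ω, X s ω)) K t, q (X r.toNNReal ω) := by
    intro ω
    have hZc : Continuous fun s => (W s ω, X s ω) :=
      (hX.brownian.continuous_paths ω).prodMk (hX.sde.continuous_paths ω)
    set τ := exitTime (fun s => (W s ω, X s ω)) K t with hτ
    -- At exit time 0 the path may start outside `K`, where φ need not agree with g, but both sides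
    -- are then zero.
    by_cases h0 : τ = 0
    · simp [h0]
    · have hmem : ∀ s ≤ τ, (W s ω, X s ω) ∈ K := fun s hs =>
        mem_of_le_exitTime hZc hK.isClosed hs h0
      have e1 : ∀ s ≤ τ, φ (W s ω, X s ω) = g (X s ω) := fun s hs =>
        (hφg _ (hmem s hs)).eq_of_nhds
      have e2 : ∫ r in (0 : ℝ)..τ, a r ω = ∫ r in (0 : ℝ)..τ, q (X r.toNNReal ω) := by
        refine intervalIntegral.integral_congr fun r hr => ?_
        rw [Set.uIcc_of_le (NNReal.coe_nonneg τ)] at hr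
        have hr' : r.toNNReal ≤ τ := Real.toNNReal_le_iff_le_coe.2 hr.2
        have hm := hmem _ hr'
        have hD := (hKD hm).2
        simp only [a]
        rw [itoDrift_congr (hφg _ hm), itoDrift_comp_snd (k := g)
          (hg.contDiffAt (hX.isOpen_domain.mem_nhds hD)), hqg _ hD, generator_eq]
      simp only [Φ, e1 τ le_rfl, e1 0 zero_le, e2, NNReal.coe_zero, intervalIntegral.integral_same]
      ring
  simp only [heq] at hfinal
  exact hfinal

/-- Along almost every path, the exit times from the sets of a compact exhaustion reach any given
time. -/
theorem exists_exitTime_eq {V : Type*} [TopologicalSpace V] {Z : ℝ≥0 → V} (hZ : Continuous Z)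
    {U : Set V} (hU : ∀ s, Z s ∈ U) {K : ℕ → Set V} (hmono : Monotone K)
    (hK : ∀ C, IsCompact C → C ⊆ U → ∃ n, C ⊆ K n) (t : ℝ≥0) :
    ∃ N, ∀ n ≥ N, exitTime Z (K n) t = t := by
  obtain ⟨N, hN⟩ := hK (Z '' Set.Icc 0 t) (isCompact_Icc.image hZ)
    (by rintro _ ⟨s, -, rfl⟩; exact hU s)
  exact ⟨N, fun n hn => exitTime_eq fun s hs => hmono hn (hN ⟨s, ⟨zero_le, hs⟩, rfl⟩)⟩

end Dynkin

/-! ### The drift of the squared VIX -/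

section Market

theorem ae_eq_zero_of_primitive_eq_zero {a : ℝ → ℝ} (ha : ∀ t : ℝ≥0, IntervalIntegrable a volume 0 t)
    (h : ∀ t : ℝ≥0, ∫ r in (0 : ℝ)..t, a r = 0) :
    ∀ᵐ r ∂(volume.restrict (Set.Ioo (0 : ℝ) 1)), a r = 0 := by
  have h1 := (ha 1).ae_hasDerivAt_integral
  rw [ae_restrict_iff' measurableSet_Ioo]
  filter_upwards [h1] with r hr hr01
  have h2 := hr (by rw [NNReal.coe_one, Set.uIcc_of_le zero_le_one]; exact ⟨hr01.1.le, hr01.2.le⟩) 0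
    (by simp)
  have h3 : (fun x => ∫ r in (0 : ℝ)..x, a r) =ᶠ[𝓝 r] fun _ => 0 := by
    filter_upwards [isOpen_Ioo.mem_nhds hr01] with x hx
    exact h ⟨x, hx.1.le⟩
  exact (h2.unique ((hasDerivAt_const r (0 : ℝ)).congr_of_eventuallyEq h3))

variable {Ω : Type*} [MeasurableSpace Ω] {P : Measure Ω} [IsProbabilityMeasure P]
  {𝓕 : Filtration ℝ≥0 ‹MeasurableSpace Ω›} {d : ℕ} {W : ℝ≥0 → Ω → Vec d} {D : Set (Vec d)}
  {μ : Vec d → Vec d} {σ : Vec d → Matrix (Fin d) (Fin d) ℝ}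
  {κ : ℝ≥0 → Kernel (Vec d) (Vec d)} {X : ℝ≥0 → Ω → Vec d} {ϖ : Vec d → ℝ}
  {F : ℝ≥0 → ℝ≥0 → Ω → ℝ} {vol : ℝ≥0 → ℝ≥0 → Ω → Vec d}
  {f : ℝ≥0 → Vec d → ℝ} {ν : ℝ≥0 → Vec d → Vec d} {h : Vec d → ℝ}

/-- At zero time to maturity F_{t,t} = h(X_t) almost surely for each t. The square h² is continuous
on `D`, while h need not be, so only the squares extend from a countable dense set of times to all
times. -/
theorem ae_forall_sq_eq (hX : IsFactorDiffusion P 𝓕 W D μ σ κ X)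
    (hM : IsStationaryMarkov P 𝓕 κ X (densityMeasure ϖ))
    (hFX : IsMarkovianMarketModel P 𝓕 W D μ σ X F vol f ν) (h_meas : Measurable h)
    (h_cons : InterModelConsistent P 𝓕 X F h) (h_cont : ContinuousOn (fun x => h x ^ 2) D)
    (hi : Integrable h (densityMeasure ϖ)) :
    ∀ᵐ ω ∂P, ∀ t, F t (t + 0) ω ^ 2 = h (X t ω) ^ 2 := by
  have h1 : ∀ t, F t (t + 0) =ᵐ[P] fun ω => h (X t ω) := fun t => by
    have := h_cons t 0
    rw [condExp_of_stronglyMeasurable (𝓕.le t) ?_ (hM.integrable_comp _ hi)] at this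
    · simpa only [add_zero] using this
    · rw [add_zero]
      exact (h_meas.comp (hM.adapted t)).stronglyMeasurable
  obtain ⟨S, hSc, hSd⟩ := TopologicalSpace.exists_countable_dense ℝ≥0
  have h2 : ∀ᵐ ω ∂P, ∀ t ∈ S, F t (t + 0) ω = h (X t ω) :=
    (ae_ball_iff hSc).2 fun t _ => h1 t
  filter_upwards [h2] with ω hω t
  have c1 : Continuous fun t => F t (t + 0) ω ^ 2 :=
    (continuous_snd.comp ((hFX.cmf_sde 0).continuous_paths ω)).pow 2
  have c2 : Continuous fun t => h (X t ω) ^ 2 :=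
    h_cont.comp_continuous (hX.sde.continuous_paths ω) fun t => hX.sde.mem_domain t ω
  exact congrFun (c1.ext_on hSd c2 fun t ht => by simp only [hω t ht]) t

/-- The drift of the squared VIX, computed in the market model and from the factor process. -/
theorem ae_rollYield_eq_generator (hX : IsFactorDiffusion P 𝓕 W D μ σ κ X)
    (hM : IsStationaryMarkov P 𝓕 κ X (densityMeasure ϖ))
    (hFX : IsMarkovianMarketModel P 𝓕 W D μ σ X F vol f ν) (h_meas : Measurable h)
    (h_cons : InterModelConsistent P 𝓕 X F h) (h_smooth : ContDiffOn ℝ 2 (fun x => h x ^ 2) D)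
    (hi : Integrable h (densityMeasure ϖ)) :
    (fun x => (2 * f 0 x + ‖ν 0 x‖ ^ 2) * h x ^ 2)
      =ᵐ[densityMeasure ϖ] generator μ σ fun x => h x ^ 2 := by
  set g : Vec d → ℝ := fun x => h x ^ 2 with hg
  have hFsq := ae_forall_sq_eq hX hM hFX h_meas h_cons h_smooth.continuousOn hi
  have hsde := hFX.cmf_sde 0
  let U : Set (Vec d × (Vec d × ℝ)) := Set.univ ×ˢ (D ×ˢ Set.univ)
  have hU : IsOpen U := isOpen_univ.prod (hX.isOpen_domain.prod isOpen_univ)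
  obtain ⟨K, hKc, hKU, hKm, hKe⟩ := exists_compact_exhaustion_of_isOpen hU
  let ψ : Vec d × (Vec d × ℝ) → ℝ := fun p => p.2.2 ^ 2 - g p.2.1
  have hψ : ContDiffOn ℝ 2 ψ U := by
    refine ContDiffOn.sub (by fun_prop) ?_
    exact h_smooth.comp (contDiff_fst.comp contDiff_snd).contDiffOn fun p hp => hp.2.1
  let b : ℝ≥0 → Ω → Vec d × ℝ := fun t ω => (μ (X t ω), F t (t + 0) ω * f 0 (X t ω))
  let s : ℝ≥0 → Ω → Fin d → Vec d × ℝ := fun t ω i =>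
    (column (σ (X t ω)) i, F t (t + 0) ω * ν 0 (X t ω) i)
  let Z : ℝ≥0 → Ω → Vec d × ℝ := fun t ω => (X t ω, F t (t + 0) ω)
  have hcol := measurable_column hX.measurable_dispersion
  have hXc := fun ω => (hX.sde.continuous_paths ω).measurable
  have hFc : ∀ ω, Measurable fun t => F t (t + 0) ω := fun ω =>
    (continuous_snd.comp (hsde.continuous_paths ω)).measurable
  have hνi : ∀ i, Measurable fun x => ν 0 x i := fun i =>
    (EuclideanSpace.proj i : Vec d →L[ℝ] ℝ).continuous.measurable.comp (hFX.measurable_volatility 0)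
  have hb : ∀ ω, Measurable fun t => b t ω := fun ω =>
    (hX.measurable_drift.comp (hXc ω)).prodMk
      ((hFc ω).mul ((hFX.measurable_rollYield 0).comp (hXc ω)))
  have hs : ∀ ω i, Measurable fun t => s t ω i := fun ω i =>
    ((hcol i).comp (hXc ω)).prodMk ((hFc ω).mul ((hνi i).comp (hXc ω)))
  -- On each set of the exhaustion the difference of the two drifts vanishes.
  have key : ∀ n, ∀ᵐ ω ∂P, ∀ᵐ r ∂(volume.restrict (Set.Ioo (0 : ℝ) 1)),
      (W r.toNNReal ω, Z r.toNNReal ω) ∈ K n →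
        (2 * f 0 (X r.toNNReal ω) + ‖ν 0 (X r.toNNReal ω)‖ ^ 2) * F r.toNNReal (r.toNNReal + 0) ω ^ 2
          = generator μ σ g (X r.toNNReal ω) := by
    intro n
    obtain ⟨χ, hχ, hχc, hχs, hχ1⟩ := exists_smooth_cutoff (hKc n) hU (hKU n)
    let φ : Vec d × (Vec d × ℝ) → ℝ := fun p => χ p * ψ p
    have hφ : ContDiff ℝ 2 φ :=
      contDiff_cutoff_mul hU (contDiff_infty.1 hχ 2) hχs hψ
    have hφc : HasCompactSupport φ := hχc.mul_right
    have hφs : tsupport φ ⊆ U := (tsupport_mul_subset_left).trans hχs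
    let a : ℝ → Ω → ℝ := fun r ω => itoDrift φ (W r.toNNReal ω, Z r.toNNReal ω)
      (b r.toNNReal ω) (s r.toNNReal ω)
    have hai : ∀ᵐ ω ∂P, ∀ t : ℝ≥0, IntervalIntegrable (fun r => a r ω) volume 0 t :=
      hsde.ae_intervalIntegrable_itoDrift hX.brownian.continuous_paths hb hs hφ hφc
    let N : ℝ≥0 → Ω → ℝ := fun t ω => φ (W t ω, Z t ω) - ∫ r in (0 : ℝ)..t, a r ω
    have hN : IsLocalMartingale P 𝓕 N := hsde.martingale_problem φ hφ hφc hφs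
    -- The test function vanishes along the path, which leaves a pure time integral. Its variation
    -- is dominated by ∫|a|, so the local martingale is constant and the drift vanishes.
    have hNa : ∀ᵐ ω ∂P, ∀ t, N t ω = -∫ r in (0 : ℝ)..t, a r ω := by
      filter_upwards [hFsq] with ω hω t
      have h0 : ψ (W t ω, Z t ω) = 0 := sub_eq_zero.2 (hω t)
      simp only [N, φ, h0, mul_zero, zero_sub]
    have hzero : ∀ T, N T =ᵐ[P] N 0 := by
      refine localMartingale_eq_of_finite_variation hN ?_
      filter_upwards [hNa, hai] with ω h1 h2
      have h2' : ∀ t : ℝ≥0, IntervalIntegrable (fun r => |a r ω|) volume 0 t := fun t => (h2 t).abs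
      have hsub : ∀ u v : ℝ≥0, IntervalIntegrable (fun r => a r ω) volume u v := fun u v =>
        (h2 u).symm.trans (h2 v)
      have hdiff : ∀ u v : ℝ≥0, (∫ r in (0 : ℝ)..v, |a r ω|) - ∫ r in (0 : ℝ)..u, |a r ω|
          = ∫ r in (u : ℝ)..v, |a r ω| := fun u v =>
        intervalIntegral.integral_interval_sub_left (h2' v) (h2' u)
      refine ⟨fun t => ∫ r in (0 : ℝ)..t, |a r ω|, continuous_primitive_nnreal h2', ?_, ?_⟩
      · intro u v huv
        rw [← sub_nonneg, hdiff]
        exact intervalIntegral.integral_nonneg (NNReal.coe_le_coe.2 huv) fun r _ => abs_nonneg _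
      · intro u v huv
        rw [h1, h1, hdiff, neg_sub_neg, ← abs_neg, neg_sub,
          intervalIntegral.integral_interval_sub_left (h2 v) (h2 u)]
        exact intervalIntegral.abs_integral_le_integral_abs (NNReal.coe_le_coe.2 huv)
    obtain ⟨S, hSc, hSd⟩ := TopologicalSpace.exists_countable_dense ℝ≥0
    have hzero' : ∀ᵐ ω ∂P, ∀ t ∈ S, N t ω = N 0 ω := (ae_ball_iff hSc).2 fun t _ => hzero t
    filter_upwards [hzero', hNa, hai, hFsq] with ω h1 h2 h3 h4
    have h5 : ∀ t : ℝ≥0, ∫ r in (0 : ℝ)..t, a r ω = 0 := by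
      have := (continuous_primitive_nnreal h3).ext_on hSd continuous_const (g := fun _ => 0)
        fun t ht => by
          have h6 := h1 t ht
          rw [h2, h2] at h6
          simpa using h6
      exact fun t => congrFun this t
    filter_upwards [ae_eq_zero_of_primitive_eq_zero h3 h5] with r hr hmem
    have hφψ : φ =ᶠ[𝓝 (W r.toNNReal ω, Z r.toNNReal ω)] ψ := by
      filter_upwards [hχ1 _ hmem] with y hy
      simp [φ, hy]
    have hD := (hKU n hmem).2.1
    simp only [a] at hr
    rw [itoDrift_congr hφψ, itoDrift_sq_sub (g := g)
      (h_smooth.contDiffAt (hX.isOpen_domain.mem_nhds hD)), sub_eq_zero] at hr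
    rw [generator_eq, ← hr]
    simp only [Z, b, s, EuclideanSpace.real_norm_sq_eq, mul_pow, ← Finset.mul_sum]
    ring
  have hall : ∀ᵐ ω ∂P, ∀ᵐ r ∂(volume.restrict (Set.Ioo (0 : ℝ) 1)),
      (2 * f 0 (X r.toNNReal ω) + ‖ν 0 (X r.toNNReal ω)‖ ^ 2) * h (X r.toNNReal ω) ^ 2
        = generator μ σ g (X r.toNNReal ω) := by
    filter_upwards [ae_all_iff.2 key, hFsq] with ω h1 h2
    filter_upwards [ae_all_iff.2 h1] with r hr
    obtain ⟨n, hn⟩ := hKe {(W r.toNNReal ω, Z r.toNNReal ω)} isCompact_singleton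
      (Set.singleton_subset_iff.2 ⟨trivial, hsde.mem_domain _ _⟩)
    have := hr n (hn rfl)
    rwa [h2] at this
  have hkm : Measurable fun x => (2 * f 0 x + ‖ν 0 x‖ ^ 2) * h x ^ 2 - generator μ σ g x := by
    have h1 := hFX.measurable_rollYield 0
    have h2 := hFX.measurable_volatility 0
    have h3 := measurable_generator hX.measurable_drift hX.measurable_dispersion g
    exact (((h1.const_mul 2).add (h2.norm.pow_const 2)).mul (h_meas.pow_const 2)).sub h3
  have hset : MeasurableSet {p : Ω × ℝ | (2 * f 0 (X p.2.toNNReal p.1)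
      + ‖ν 0 (X p.2.toNNReal p.1)‖ ^ 2) * h (X p.2.toNNReal p.1) ^ 2
      = generator μ σ g (X p.2.toNNReal p.1)} := by
    have := (hM.measurable_uncurry hkm).comp (measurable_swap (α := Ω) (β := ℝ))
    have := this (measurableSet_singleton 0)
    convert this using 1
    ext p
    simp [Function.uncurry, sub_eq_zero]
  -- After exchanging the order, one good time r in (0, 1) suffices, because X_r has the invariant
  -- law.
  rw [Measure.ae_ae_comm hset] at hall
  have hne : (ae (volume.restrict (Set.Ioo (0 : ℝ) 1))).NeBot := by
    rw [ae_neBot, Ne, Measure.restrict_eq_zero, Real.volume_Ioo]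
    simp
  obtain ⟨r, hr⟩ := hall.exists
  have h7 : ∀ᵐ x ∂(P.map (X r.toNNReal)),
      (2 * f 0 x + ‖ν 0 x‖ ^ 2) * h x ^ 2 - generator μ σ g x = 0 := by
    refine (ae_map_iff (hM.measurable _).aemeasurable (hkm (measurableSet_singleton 0))).2 ?_
    filter_upwards [hr] with ω hω
    exact sub_eq_zero.2 hω
  rw [hM.law] at h7
  filter_upwards [h7] with x hx using sub_eq_zero.1 hx

end Market

/-- Fatou's lemma for integrable functions with an integrable lower bound. -/
theorem integrable_and_integral_le_of_tendsto {α : Type*} {m : MeasurableSpace α} {μ : Measure α}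
    {f : ℕ → α → ℝ} {F G : α → ℝ} (hf : ∀ n, Integrable (f n) μ) (hG : Integrable G μ)
    (hle : ∀ n, ∀ᵐ a ∂μ, -G a ≤ f n a)
    (hlim : ∀ᵐ a ∂μ, Tendsto (fun n => f n a) atTop (𝓝 (F a))) {c : ℝ}
    (hc : ∀ n, ∫ a, f n a ∂μ ≤ c) : Integrable F μ ∧ ∫ a, F a ∂μ ≤ c := by
  have hFm : AEStronglyMeasurable F μ :=
    aestronglyMeasurable_of_tendsto_ae atTop (fun n => (hf n).aestronglyMeasurable) hlim
  have hki : ∀ n, Integrable (fun a => f n a + G a) μ := fun n => (hf n).add hG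
  have hk0 : ∀ n, 0 ≤ᵐ[μ] fun a => f n a + G a := fun n => by
    filter_upwards [hle n] with a ha
    simp only [Pi.zero_apply]; linarith
  have hF0 : 0 ≤ᵐ[μ] fun a => F a + G a := by
    filter_upwards [hlim, ae_all_iff.2 hk0] with a ha h0
    exact ge_of_tendsto' (ha.add_const (G a)) h0
  have hbd : ∫⁻ a, ENNReal.ofReal (F a + G a) ∂μ ≤ ENNReal.ofReal (c + ∫ a, G a ∂μ) := by
    calc ∫⁻ a, ENNReal.ofReal (F a + G a) ∂μ
        = ∫⁻ a, liminf (fun n => ENNReal.ofReal (f n a + G a)) atTop ∂μ := by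
          refine lintegral_congr_ae ?_
          filter_upwards [hlim] with a ha
          exact ((ENNReal.tendsto_ofReal (ha.add_const (G a))).liminf_eq).symm
      _ ≤ liminf (fun n => ∫⁻ a, ENNReal.ofReal (f n a + G a) ∂μ) atTop :=
          lintegral_liminf_le' fun n => (hki n).aestronglyMeasurable.aemeasurable.ennreal_ofReal
      _ ≤ ENNReal.ofReal (c + ∫ a, G a ∂μ) := by
          refine liminf_le_of_le (by isBoundedDefault) fun b hb => ?_
          obtain ⟨n, hn⟩ := hb.exists
          refine hn.trans ?_
          rw [← ofReal_integral_eq_lintegral_ofReal (hki n) (hk0 n), integral_add (hf n) hG]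
          exact ENNReal.ofReal_le_ofReal (by linarith [hc n])
  have hFG : Integrable (fun a => F a + G a) μ :=
    ⟨hFm.add hG.aestronglyMeasurable,
      (hasFiniteIntegral_iff_ofReal hF0).2 (hbd.trans_lt ENNReal.ofReal_lt_top)⟩
  have hF : Integrable F μ := (hFG.sub hG).congr
    (Eventually.of_forall fun a => add_sub_cancel_right _ _)
  have h0 : 0 ≤ c + ∫ a, G a ∂μ := by
    have h1 := integral_nonneg_of_ae (hk0 0)
    rw [integral_add (hf 0) hG] at h1
    linarith [hc 0]
  refine ⟨hF, ?_⟩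
  rw [← ofReal_integral_eq_lintegral_ofReal hFG hF0, ENNReal.ofReal_le_ofReal_iff h0,
    integral_add hF hG] at hbd
  linarith

theorem setIntegral_eq_integral_indicator_mul {α : Type*} {m : MeasurableSpace α} {μ : Measure α}
    {A : Set α} (hA : MeasurableSet A) (k : α → ℝ) :
    ∫ a in A, k a ∂μ = ∫ a, A.indicator 1 a * k a ∂μ := by
  rw [← integral_indicator hA]
  refine integral_congr_ae (Eventually.of_forall fun a => ?_)
  by_cases ha : a ∈ A <;> simp [ha]

/-! ### The inverse problem in weak form -/

section Weak

variable {Ω : Type*} [MeasurableSpace Ω] {d : ℕ} {P : Measure Ω} [IsProbabilityMeasure P]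
  {𝓕 : Filtration ℝ≥0 ‹MeasurableSpace Ω›} {κ : ℝ≥0 → Kernel (Vec d) (Vec d)}
  {X : ℝ≥0 → Ω → Vec d} {π : Measure (Vec d)} {τ : ℝ} {g w : Vec d → ℝ}

/-- The equation `τ g(x) = E[∫_0^τ w(X_r) dr | X_0 = x]`, tested against bounded weights. -/
def IsWeakSolution (P : Measure Ω) (X : ℝ≥0 → Ω → Vec d) (τ : ℝ) (g w : Vec d → ℝ) : Prop :=
  ∀ ρ : Vec d → ℝ, Measurable ρ → (∀ x, 0 ≤ ρ x) → (∀ x, ρ x ≤ 1) →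
    τ * ∫ ω, ρ (X 0 ω) * g (X 0 ω) ∂P
      = ∫ r in (0 : ℝ)..τ, ∫ ω, ρ (X 0 ω) * w (X r.toNNReal ω) ∂P

namespace IsStationaryMarkov

/-- Conditional expectations given X_0 are determined by integration against bounded functions of
X_0, and Fubini moves the time integral outside. -/
theorem isWeakSolution_iff (hM : IsStationaryMarkov P 𝓕 κ X π) (hτ : 0 < τ) (hgm : Measurable g)
    (hg : Integrable g π) (hwm : Measurable w) (hw : Integrable w π) :
    IsWeakSolution P X τ g w ↔ (fun ω => g (X 0 ω)) =ᵐ[P]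
      P[fun ω => (1 / τ) * ∫ u in (0 : ℝ)..τ, w (X u.toNNReal ω) |
        MeasurableSpace.comap (X 0) inferInstance] := by
  have hI := hM.integrable_intervalIntegral hwm hw 0 τ
  have hle := (hM.measurable 0).comap_le
  constructor
  · intro h
    refine ae_eq_condExp_of_forall_setIntegral_eq hle (hI.const_mul _) ?_ ?_ ?_
    · exact fun s _ _ => (hM.integrable_comp 0 hg).integrableOn
    · rintro _ ⟨B, hB, rfl⟩ -
      have h1 := h (B.indicator 1) (measurable_one.indicator hB)
        (Set.indicator_nonneg fun _ _ => zero_le_one)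
        (Set.indicator_le_self' (fun _ _ => zero_le_one))
      have hZm : Measurable fun ω => B.indicator (1 : Vec d → ℝ) (X 0 ω) :=
        (measurable_one.indicator hB).comp (hM.measurable 0)
      rw [← hM.integral_mul_intervalIntegral hwm hw hZm (C := 1) fun ω => by
        by_cases hω : X 0 ω ∈ B <;> simp [hω]] at h1
      rw [setIntegral_eq_integral_indicator_mul (hM.measurable 0 hB),
        setIntegral_eq_integral_indicator_mul (hM.measurable 0 hB), ← mul_right_inj' hτ.ne']
      refine h1.trans ?_
      rw [← integral_const_mul]
      refine integral_congr_ae (Eventually.of_forall fun ω => ?_)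
      change (X 0 ⁻¹' B).indicator 1 ω * _ = _
      field_simp
    · exact (hgm.comp (comap_measurable (X 0))).aestronglyMeasurable
  · intro h ρ hρ h0 h1
    have hρm : Measurable fun ω => ρ (X 0 ω) := hρ.comp (hM.measurable 0)
    have hρb : ∀ ω, |ρ (X 0 ω)| ≤ 1 := fun ω => by rw [abs_of_nonneg (h0 _)]; exact h1 _
    rw [← hM.integral_mul_intervalIntegral hwm hw hρm hρb]
    have hi : Integrable ((fun ω => ρ (X 0 ω)) * fun ω => (1 / τ) * ∫ u in (0 : ℝ)..τ, w (X u.toNNReal ω)) P :=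
      (hI.const_mul _).bdd_mul (c := 1) hρm.aestronglyMeasurable (Eventually.of_forall hρb)
    have h2 := condExp_mul_of_stronglyMeasurable_left
      (m := MeasurableSpace.comap (X 0) inferInstance)
      (hρ.comp (comap_measurable (X 0))).stronglyMeasurable hi (hI.const_mul _)
    have h3 : ∫ ω, ρ (X 0 ω) * g (X 0 ω) ∂P
        = ∫ ω, ρ (X 0 ω) * ((1 / τ) * ∫ u in (0 : ℝ)..τ, w (X u.toNNReal ω)) ∂P := by
      refine Eq.trans (integral_congr_ae ?_) (integral_condExp hle)
      filter_upwards [h, h2] with ω ha hb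
      rw [ha]
      exact hb.symm
    rw [h3, ← integral_const_mul]
    refine integral_congr_ae (Eventually.of_forall fun ω => ?_)
    field_simp

/-- A weak solution at time `0` is a solution at all times, given the past. -/
theorem isWeakSolution_shift (hM : IsStationaryMarkov P 𝓕 κ X π) (h : IsWeakSolution P X τ g w)
    (hτ : 0 < τ) (hgm : Measurable g) (hg : Integrable g π) (hwm : Measurable w)
    (hw : Integrable w π) (s : ℝ≥0) {Z : Ω → ℝ} (hZ : Measurable[𝓕 s] Z) (hZ0 : ∀ ω, 0 ≤ Z ω)
    (hZ1 : ∀ ω, Z ω ≤ 1) :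
    τ * ∫ ω, Z ω * g (X s ω) ∂P
      = ∫ r in (s : ℝ)..s + τ, ∫ ω, Z ω * w (X r.toNNReal ω) ∂P := by
  -- Replacing `Z` by a weight on the initial state reduces the equation at time `s` to the equation
  -- at time 0.
  obtain ⟨ρ, hρ, hρ0, hρ1, hρe⟩ := hM.exists_weight s hZ hZ0 hZ1
  have h1 := hρe g hgm hg 0
  rw [add_zero] at h1
  rw [h1, h ρ hρ hρ0 hρ1]
  have h2 := intervalIntegral.integral_comp_add_left
    (fun r : ℝ => ∫ ω, Z ω * w (X r.toNNReal ω) ∂P) (s : ℝ) (a := 0) (b := τ)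
  rw [add_zero] at h2
  rw [← h2]
  refine intervalIntegral.integral_congr fun r hr => ?_
  rw [Set.uIcc_of_le hτ.le] at hr
  rw [← hρe w hwm hw, Real.toNNReal_add (NNReal.coe_nonneg s) hr.1, Real.toNNReal_coe]

/-- If `w` is a weak solution then `g` belongs to the domain of the generator, in the sense that
`g(X_t) - ∫_0^t u(X_r) dr` is a martingale. -/
theorem hasCenteredIncrements_of_isWeakSolution (hM : IsStationaryMarkov P 𝓕 κ X π)
    {T : ℝ≥0} (h : IsWeakSolution P X T g w) (hT : 0 < T) (hgm : Measurable g)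
    (hg : Integrable g π) (hwm : Measurable w) (hw : Integrable w π) (t : ℝ≥0) :
    HasCenteredIncrements P 𝓕 t fun s ω =>
      g (X s ω) - ∫ r in (0 : ℝ)..s, (semigroup κ T w (X r.toNNReal ω) - w (X r.toNNReal ω)) / T := by
  have hT' : (0 : ℝ) < T := hT
  let u : Vec d → ℝ := fun x => (semigroup κ T w x - w x) / T
  have hum : Measurable u := ((hM.measurable_semigroup T hwm).sub hwm).div_const _
  have hu : Integrable u π := ((hM.integrable_semigroup T hw).sub hw).div_const _
  have hint : ∀ s : ℝ≥0, Integrable (fun ω => g (X s ω) - ∫ r in (0 : ℝ)..s, u (X r.toNNReal ω)) P :=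
    fun s => (hM.integrable_comp s hg).sub (hM.integrable_intervalIntegral hum hu _ _)
  refine ⟨fun s _ => hint s, fun s s' hs _ A hA => ?_⟩
  have hA' := 𝓕.le _ _ hA
  let Z : Ω → ℝ := A.indicator 1
  have hZ : Measurable[𝓕 s] Z := Measurable.indicator (f := fun _ => (1 : ℝ)) measurable_const hA
  have hZm : Measurable Z := measurable_one.indicator hA'
  have hZ0 : ∀ ω, 0 ≤ Z ω := Set.indicator_nonneg fun _ _ => zero_le_one
  have hZ1 : ∀ ω, Z ω ≤ 1 := Set.indicator_le_self' fun _ _ => zero_le_one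
  have hZC : ∀ ω, |Z ω| ≤ 1 := fun ω => by rw [abs_of_nonneg (hZ0 ω)]; exact hZ1 ω
  have hset : ∀ k : Ω → ℝ, ∫ ω in A, k ω ∂P = ∫ ω, Z ω * k ω ∂P :=
    setIntegral_eq_integral_indicator_mul hA'
  let E : ℝ → ℝ := fun r => ∫ ω, Z ω * w (X r.toNNReal ω) ∂P
  have hE : ∀ a b, IntervalIntegrable E volume a b := fun a b =>
    hM.intervalIntegrable_integral_mul hwm hw hZm hZC a b
  have e1 := hM.isWeakSolution_shift h hT' hgm hg hwm hw s hZ hZ0 hZ1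
  have e2 := hM.isWeakSolution_shift h hT' hgm hg hwm hw s' (hZ.mono (𝓕.mono hs) le_rfl) hZ0 hZ1
  have hbd : ∀ {k : Ω → ℝ}, Integrable k P → Integrable (fun ω => Z ω * k ω) P := fun hk =>
    hk.bdd_mul (c := 1) hZm.aestronglyMeasurable (Eventually.of_forall hZC)
  -- By the Markov property, P_T w at X_r has the same weighted mean as w at X_{r+T}.
  have e3 : ∀ r ∈ Set.uIcc (s : ℝ) s', ∫ ω, Z ω * u (X r.toNNReal ω) ∂P = (E (r + T) - E r) / T := by
    intro r hr
    rw [Set.uIcc_of_le (NNReal.coe_le_coe.2 hs)] at hr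
    have hr0 : s ≤ r.toNNReal := NNReal.le_toNNReal_of_coe_le hr.1
    have h1 := hM.integral_mul_comp r.toNNReal T (hZ.mono (𝓕.mono hr0) le_rfl) hZC hwm hw
    have h2 : (r + T).toNNReal = r.toNNReal + T := by
      rw [Real.toNNReal_add (s.2.trans hr.1) (NNReal.coe_nonneg T), Real.toNNReal_coe]
    simp only [E, h2]
    rw [h1, ← integral_sub (hbd (hM.integrable_comp _ (hM.integrable_semigroup T hw)))
      (hbd (hM.integrable_comp _ hw)), ← integral_div]
    refine integral_congr_ae (Eventually.of_forall fun ω => ?_)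
    simp only [u]
    ring
  have e4 : ∫ ω in A, ((∫ r in (0 : ℝ)..s', u (X r.toNNReal ω)) - ∫ r in (0 : ℝ)..s, u (X r.toNNReal ω)) ∂P
      = ∫ r in (s : ℝ)..s', (E (r + T) - E r) / T := by
    rw [← intervalIntegral.integral_congr e3, ← hM.integral_mul_intervalIntegral hum hu hZm hZC, hset]
    refine integral_congr_ae ?_
    filter_upwards [hM.ae_intervalIntegrable hum hu] with ω hω
    rw [intervalIntegral.integral_interval_sub_left (hω _ _) (hω _ _)]
  -- The integrals of E over [s+T, s'+T] and over [s, s'] differ by the same amount as those over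
  -- the windows [s', s'+T] and [s, s+T], which the shifted equation evaluates by g.
  have e5 : ∫ r in (s : ℝ)..s', (E (r + T) - E r) / T
      = ((∫ r in (s' : ℝ)..s' + T, E r) - ∫ r in (s : ℝ)..s + T, E r) / T := by
    have hE' : IntervalIntegrable (fun r => E (r + T)) volume s s' := by
      simpa using (hE (s + T) (s' + T)).comp_add_right (T : ℝ)
    rw [intervalIntegral.integral_div, intervalIntegral.integral_sub hE' (hE _ _),
      intervalIntegral.integral_comp_add_right]
    congr 1
    have a1 := intervalIntegral.integral_add_adjacent_intervals (hE s s') (hE s' (s' + T))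
    have a2 := intervalIntegral.integral_add_adjacent_intervals (hE s (s + T)) (hE (s + T) (s' + T))
    linarith
  have hgA := fun s => (hM.integrable_comp s hg).integrableOn (s := A)
  have huA := fun s : ℝ≥0 => (hM.integrable_intervalIntegral hum hu 0 s).integrableOn (s := A)
  have e6 : ∫ ω in A, ((g (X s' ω) - ∫ r in (0 : ℝ)..s', u (X r.toNNReal ω))
      - (g (X s ω) - ∫ r in (0 : ℝ)..s, u (X r.toNNReal ω))) ∂P
      = (∫ ω in A, g (X s' ω) ∂P) - (∫ ω in A, g (X s ω) ∂P)
        - ∫ ω in A, ((∫ r in (0 : ℝ)..s', u (X r.toNNReal ω)) - ∫ r in (0 : ℝ)..s, u (X r.toNNReal ω)) ∂P := by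
    rw [integral_sub (huA s') (huA s), integral_sub (hint s').integrableOn (hint s).integrableOn,
      integral_sub (hgA s') (huA s'), integral_sub (hgA s) (huA s)]
    ring
  change ∫ ω in A, ((g (X s' ω) - ∫ r in (0 : ℝ)..s', u (X r.toNNReal ω))
      - (g (X s ω) - ∫ r in (0 : ℝ)..s, u (X r.toNNReal ω))) ∂P = 0
  rw [e6, e4, e5, hset, hset, ← e1, ← e2]
  field_simp
  ring

/-- Test with the constant weight 1; by stationarity the time average is trivial. -/
theorem integral_eq_of_isWeakSolution (hM : IsStationaryMarkov P 𝓕 κ X π)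
    (h : IsWeakSolution P X τ g w) (hτ : 0 < τ) (hg : Integrable g π) (hw : Integrable w π) :
    ∫ x, w x ∂π = ∫ x, g x ∂π := by
  have := h (fun _ => 1) measurable_const (fun _ => zero_le_one) fun _ => le_rfl
  simp only [one_mul, hM.integral_comp _ hg, hM.integral_comp _ hw,
    intervalIntegral.integral_const, sub_zero, smul_eq_mul] at this
  exact (mul_left_cancel₀ hτ.ne' this).symm

end IsStationaryMarkov

end Weak

/-! ### Identification of the generator by comparing martingales -/

section Identification

variable {Ω : Type*} [MeasurableSpace Ω] {P : Measure Ω} [IsProbabilityMeasure P]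
  {𝓕 : Filtration ℝ≥0 ‹MeasurableSpace Ω›} {d : ℕ} {W : ℝ≥0 → Ω → Vec d} {D : Set (Vec d)}
  {μ : Vec d → Vec d} {σ : Vec d → Matrix (Fin d) (Fin d) ℝ}
  {κ : ℝ≥0 → Kernel (Vec d) (Vec d)} {X : ℝ≥0 → Ω → Vec d} {ϖ : Vec d → ℝ}

theorem abs_intervalIntegral_le_of_le {f : ℝ → ℝ} (hf : ∀ a b, IntervalIntegrable f volume a b)
    {s t : ℝ≥0} (hst : s ≤ t) : |∫ r in (0 : ℝ)..s, f r| ≤ ∫ r in (0 : ℝ)..t, |f r| :=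
  (intervalIntegral.abs_integral_le_integral_abs s.2).trans
    (intervalIntegral.integral_mono_interval le_rfl s.2 (NNReal.coe_le_coe.2 hst)
      (Eventually.of_forall fun _ => abs_nonneg _) (hf _ _).abs)

/-- For non-negative `g` the process `g(X_t) - ∫_0^t ℒ g(X_r) dr` is a supermartingale. -/
theorem IsFactorDiffusion.setIntegral_sub_le (hX : IsFactorDiffusion P 𝓕 W D μ σ κ X)
    (hϖ : IsInvariantDensity D μ σ κ ϖ) (hM : IsStationaryMarkov P 𝓕 κ X (densityMeasure ϖ))
    {g : Vec d → ℝ} (hg : ContDiffOn ℝ 2 g D) (hg0 : ∀ x, 0 ≤ g x)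
    (hgi : Integrable g (densityMeasure ϖ))
    (hq : Integrable (generator μ σ g) (densityMeasure ϖ)) (t : ℝ≥0)
    {A : Set Ω} (hA : MeasurableSet[𝓕 0] A) :
    ∫ ω in A, (g (X t ω) - g (X 0 ω)) ∂P
      ≤ ∫ ω in A, (∫ r in (0 : ℝ)..t, generator μ σ g (X r.toNNReal ω)) ∂P := by
  set q := generator μ σ g
  have hqm : Measurable q := measurable_generator hX.measurable_drift hX.measurable_dispersion g
  obtain ⟨K, hKc, hKU, hKm, hKe⟩ := exists_compact_exhaustion_of_isOpen
    (isOpen_univ.prod hX.isOpen_domain : IsOpen (Set.univ ×ˢ D : Set (Vec d × Vec d)))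
  have hdyn := fun n => hX.integral_exitTime hϖ hM hg (q := q) (fun _ _ => rfl) (hKc n) (hKU n) t hA
  have hqI := hM.ae_intervalIntegrable hqm hq
  have hqi := hM.integrable_intervalIntegral hqm hq 0 t
  have hgt : Integrable (fun ω => g (X t ω) - g (X 0 ω)) P :=
    (hM.integrable_comp t hgi).sub (hM.integrable_comp 0 hgi)
  -- Since g ≥ 0, the stopped increments are bounded below by −g(X_0) − ∫|q|. No upper bound on g at
  -- the exit times is available, so Fatou yields only an inequality.
  have key := integrable_and_integral_le_of_tendsto (μ := P.restrict A) (c := 0)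
    (G := fun ω => g (X 0 ω) + ∫ r in (0 : ℝ)..t, |q (X r.toNNReal ω)|)
    (F := fun ω => g (X t ω) - g (X 0 ω) - ∫ r in (0 : ℝ)..t, q (X r.toNNReal ω))
    (fun n => (hdyn n).1.integrableOn)
    ((hM.integrable_comp 0 hgi).add (hM.integrable_intervalIntegral hqm.abs hq.abs 0 t)).integrableOn
    (fun n => ae_restrict_of_ae ?_) (ae_restrict_of_ae ?_) fun n => (hdyn n).2.le
  · have h1 := key.2
    rw [integral_sub hgt.integrableOn hqi.integrableOn] at h1
    linarith
  · filter_upwards [hqI] with ω hω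
    have h1 := abs_le.1 (abs_intervalIntegral_le_of_le hω
      (exitTime_le : exitTime (fun s => (W s ω, X s ω)) (K n) t ≤ t))
    have h2 := hg0 (X (exitTime (fun s => (W s ω, X s ω)) (K n) t) ω)
    linarith [h1.2]
  · refine Eventually.of_forall fun ω => ?_
    obtain ⟨N, hN⟩ := exists_exitTime_eq (Z := fun s => (W s ω, X s ω))
      ((hX.brownian.continuous_paths ω).prodMk (hX.sde.continuous_paths ω))
      (U := Set.univ ×ˢ D) (fun s => ⟨trivial, hX.sde.mem_domain s ω⟩) hKm hKe t
    refine tendsto_const_nhds.congr' ?_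
    filter_upwards [eventually_ge_atTop N] with n hn
    rw [hN n hn]

/-- If `g(X_t) - ∫_0^t u(X_r) dr` has centered increments, then `u` is the generator of `g`. -/
theorem IsFactorDiffusion.ae_generator_eq (hX : IsFactorDiffusion P 𝓕 W D μ σ κ X)
    (hϖ : IsInvariantDensity D μ σ κ ϖ) (hM : IsStationaryMarkov P 𝓕 κ X (densityMeasure ϖ))
    {g : Vec d → ℝ} (hg : ContDiffOn ℝ 2 g D) (hg0 : ∀ x, 0 ≤ g x)
    (hgi : Integrable g (densityMeasure ϖ))
    (hq : Integrable (generator μ σ g) (densityMeasure ϖ))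
    {u : Vec d → ℝ} (hum : Measurable u) (hu : Integrable u (densityMeasure ϖ))
    (hc : ∀ t, HasCenteredIncrements P 𝓕 t fun s ω =>
      g (X s ω) - ∫ r in (0 : ℝ)..s, u (X r.toNNReal ω)) :
    generator μ σ g =ᵐ[densityMeasure ϖ] u := by
  have := hM.isProbabilityMeasure
  set q := generator μ σ g with hqdef
  have hqm : Measurable q := measurable_generator hX.measurable_drift hX.measurable_dispersion g
  have hqI := hM.ae_intervalIntegrable hqm hq
  have huI := hM.ae_intervalIntegrable hum hu
  have hqi := fun t : ℝ≥0 => hM.integrable_intervalIntegral hqm hq 0 t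
  have hui := fun t : ℝ≥0 => hM.integrable_intervalIntegral hum hu 0 t
  have hgc : ∀ ω, Continuous fun s => g (X s ω) := fun ω =>
    hg.continuousOn.comp_continuous (hX.sde.continuous_paths ω) fun t => hX.sde.mem_domain t ω
  have hdm : Measurable fun x => q x - u x := hqm.sub hum
  have hdi : Integrable (fun x => q x - u x) (densityMeasure ϖ) := hq.sub hu
  -- On events of the initial state the u-process has mean increment zero and the q-process at most
  -- zero; subtracting leaves the time integral of q − u with non-negative mean.
  have hnonneg : 0 ≤ᵐ[densityMeasure ϖ] fun x => q x - u x := by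
    refine hM.nonneg_of_integral_nonneg hdm hdi fun B hB t => ?_
    have hA : MeasurableSet[𝓕 0] (X 0 ⁻¹' B) := hM.adapted 0 hB
    have hA' := 𝓕.le _ _ hA
    rw [← hM.integral_mul_intervalIntegral hdm hdi (measurable_one.indicator hA') (C := 1) fun ω => by
      by_cases hω : ω ∈ X 0 ⁻¹' B <;> simp [hω], ← setIntegral_eq_integral_indicator_mul hA']
    have h1 := (hc t).2 0 t zero_le le_rfl _ hA
    have h2 := hX.setIntegral_sub_le hϖ hM hg hg0 hgi hq t hA
    have h3 : ∫ ω in X 0 ⁻¹' B, ((g (X t ω) - ∫ r in (0 : ℝ)..t, u (X r.toNNReal ω))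
        - (g (X 0 ω) - ∫ r in (0 : ℝ)..(0 : ℝ≥0), u (X r.toNNReal ω))) ∂P
        = (∫ ω in X 0 ⁻¹' B, (g (X t ω) - g (X 0 ω)) ∂P)
          - ∫ ω in X 0 ⁻¹' B, (∫ r in (0 : ℝ)..t, u (X r.toNNReal ω)) ∂P := by
      have hgt : Integrable (fun ω => g (X t ω) - g (X 0 ω)) P :=
        (hM.integrable_comp t hgi).sub (hM.integrable_comp 0 hgi)
      rw [← integral_sub hgt.integrableOn
        (hui t).integrableOn]
      refine integral_congr_ae (Eventually.of_forall fun ω => ?_)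
      simp only [NNReal.coe_zero, intervalIntegral.integral_same]
      ring
    replace h1 := h3.symm.trans h1
    have h4 : ∫ ω in X 0 ⁻¹' B, (∫ r in (0 : ℝ)..t, (q (X r.toNNReal ω) - u (X r.toNNReal ω))) ∂P
        = (∫ ω in X 0 ⁻¹' B, (∫ r in (0 : ℝ)..t, q (X r.toNNReal ω)) ∂P)
          - ∫ ω in X 0 ⁻¹' B, (∫ r in (0 : ℝ)..t, u (X r.toNNReal ω)) ∂P := by
      rw [← integral_sub (hqi t).integrableOn (hui t).integrableOn]
      refine integral_congr_ae (ae_restrict_of_ae ?_)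
      filter_upwards [hqI, huI] with ω a b
      exact intervalIntegral.integral_sub (a _ _) (b _ _)
    rw [h4]
    linarith
  obtain ⟨K, hKc, hKU, hKm, hKe⟩ := exists_compact_exhaustion_of_isOpen
    (isOpen_univ.prod hX.isOpen_domain : IsOpen (Set.univ ×ˢ D : Set (Vec d × Vec d)))
  have hZm : ∀ s, Measurable[𝓕 s] fun ω => (W s ω, X s ω) := fun s =>
    ((hX.brownian.adapted s).measurable).prodMk (hM.adapted s)
  -- Along the exit times, the martingale with drift `u` is only a supermartingale.
  have hstep : ∀ n, Integrable (fun ω => ∫ r in (0 : ℝ)..exitTime (fun s => (W s ω, X s ω)) (K n) 1,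
        (q (X r.toNNReal ω) - u (X r.toNNReal ω))) P ∧
      ∫ ω, (∫ r in (0 : ℝ)..exitTime (fun s => (W s ω, X s ω)) (K n) 1,
        (q (X r.toNNReal ω) - u (X r.toNNReal ω))) ∂P ≤ 0 := by
    intro n
    have hdyn := hX.integral_exitTime hϖ hM hg (q := q) (fun _ _ => rfl) (hKc n) (hKU n) 1
      MeasurableSet.univ
    rw [setIntegral_univ] at hdyn
    -- On the grids the stopped u-martingale has mean exactly zero. Fatou carries this to the exit
    -- time as an inequality, whereas Dynkin's formula there is an equality for q.
    have hgrid := fun m => (hc 1).gridExit hZm (hKc n).isClosed m MeasurableSet.univ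
    simp only [setIntegral_univ] at hgrid
    have key := integrable_and_integral_le_of_tendsto (μ := P) (c := 0)
      (G := fun ω => g (X 0 ω) + ∫ r in (0 : ℝ)..(1 : ℝ≥0), |u (X r.toNNReal ω)|)
      (F := fun ω => g (X (exitTime (fun s => (W s ω, X s ω)) (K n) 1) ω) - g (X 0 ω)
        - ∫ r in (0 : ℝ)..exitTime (fun s => (W s ω, X s ω)) (K n) 1, u (X r.toNNReal ω))
      (fun m => (hgrid m).1)
      ((hM.integrable_comp 0 hgi).add (hM.integrable_intervalIntegral hum.abs hu.abs 0 _))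
      (fun m => ?_) ?_ fun m => (hgrid m).2.le
    · have heq : (fun ω => ∫ r in (0 : ℝ)..exitTime (fun s => (W s ω, X s ω)) (K n) 1,
          (q (X r.toNNReal ω) - u (X r.toNNReal ω)))
          =ᵐ[P] fun ω => (g (X (exitTime (fun s => (W s ω, X s ω)) (K n) 1) ω) - g (X 0 ω)
        - ∫ r in (0 : ℝ)..exitTime (fun s => (W s ω, X s ω)) (K n) 1, u (X r.toNNReal ω))
          - (g (X (exitTime (fun s => (W s ω, X s ω)) (K n) 1) ω) - g (X 0 ω)
        - ∫ r in (0 : ℝ)..exitTime (fun s => (W s ω, X s ω)) (K n) 1, q (X r.toNNReal ω)) := by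
        filter_upwards [hqI, huI] with ω a b
        rw [intervalIntegral.integral_sub (a _ _) (b _ _)]
        ring
      refine ⟨(key.1.sub hdyn.1).congr heq.symm, ?_⟩
      rw [integral_congr_ae heq, integral_sub key.1 hdyn.1, hdyn.2]
      linarith [key.2]
    · filter_upwards [huI] with ω hω
      have h1 := abs_le.1 (abs_intervalIntegral_le_of_le hω
        (gridExit_le : gridExit (fun s => (W s ω, X s ω)) (K n) 1 m ≤ 1))
      have h2 := hg0 (X (gridExit (fun s => (W s ω, X s ω)) (K n) 1 m) ω)
      simp only [NNReal.coe_zero, intervalIntegral.integral_same]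
      linarith [h1.2]
    · filter_upwards [huI] with ω hω
      have h1 : Continuous fun s : ℝ≥0 => g (X s ω) - ∫ r in (0 : ℝ)..s, u (X r.toNNReal ω) :=
        (hgc ω).sub (continuous_primitive_nnreal fun t => hω _ _)
      have h2 := ((h1.tendsto _).comp (tendsto_gridExit (fun s => (W s ω, X s ω)) (K n) 1)).sub_const
        (g (X 0 ω))
      refine (h2.congr fun m => ?_).trans_eq ?_
      · simp only [Function.comp, NNReal.coe_zero, intervalIntegral.integral_same, sub_zero]
      · congr 1
        ring
  -- The exits from the exhausting sets eventually equal 1, so E∫_0^1 (q − u)(X_r) dr ≤ 0. By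
  -- stationarity this is ⟨q − u⟩ ≤ 0, which with q − u ≥ 0 forces equality.
  have hlim := integrable_and_integral_le_of_tendsto (μ := P) (c := 0)
    (G := fun ω => ∫ r in (0 : ℝ)..(1 : ℝ≥0), |q (X r.toNNReal ω) - u (X r.toNNReal ω)|)
    (F := fun ω => ∫ r in (0 : ℝ)..(1 : ℝ≥0), (q (X r.toNNReal ω) - u (X r.toNNReal ω)))
    (fun n => (hstep n).1) (hM.integrable_intervalIntegral hdm.abs hdi.abs 0 _)
    (fun n => ?_) ?_ fun n => (hstep n).2
  · have h1 := hlim.2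
    have h2 := hM.integral_mul_intervalIntegral hdm hdi (Z := fun _ => 1) measurable_const (C := 1)
      (by simp) 0 (1 : ℝ≥0)
    simp only [one_mul] at h2
    rw [h2, intervalIntegral.integral_congr (g := fun _ => ∫ x, (q x - u x) ∂(densityMeasure ϖ))
      fun r _ => hM.integral_comp _ hdi] at h1
    simp only [intervalIntegral.integral_const, NNReal.coe_one, sub_zero, one_smul] at h1
    have h3 := (integral_eq_zero_iff_of_nonneg_ae hnonneg hdi).1
      (le_antisymm h1 (integral_nonneg_of_ae hnonneg))
    filter_upwards [h3] with x hx using sub_eq_zero.1 hx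
  · filter_upwards [hM.ae_intervalIntegrable hdm hdi] with ω hω
    exact (abs_le.1 (abs_intervalIntegral_le_of_le hω exitTime_le)).1
  · refine Eventually.of_forall fun ω => ?_
    obtain ⟨N, hN⟩ := exists_exitTime_eq (Z := fun s => (W s ω, X s ω))
      ((hX.brownian.continuous_paths ω).prodMk (hX.sde.continuous_paths ω))
      (U := Set.univ ×ˢ D) (fun s => ⟨trivial, hX.sde.mem_domain s ω⟩) hKm hKe 1
    refine tendsto_const_nhds.congr' ?_
    filter_upwards [eventually_ge_atTop N] with n hn
    rw [hN n hn]

end Identification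

/-! ### Consequences of the spectral gap in L² -/

section SpectralGap

section SquareIntegrable

variable {α : Type*} {m : MeasurableSpace α} {π : Measure α} {f : α → ℝ}

theorem norm_toLp_two_sq (hf : MemLp f 2 π) : ‖hf.toLp f‖ ^ 2 = ∫ x, f x ^ 2 ∂π := by
  rw [← real_inner_self_eq_norm_sq, L2.inner_def]
  refine integral_congr_ae ?_
  filter_upwards [hf.coeFn_toLp] with x hx
  rw [hx, real_inner_self_eq_norm_sq, Real.norm_eq_abs, sq_abs]

/-- The variance of |f| is non-negative. -/
theorem integral_abs_le_norm_toLp [IsProbabilityMeasure π] (hf : MemLp f 2 π) :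
    ∫ x, |f x| ∂π ≤ ‖hf.toLp f‖ := by
  have h1 := hf.integrable one_le_two
  have h2 := hf.integrable_sq
  refine abs_le_of_sq_le_sq' ?_ (norm_nonneg _) |>.2
  rw [norm_toLp_two_sq]
  set c := ∫ x, |f x| ∂π
  have h3 : 0 ≤ ∫ x, (|f x| - c) ^ 2 ∂π := integral_nonneg fun x => sq_nonneg _
  have h4 : ∫ x, (|f x| - c) ^ 2 ∂π = (∫ x, f x ^ 2 ∂π) - c ^ 2 := by
    have : ∀ x, (|f x| - c) ^ 2 = f x ^ 2 - 2 * c * |f x| + c ^ 2 := fun x => by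
      rw [← sq_abs (f x)]; ring
    simp only [this]
    have i1 : Integrable (fun x => 2 * c * |f x|) π := h1.abs.const_mul _
    have i2 : Integrable (fun x => f x ^ 2 - 2 * c * |f x|) π := h2.sub i1
    rw [integral_add i2 (integrable_const _), integral_sub h2 i1, integral_const_mul,
      integral_const, probReal_univ]
    simp only [smul_eq_mul, c]
    ring
  linarith

end SquareIntegrable

variable {Ω : Type*} [MeasurableSpace Ω] {d : ℕ} {P : Measure Ω} [IsProbabilityMeasure P]
  {𝓕 : Filtration ℝ≥0 ‹MeasurableSpace Ω›} {κ : ℝ≥0 → Kernel (Vec d) (Vec d)}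
  {X : ℝ≥0 → Ω → Vec d} {π : Measure (Vec d)} {gap : ℝ} {T : ℝ≥0} {g w q : Vec d → ℝ}

/-- The transition operators contract functions of mean zero in `L²(π)` at the rate `gap`. -/
def HasDecay (κ : ℝ≥0 → Kernel (Vec d) (Vec d)) (π : Measure (Vec d)) (gap : ℝ) : Prop :=
  ∀ (t : ℝ≥0) (g : Vec d → ℝ), Measurable g → MemLp g 2 π → ∫ x, g x ∂π = 0 →
    ∫ x, semigroup κ t g x ^ 2 ∂π ≤ Real.exp (-gap * t) * ∫ x, g x ^ 2 ∂π

namespace IsStationaryMarkov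

/-- The decay is assumed for squared norms, so the square root halves the rate; this is the source
of λτ/2 in the final constant. -/
theorem norm_semigroup_le (hM : IsStationaryMarkov P 𝓕 κ X π) (hd : HasDecay κ π gap) (t : ℝ≥0)
    (hqm : Measurable q) (hq : MemLp q 2 π) (hq0 : ∫ x, q x ∂π = 0) :
    ‖(hM.memLp_semigroup t hqm hq).toLp _‖ ≤ Real.exp (-gap * t / 2) * ‖hq.toLp q‖ := by
  refine abs_le_of_sq_le_sq' ?_ (by positivity) |>.2
  rw [mul_pow, norm_toLp_two_sq, norm_toLp_two_sq, ← Real.exp_nat_mul]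
  refine (hd t q hqm hq hq0).trans_eq ?_
  congr 2
  push_cast
  ring

theorem semigroup_sub (hM : IsStationaryMarkov P 𝓕 κ X π) (t : ℝ≥0) {f k : Vec d → ℝ}
    (hf : Integrable f π) (hk : Integrable k π) :
    semigroup κ t (fun x => f x - k x) =ᵐ[π] fun x => semigroup κ t f x - semigroup κ t k x := by
  have := hM.isMarkovKernel t
  rw [← hM.invariant t] at hf hk
  filter_upwards [Measure.ae_integrable_of_integrable_comp hf,
    Measure.ae_integrable_of_integrable_comp hk] with x h1 h2
  exact integral_sub h1 h2

theorem semigroup_const (hM : IsStationaryMarkov P 𝓕 κ X π) (t : ℝ≥0) (c : ℝ) (x : Vec d) :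
    semigroup κ t (fun _ => c) x = c := by
  have := hM.isMarkovKernel t
  simp [semigroup]

/-- Two functions with the same mean on which `e^{ℒT} - 1` agrees are equal. -/
theorem ae_eq_of_semigroup_sub_eq (hM : IsStationaryMarkov P 𝓕 κ X π) (hd : HasDecay κ π gap)
    (hgap : 0 < gap) (hT : 0 < T) {w' : Vec d → ℝ} (hwm : Measurable w) (hw : MemLp w 2 π)
    (hwm' : Measurable w') (hw' : MemLp w' 2 π) (hmean : ∫ x, w x ∂π = ∫ x, w' x ∂π)
    (h : (fun x => semigroup κ T w x - w x) =ᵐ[π] fun x => semigroup κ T w' x - w' x) :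
    w =ᵐ[π] w' := by
  have := hM.isProbabilityMeasure
  have hi := hw.integrable one_le_two
  have hi' := hw'.integrable one_le_two
  have hδ : MemLp (fun x => w x - w' x) 2 π := hw.sub hw'
  have h1 : semigroup κ T (fun x => w x - w' x) =ᵐ[π] fun x => w x - w' x := by
    filter_upwards [hM.semigroup_sub T hi hi', h] with x a b
    rw [a]; linarith
  have h2 := hM.norm_semigroup_le hd T (q := fun x => w x - w' x) (hwm.sub hwm') hδ
    (by rw [integral_sub hi hi', hmean, sub_self])
  rw [(MemLp.toLp_eq_toLp_iff _ hδ).2 h1] at h2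
  have h3 : Real.exp (-gap * T / 2) < 1 := by
    rw [Real.exp_lt_one_iff]
    have : 0 < gap * T := mul_pos hgap hT
    linarith
  have h4 : ‖hδ.toLp _‖ = 0 := by nlinarith [norm_nonneg (hδ.toLp fun x => w x - w' x)]
  rw [norm_eq_zero, Lp.eq_zero_iff_ae_eq_zero] at h4
  filter_upwards [h4, hδ.coeFn_toLp] with x h5 h6
  exact sub_eq_zero.1 (h6.symm.trans h5)

/-- The norm bound for the inverse of `e^{ℒT} - 1` on functions of mean zero. -/
theorem integral_sq_le_of_semigroup_sub_eq (hM : IsStationaryMarkov P 𝓕 κ X π)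
    (hd : HasDecay κ π gap) (hgap : 0 < gap) (hT : 0 < T) (hwm : Measurable w) (hw : MemLp w 2 π)
    (hq : MemLp q 2 π) (h : q =ᵐ[π] fun x => (semigroup κ T w x - w x) / T) {c : ℝ}
    (hc : ∫ x, w x ∂π = c) :
    ∫ x, (w x - c) ^ 2 ∂π ≤ (T / (1 - Real.exp (-gap * T / 2))) ^ 2 * ∫ x, q x ^ 2 ∂π := by
  have := hM.isProbabilityMeasure
  have hT' : (0 : ℝ) < T := hT
  have hξ : MemLp (fun x => w x - c) 2 π := hw.sub (memLp_const c)
  have hi := hw.integrable one_le_two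
  have h0 : ∫ x, (w x - c) ∂π = 0 := by
    rw [integral_sub hi (integrable_const _), hc]; simp
  have hP := hM.memLp_semigroup T (hwm.sub_const c) hξ
  -- Constants are fixed by the semigroup, so w − c = P_T(w − c) − T q. Taking norms and absorbing
  -- the contracted term gives the constant.
  have h1 : (fun x => w x - c) =ᵐ[π] semigroup κ T (fun x => w x - c) - (T : ℝ) • q := by
    filter_upwards [hM.semigroup_sub T hi (integrable_const c), h] with x a b
    simp only [Pi.sub_apply, Pi.smul_apply, smul_eq_mul]
    rw [a, b, hM.semigroup_const]
    field_simp
    ring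
  have h2 : ‖hξ.toLp _‖ ≤ Real.exp (-gap * T / 2) * ‖hξ.toLp _‖ + T * ‖hq.toLp q‖ := by
    have e : hξ.toLp _ = hP.toLp _ - (T : ℝ) • hq.toLp q := by
      rw [← MemLp.toLp_const_smul, ← MemLp.toLp_sub]
      exact (MemLp.toLp_eq_toLp_iff _ _).2 h1
    calc ‖hξ.toLp _‖ = ‖hP.toLp _ - (T : ℝ) • hq.toLp q‖ := by rw [e]
      _ ≤ ‖hP.toLp _‖ + ‖(T : ℝ) • hq.toLp q‖ := norm_sub_le _ _
      _ ≤ _ := by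
        rw [norm_smul, Real.norm_of_nonneg hT'.le]
        gcongr
        exact hM.norm_semigroup_le hd T (hwm.sub_const c) hξ h0
  have h3 : 0 < 1 - Real.exp (-gap * T / 2) := by
    rw [sub_pos, Real.exp_lt_one_iff]
    have : 0 < gap * T := mul_pos hgap hT'
    linarith
  have h4 : ‖hξ.toLp _‖ ≤ T / (1 - Real.exp (-gap * T / 2)) * ‖hq.toLp q‖ := by
    rw [div_mul_eq_mul_div, le_div_iff₀ h3]
    linarith
  rw [← norm_toLp_two_sq hξ, ← norm_toLp_two_sq hq, ← mul_pow]
  exact pow_le_pow_left₀ (norm_nonneg _) h4 2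

theorem abs_integral_mul_le (hM : IsStationaryMarkov P 𝓕 κ X π) {ρ : Vec d → ℝ}
    (hρ : Measurable ρ) (hρ1 : ∀ x, |ρ x| ≤ 1) (hq : Integrable q π) (r : ℝ≥0) :
    |∫ ω, ρ (X 0 ω) * q (X r ω) ∂P| ≤ ∫ x, |q x| ∂π := by
  rw [← hM.integral_comp r hq.abs]
  refine abs_integral_le_integral_abs.trans ?_
  have hi := hM.integrable_comp r hq
  refine integral_mono (hi.bdd_mul (c := 1) (hρ.comp (hM.measurable 0)).aestronglyMeasurable
    (Eventually.of_forall fun ω => hρ1 _)).abs hi.abs fun ω => ?_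
  simp only [abs_mul]
  exact mul_le_of_le_one_left (abs_nonneg _) (hρ1 _)

/-- Mixing: the state at a late time is nearly uncorrelated with the initial state. -/
theorem tendsto_integral_mul (hM : IsStationaryMarkov P 𝓕 κ X π) (hd : HasDecay κ π gap)
    (hgap : 0 < gap) (hT : 0 < T) {ρ : Vec d → ℝ} (hρ : Measurable ρ) (hρ1 : ∀ x, |ρ x| ≤ 1)
    (hgm : Measurable g) (hg : MemLp g 2 π) :
    Tendsto (fun n : ℕ => ∫ ω, ρ (X 0 ω) * g (X (n * T) ω) ∂P) atTop
      (𝓝 ((∫ ω, ρ (X 0 ω) ∂P) * ∫ x, g x ∂π)) := by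
  have := hM.isProbabilityMeasure
  set c := ∫ x, g x ∂π
  have hi := hg.integrable one_le_two
  have hξ : MemLp (fun x => g x - c) 2 π := hg.sub (memLp_const c)
  have hξi := hξ.integrable one_le_two
  have h0 : ∫ x, (g x - c) ∂π = 0 := by
    rw [integral_sub hi (integrable_const _)]; simp [c]
  have hρm : Measurable fun ω => ρ (X 0 ω) := hρ.comp (hM.measurable 0)
  have hρi : Integrable (fun ω => ρ (X 0 ω)) P :=
    Integrable.of_bound hρm.aestronglyMeasurable 1 (Eventually.of_forall fun ω => hρ1 _)
  -- After centering g, the Markov property turns the covariance into a pairing of a bounded weight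
  -- with P_{nT}(g − c), which decays geometrically.
  have hb : ∀ n : ℕ, |(∫ ω, ρ (X 0 ω) * g (X (n * T) ω) ∂P) - (∫ ω, ρ (X 0 ω) ∂P) * c|
      ≤ Real.exp (-gap * T / 2) ^ n * ‖hξ.toLp _‖ := by
    intro n
    have e1 : (∫ ω, ρ (X 0 ω) * g (X (n * T) ω) ∂P) - (∫ ω, ρ (X 0 ω) ∂P) * c
        = ∫ ω, ρ (X 0 ω) * (g (X (n * T) ω) - c) ∂P := by
      rw [← integral_mul_const, ← integral_sub ((hM.integrable_comp _ hi).bdd_mul (c := 1)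
        hρm.aestronglyMeasurable (Eventually.of_forall fun ω => hρ1 _)) (hρi.mul_const c)]
      simp only [mul_sub]
    have e2 := hM.integral_mul_comp 0 (n * T) (Z := fun ω => ρ (X 0 ω)) (hρ.comp (hM.adapted 0))
      (fun ω => hρ1 _) (hgm.sub_const c) hξi
    rw [zero_add] at e2
    rw [e1, e2]
    refine (hM.abs_integral_mul_le hρ hρ1 (hM.integrable_semigroup _ hξi) 0).trans ?_
    refine (integral_abs_le_norm_toLp (hM.memLp_semigroup _ (hgm.sub_const c) hξ)).trans ?_
    refine (hM.norm_semigroup_le hd _ (hgm.sub_const c) hξ h0).trans_eq ?_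
    rw [← Real.exp_nat_mul]
    congr 2
    push_cast
    ring
  have hr : Real.exp (-gap * T / 2) < 1 := by
    rw [Real.exp_lt_one_iff]
    have : 0 < gap * T := mul_pos hgap hT
    linarith
  have hlim : Tendsto (fun n : ℕ => Real.exp (-gap * T / 2) ^ n * ‖hξ.toLp _‖) atTop (𝓝 0) := by
    simpa using (tendsto_pow_atTop_nhds_zero_of_lt_one (Real.exp_pos _).le hr).mul_const _
  rw [tendsto_iff_dist_tendsto_zero]
  exact squeeze_zero (fun _ => dist_nonneg) hb hlim

/-- The inverse of `e^{ℒT} - 1`, by the Neumann series, solves the inverse problem. -/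
theorem exists_isWeakSolution (hM : IsStationaryMarkov P 𝓕 κ X π) (hd : HasDecay κ π gap)
    (hgap : 0 < gap) (hT : 0 < T) (hgm : Measurable g) (hg : MemLp g 2 π) (hqm : Measurable q)
    (hq : MemLp q 2 π) (hq0 : ∫ x, q x ∂π = 0)
    (hdyn : ∀ (t : ℝ≥0) (Z : Ω → ℝ), Measurable[𝓕 0] Z → (∀ ω, |Z ω| ≤ 1) →
      ∫ ω, Z ω * (g (X t ω) - g (X 0 ω)) ∂P
        = ∫ r in (0 : ℝ)..t, ∫ ω, Z ω * q (X r.toNNReal ω) ∂P) :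
    ∃ w, Measurable w ∧ MemLp w 2 π ∧ IsWeakSolution P X T g w := by
  have := hM.isProbabilityMeasure
  have hT' : (0 : ℝ) < T := hT
  set c := ∫ x, g x ∂π with hcdef
  have hgi := hg.integrable one_le_two
  have hqi := hq.integrable one_le_two
  let v : ℕ → Vec d → ℝ := fun k => semigroup κ (k * T) q
  have hvm : ∀ k, Measurable (v k) := fun k => hM.measurable_semigroup _ hqm
  have hv : ∀ k, MemLp (v k) 2 π := fun k => hM.memLp_semigroup _ hqm hq
  have hr : Real.exp (-gap * T / 2) < 1 := by
    rw [Real.exp_lt_one_iff]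
    have : 0 < gap * T := mul_pos hgap hT
    linarith
  -- The terms P_{kT} q decay geometrically because ⟨q⟩ = 0.
  have hsum : Summable fun k => (hv k).toLp (v k) := by
    refine Summable.of_norm_bounded (g := fun k : ℕ => Real.exp (-gap * T / 2) ^ k * ‖hq.toLp q‖)
      ((summable_geometric_of_lt_one (Real.exp_pos _).le hr).mul_right _) fun k => ?_
    refine (hM.norm_semigroup_le hd _ hqm hq hq0).trans_eq ?_
    rw [← Real.exp_nat_mul]
    congr 2
    push_cast
    ring
  obtain ⟨S, hS⟩ := hsum
  have hSm : AEStronglyMeasurable S π := Lp.aestronglyMeasurable S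
  let ξ : Vec d → ℝ := hSm.mk S
  have hξm : Measurable ξ := hSm.stronglyMeasurable_mk.measurable
  have hξ : MemLp ξ 2 π := (memLp_congr_ae hSm.ae_eq_mk).1 (Lp.memLp S)
  have hξS : hξ.toLp ξ = S := by
    rw [← Lp.toLp_coeFn S (Lp.memLp S)]
    exact (MemLp.toLp_eq_toLp_iff _ _).2 hSm.ae_eq_mk.symm
  let s : ℕ → Vec d → ℝ := fun n x => ∑ k ∈ Finset.range n, v k x
  have hs : ∀ n, MemLp (s n) 2 π := fun n => memLp_finsetSum _ fun k _ => hv k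
  have hsm : ∀ n, Measurable (s n) := fun n => Finset.measurable_fun_sum _ fun k _ => hvm k
  have hsS : ∀ n, (hs n).toLp (s n) = ∑ k ∈ Finset.range n, (hv k).toLp (v k) := by
    intro n
    induction n with
    | zero =>
      rw [Finset.range_zero, Finset.sum_empty, Lp.eq_zero_iff_ae_eq_zero]
      filter_upwards [(hs 0).coeFn_toLp] with x hx
      simp [s]
    | succ n ih =>
      rw [Finset.sum_range_succ, ← ih, ← MemLp.toLp_add]
      refine (MemLp.toLp_eq_toLp_iff _ _).2 (Eventually.of_forall fun x => ?_)
      simp only [s, Pi.add_apply, Finset.sum_range_succ]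
  have hlim : Tendsto (fun n => ∫ x, |ξ x - s n x| ∂π) atTop (𝓝 0) := by
    have h1 : Tendsto (fun n => ‖S - ∑ k ∈ Finset.range n, (hv k).toLp (v k)‖) atTop (𝓝 0) := by
      simpa using (hS.tendsto_sum_nat.const_sub S).norm
    refine squeeze_zero (fun n => integral_nonneg fun x => abs_nonneg _) (fun n => ?_) h1
    refine (integral_abs_le_norm_toLp (hξ.sub (hs n))).trans_eq ?_
    rw [MemLp.toLp_sub hξ (hs n), hξS, hsS]
  -- Formally q = T⁻¹(P_T − 1)w, so the mean-zero part of w is −T ∑_k P_{kT} q, and the mean of w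
  -- must be that of g.
  refine ⟨fun x => c - T * ξ x, (hξm.const_mul _).const_sub _, (memLp_const c).sub (hξ.const_mul _),
    fun ρ hρ hρ0 hρ1 => ?_⟩
  have hρb : ∀ x, |ρ x| ≤ 1 := fun x => by rw [abs_of_nonneg (hρ0 x)]; exact hρ1 x
  have hρm : Measurable fun ω => ρ (X 0 ω) := hρ.comp (hM.measurable 0)
  have hbd : ∀ {k : Vec d → ℝ}, Integrable k π → ∀ r, Integrable (fun ω => ρ (X 0 ω) * k (X r ω)) P :=
    fun hk r => (hM.integrable_comp r hk).bdd_mul (c := 1) hρm.aestronglyMeasurable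
      (Eventually.of_forall fun ω => hρb _)
  have hρi : Integrable (fun ω => ρ (X 0 ω)) P :=
    Integrable.of_bound hρm.aestronglyMeasurable 1 (Eventually.of_forall fun ω => hρb _)
  have hξi := hξ.integrable one_le_two
  have hsi := fun n => (hs n).integrable one_le_two
  let L : (Vec d → ℝ) → ℝ := fun k => ∫ r in (0 : ℝ)..T, ∫ ω, ρ (X 0 ω) * k (X r.toNNReal ω) ∂P
  have hII : ∀ {k : Vec d → ℝ}, Measurable k → Integrable k π → ∀ a b, IntervalIntegrable
      (fun r : ℝ => ∫ ω, ρ (X 0 ω) * k (X r.toNNReal ω) ∂P) volume a b := fun hkm hk a b =>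
    hM.intervalIntegrable_integral_mul hkm hk hρm (fun ω => hρb _) a b
  have hLlim : Tendsto (fun n => L (s n)) atTop (𝓝 (L ξ)) := by
    rw [tendsto_iff_dist_tendsto_zero]
    refine squeeze_zero (fun _ => dist_nonneg) (fun n => ?_)
      (by simpa using hlim.mul_const (T : ℝ))
    rw [dist_comm, Real.dist_eq]
    have hδ : Integrable (fun x => ξ x - s n x) π := hξi.sub (hsi n)
    have e : L ξ - L (s n) = ∫ r in (0 : ℝ)..T, ∫ ω, ρ (X 0 ω) * (ξ (X r.toNNReal ω) - s n (X r.toNNReal ω)) ∂P := by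
      simp only [L]
      rw [← intervalIntegral.integral_sub (hII hξm hξi _ _) (hII (hsm n) (hsi n) _ _)]
      refine intervalIntegral.integral_congr fun r _ => ?_
      simp only [mul_sub]
      rw [integral_sub (hbd hξi _) (hbd (hsi n) _)]
    rw [e]
    have := intervalIntegral.norm_integral_le_of_norm_le_const (a := 0) (b := (T : ℝ))
      (f := fun r : ℝ => ∫ ω, ρ (X 0 ω) * (ξ (X r.toNNReal ω) - s n (X r.toNNReal ω)) ∂P)
      (C := ∫ x, |ξ x - s n x| ∂π) fun r _ => hM.abs_integral_mul_le hρ hρb hδ _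
    simpa [abs_of_pos hT'] using this
  -- The k-th term of the series, integrated over one period, equals q integrated over [kT, (k+1)T],
  -- by the Markov property. The partial sums fill [0, nT].
  have hLs : ∀ n : ℕ, L (s n) = ∫ r in (0 : ℝ)..(n * T : ℝ≥0), ∫ ω, ρ (X 0 ω) * q (X r.toNNReal ω) ∂P := by
    intro n
    induction n with
    | zero => simp [L, s]
    | succ n ih =>
      have e1 : L (s (n + 1)) = L (s n) + L (v n) := by
        simp only [L]
        rw [← intervalIntegral.integral_add (hII (hsm n) (hsi n) _ _)
          (hII (hvm n) ((hv n).integrable one_le_two) _ _)]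
        refine intervalIntegral.integral_congr fun r _ => ?_
        rw [← integral_add (hbd (hsi n) _) (hbd ((hv n).integrable one_le_two) _)]
        simp only [s, Finset.sum_range_succ, mul_add]
      have e2 : L (v n) = ∫ r in ((n * T : ℝ≥0) : ℝ)..((n + 1 : ℕ) * T : ℝ≥0),
          ∫ ω, ρ (X 0 ω) * q (X r.toNNReal ω) ∂P := by
        have h1 := intervalIntegral.integral_comp_add_right
          (fun r : ℝ => ∫ ω, ρ (X 0 ω) * q (X r.toNNReal ω) ∂P) ((n * T : ℝ≥0) : ℝ) (a := 0) (b := T)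
        have h2 : (T : ℝ) + ((n * T : ℝ≥0) : ℝ) = ((n + 1 : ℕ) * T : ℝ≥0) := by push_cast; ring
        rw [zero_add, h2] at h1
        rw [← h1]
        refine intervalIntegral.integral_congr fun r hr => ?_
        rw [Set.uIcc_of_le hT'.le] at hr
        have h3 := hM.integral_mul_comp r.toNNReal (n * T) (Z := fun ω => ρ (X 0 ω))
          (hρ.comp ((hM.adapted 0).mono (𝓕.mono zero_le) le_rfl)) (fun ω => hρb _) hqm hqi
        simp only [v]
        rw [← h3, Real.toNNReal_add hr.1 (NNReal.coe_nonneg _), Real.toNNReal_coe]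
      rw [e1, ih, e2, intervalIntegral.integral_add_adjacent_intervals (hII hqm hqi _ _) (hII hqm hqi _ _)]
  have hLs' : ∀ n : ℕ, L (s n) = (∫ ω, ρ (X 0 ω) * g (X (n * T) ω) ∂P) - ∫ ω, ρ (X 0 ω) * g (X 0 ω) ∂P := by
    intro n
    rw [hLs, ← hdyn _ (fun ω => ρ (X 0 ω)) (hρ.comp (hM.adapted 0)) fun ω => hρb _, ← integral_sub (hbd hgi _) (hbd hgi _)]
    simp only [mul_sub]
  have hLlim' : Tendsto (fun n => L (s n)) atTop
      (𝓝 ((∫ ω, ρ (X 0 ω) ∂P) * c - ∫ ω, ρ (X 0 ω) * g (X 0 ω) ∂P)) := by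
    simp only [hLs']
    exact (hM.tendsto_integral_mul hd hgap hT hρ hρb hgm hg).sub_const _
  -- L¹ convergence of the series identifies the limit as L ξ; Dynkin's formula over [0, nT] and
  -- mixing identify it as c E[ρ] − E[ρ g(X_0)].
  have hLξ := tendsto_nhds_unique hLlim hLlim'
  have e3 : ∫ r in (0 : ℝ)..T, ∫ ω, ρ (X 0 ω) * (c - T * ξ (X r.toNNReal ω)) ∂P
      = T * ((∫ ω, ρ (X 0 ω) ∂P) * c) - T * L ξ := by
    have : ∀ r : ℝ, ∫ ω, ρ (X 0 ω) * (c - T * ξ (X r.toNNReal ω)) ∂P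
        = (∫ ω, ρ (X 0 ω) ∂P) * c - T * ∫ ω, ρ (X 0 ω) * ξ (X r.toNNReal ω) ∂P := by
      intro r
      rw [← integral_mul_const, ← integral_const_mul, ← integral_sub (hρi.mul_const c)
        ((hbd hξi _).const_mul _)]
      refine integral_congr_ae (Eventually.of_forall fun ω => ?_)
      simp only
      ring
    simp only [this, L]
    rw [intervalIntegral.integral_sub intervalIntegrable_const ((hII hξm hξi _ _).const_mul _),
      intervalIntegral.integral_const, intervalIntegral.integral_const_mul]
    simp
  rw [e3, hLξ]
  ring

end IsStationaryMarkov

end SpectralGap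

/-! ### Dynkin's formula without stopping -/

section Dynkin

variable {Ω : Type*} [MeasurableSpace Ω] {P : Measure Ω} [IsProbabilityMeasure P]
  {𝓕 : Filtration ℝ≥0 ‹MeasurableSpace Ω›} {d : ℕ} {W : ℝ≥0 → Ω → Vec d} {D : Set (Vec d)}
  {μ : Vec d → Vec d} {σ : Vec d → Matrix (Fin d) (Fin d) ℝ}
  {κ : ℝ≥0 → Kernel (Vec d) (Vec d)} {X : ℝ≥0 → Ω → Vec d} {ϖ : Vec d → ℝ}

/-- Dynkin's formula for a non-negative function whose generator has mean zero. -/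
theorem IsFactorDiffusion.integral_mul_sub_eq (hX : IsFactorDiffusion P 𝓕 W D μ σ κ X)
    (hϖ : IsInvariantDensity D μ σ κ ϖ) (hM : IsStationaryMarkov P 𝓕 κ X (densityMeasure ϖ))
    {g : Vec d → ℝ} (hg : ContDiffOn ℝ 2 g D) (hg0 : ∀ x, 0 ≤ g x)
    (hgi : Integrable g (densityMeasure ϖ))
    (hq : Integrable (generator μ σ g) (densityMeasure ϖ))
    (hq0 : ∫ x, generator μ σ g x ∂(densityMeasure ϖ) = 0) (t : ℝ≥0)
    {Z : Ω → ℝ} (hZ : Measurable[𝓕 0] Z) (hZC : ∀ ω, |Z ω| ≤ 1) :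
    ∫ ω, Z ω * (g (X t ω) - g (X 0 ω)) ∂P
      = ∫ r in (0 : ℝ)..t, ∫ ω, Z ω * generator μ σ g (X r.toNNReal ω) ∂P := by
  set q := generator μ σ g
  have hqm : Measurable q := measurable_generator hX.measurable_drift hX.measurable_dispersion g
  have hZm : Measurable Z := hZ.mono (𝓕.le 0) le_rfl
  let Δ : Ω → ℝ := fun ω => (∫ r in (0 : ℝ)..t, q (X r.toNNReal ω)) - (g (X t ω) - g (X 0 ω))
  have hqi := hM.integrable_intervalIntegral hqm hq 0 t
  have hgt : Integrable (fun ω => g (X t ω) - g (X 0 ω)) P :=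
    (hM.integrable_comp t hgi).sub (hM.integrable_comp 0 hgi)
  have hΔ : Integrable Δ P := hqi.sub hgt
  have hset : ∀ A, MeasurableSet[𝓕 0] A → 0 ≤ ∫ ω in A, Δ ω ∂P := fun A hA => by
    have h1 := hX.setIntegral_sub_le hϖ hM hg hg0 hgi hq t hA
    rw [integral_sub hqi.integrableOn hgt.integrableOn]
    exact sub_nonneg.2 h1
  -- Stationarity cancels the two values of g, and ⟨q⟩ = 0 removes the drift.
  have htot : ∫ ω, Δ ω ∂P = 0 := by
    have h1 := hM.integral_mul_intervalIntegral hqm hq (Z := fun _ => 1) measurable_const (C := 1)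
      (by simp) 0 t
    simp only [one_mul] at h1
    rw [integral_sub hqi hgt, integral_sub (hM.integrable_comp t hgi) (hM.integrable_comp 0 hgi),
      hM.integral_comp t hgi, hM.integral_comp 0 hgi, h1]
    simp [hM.integral_comp _ hq, hq0]
  -- The integrals over `A` and its complement are both non-negative and sum to zero.
  have hzero : ∀ A, MeasurableSet[𝓕 0] A → ∫ ω in A, Δ ω ∂P = 0 := fun A hA => by
    have h1 := integral_add_compl (𝓕.le _ _ hA) hΔ
    linarith [hset A hA, hset Aᶜ hA.compl]
  have hce : 0 =ᵐ[P] P[Δ | 𝓕 0] :=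
    ae_eq_condExp_of_forall_setIntegral_eq (𝓕.le 0) hΔ (fun _ _ _ => integrableOn_zero)
      (fun A hA _ => by rw [hzero A hA]; simp) aestronglyMeasurable_zero
  have hZΔ : Integrable (Z * Δ) P :=
    hΔ.bdd_mul (c := 1) hZm.aestronglyMeasurable (Eventually.of_forall hZC)
  have h2 : ∫ ω, (Z * Δ) ω ∂P = 0 := by
    rw [← integral_condExp (𝓕.le 0)]
    refine integral_eq_zero_of_ae ?_
    filter_upwards [hce, condExp_mul_of_stronglyMeasurable_left hZ.stronglyMeasurable hZΔ hΔ]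
      with ω a b
    rw [b, Pi.mul_apply, ← a, Pi.zero_apply, mul_zero]
  have hbd : ∀ {k : Ω → ℝ}, Integrable k P → Integrable (fun ω => Z ω * k ω) P := fun hk =>
    hk.bdd_mul (c := 1) hZm.aestronglyMeasurable (Eventually.of_forall hZC)
  have h3 : ∫ ω, (Z * Δ) ω ∂P = (∫ ω, Z ω * (∫ r in (0 : ℝ)..t, q (X r.toNNReal ω)) ∂P)
      - ∫ ω, Z ω * (g (X t ω) - g (X 0 ω)) ∂P := by
    rw [← integral_sub (hbd hqi) (hbd hgt)]
    simp only [Δ, Pi.mul_apply, mul_sub]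
  rw [← hM.integral_mul_intervalIntegral hqm hq hZm hZC]
  linarith

/-- The generator of `g` is the difference quotient of a weak solution. -/
theorem IsFactorDiffusion.ae_generator_eq_of_isWeakSolution
    (hX : IsFactorDiffusion P 𝓕 W D μ σ κ X)
    (hϖ : IsInvariantDensity D μ σ κ ϖ) (hM : IsStationaryMarkov P 𝓕 κ X (densityMeasure ϖ))
    {g : Vec d → ℝ} (hg : ContDiffOn ℝ 2 g D) (hg0 : ∀ x, 0 ≤ g x) (hgm : Measurable g)
    (hgi : Integrable g (densityMeasure ϖ))
    (hq : Integrable (generator μ σ g) (densityMeasure ϖ)) {T : ℝ≥0} (hT : 0 < T)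
    {w : Vec d → ℝ} (hwm : Measurable w) (hw : Integrable w (densityMeasure ϖ))
    (h : IsWeakSolution P X T g w) :
    generator μ σ g =ᵐ[densityMeasure ϖ] fun x => (semigroup κ T w x - w x) / T :=
  hX.ae_generator_eq hϖ hM hg hg0 hgi hq (((hM.measurable_semigroup T hwm).sub hwm).div_const _)
    (((hM.integrable_semigroup T hw).sub hw).div_const _)
    fun t => hM.hasCenteredIncrements_of_isWeakSolution h hT hgm hgi hwm hw t

end Dynkin

section Density

variable {d : ℕ} {ϖ : Vec d → ℝ}

theorem memLp_two_densityMeasure_iff (hm : Measurable ϖ) (h0 : ∀ x, 0 ≤ ϖ x) {g : Vec d → ℝ}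
    (hg : Measurable g) : MemLp g 2 (densityMeasure ϖ) ↔ Integrable fun x => g x ^ 2 * ϖ x := by
  rw [memLp_two_iff_integrable_sq hg.aestronglyMeasurable, integrable_densityMeasure_iff hm h0]

theorem HasSpectralGap.hasDecay {D : Set (Vec d)} {μ : Vec d → Vec d}
    {σ : Vec d → Matrix (Fin d) (Fin d) ℝ} {κ : ℝ≥0 → Kernel (Vec d) (Vec d)} {gap : ℝ}
    (h : HasSpectralGap D μ σ κ ϖ gap) (hm : Measurable ϖ) (h0 : ∀ x, 0 ≤ ϖ x) :
    HasDecay κ (densityMeasure ϖ) gap := fun t g hg hg2 hg0 => by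
  rw [integral_densityMeasure hm h0] at hg0 ⊢
  rw [integral_densityMeasure hm h0]
  exact h.decay t g hg ((memLp_two_densityMeasure_iff hm h0 hg).1 hg2) hg0

end Density

end VIXInverse

/-! ### The main theorem -/

theorem theorem1 {d : ℕ} {Ω : Type*} [MeasurableSpace Ω] (P : Measure Ω) [IsProbabilityMeasure P]
    (𝓕 : Filtration ℝ≥0 ‹MeasurableSpace Ω›) (W : ℝ≥0 → Ω → Vec d)
    (D : Set (Vec d)) (μ : Vec d → Vec d) (σ : Vec d → Matrix (Fin d) (Fin d) ℝ)
    (κ : ℝ≥0 → Kernel (Vec d) (Vec d)) (X : ℝ≥0 → Ω → Vec d)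
    (hX : IsFactorDiffusion P 𝓕 W D μ σ κ X)
    (ϖ : Vec d → ℝ) (hϖ : IsUniqueInvariantDensity D μ σ κ ϖ)
    (hstat : IsStationaryWithDensity P X ϖ)
    (gap : ℝ) (hgap : HasSpectralGap D μ σ κ ϖ gap)
    (F : ℝ≥0 → ℝ≥0 → Ω → ℝ) (vol : ℝ≥0 → ℝ≥0 → Ω → Vec d) (hF : IsMarketModel P 𝓕 W F vol)
    (f : ℝ≥0 → Vec d → ℝ) (ν : ℝ≥0 → Vec d → Vec d)
    (hFX : IsMarkovianMarketModel P 𝓕 W D μ σ X F vol f ν)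
    (h : Vec d → ℝ) (h_meas : Measurable h) (h_cons : InterModelConsistent P 𝓕 X F h)
    (h_smooth : ContDiffOn ℝ 2 (fun x => h x ^ 2) D)
    (h_four : Integrable fun x => h x ^ 4 * ϖ x)
    (h_gen : Integrable fun x => generator μ σ (fun y => h y ^ 2) x ^ 2 * ϖ x)
    (τ : ℝ) (hτ : 0 < τ) :
    Integrable (fun x => ((2 * f 0 x + ‖ν 0 x‖ ^ 2) * h x ^ 2) * ϖ x) ∧
    ((∃ w, IsSquareIntegrableSolution P X ϖ τ h w) ↔
      bracket ϖ (fun x => (2 * f 0 x + ‖ν 0 x‖ ^ 2) * h x ^ 2) = 0) ∧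
    (∀ w w', IsSquareIntegrableSolution P X ϖ τ h w → IsSquareIntegrableSolution P X ϖ τ h w' →
      w =ᵐ[densityMeasure ϖ] w') ∧
    (∀ w, IsSquareIntegrableSolution P X ϖ τ h w →
      bracket ϖ w = bracket ϖ (fun x => h x ^ 2) ∧
      bracket ϖ (fun x => (w x - bracket ϖ fun y => h y ^ 2) ^ 2) ≤
        (τ / (1 - Real.exp (-gap * τ / 2))) ^ 2 *
          bracket ϖ (fun x => generator μ σ (fun y => h y ^ 2) x ^ 2)) := by
  have hX' := hϖ.1
  have hm := hX'.measurable
  have h0 := hX'.nonneg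
  have hM := hX.isStationaryMarkov hstat
  have hprob := hM.isProbabilityMeasure
  have hd := hgap.hasDecay hm h0
  set g : Vec d → ℝ := fun x => h x ^ 2 with hgdef
  have hgm : Measurable g := h_meas.pow_const 2
  have hg0 : ∀ x, 0 ≤ g x := fun x => sq_nonneg _
  have hqm : Measurable (generator μ σ g) :=
    measurable_generator hX.measurable_drift hX.measurable_dispersion g
  have hg : MemLp g 2 (densityMeasure ϖ) := by
    rw [memLp_two_densityMeasure_iff hm h0 hgm]
    simpa only [hgdef, ← pow_mul] using h_four
  have hq : MemLp (generator μ σ g) 2 (densityMeasure ϖ) :=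
    (memLp_two_densityMeasure_iff hm h0 hqm).2 h_gen
  have hgi := hg.integrable one_le_two
  have hqi := hq.integrable one_le_two
  -- Since h⁴ is integrable, h² is, so h is in L² and hence integrable; consistency at zero maturity
  -- can then be evaluated.
  have hhi : Integrable h (densityMeasure ϖ) :=
    ((memLp_two_iff_integrable_sq h_meas.aestronglyMeasurable).2 hgi).integrable one_le_two
  have hroll := ae_rollYield_eq_generator hX hM hFX h_meas h_cons h_smooth hhi
  lift τ to ℝ≥0 using hτ.le
  have hT : 0 < τ := hτ
  have hsol : ∀ w, IsSquareIntegrableSolution P X ϖ τ h w →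
      Measurable w ∧ MemLp w 2 (densityMeasure ϖ) ∧ IsWeakSolution P X τ g w := fun w hw => by
    have hw2 := (memLp_two_densityMeasure_iff hm h0 hw.measurable).2 hw.square_integrable
    exact ⟨hw.measurable, hw2, (hM.isWeakSolution_iff hτ hgm hgi hw.measurable
      (hw2.integrable one_le_two)).2 hw.inverse_problem⟩
  have hgen : ∀ w, IsSquareIntegrableSolution P X ϖ τ h w → generator μ σ g
      =ᵐ[densityMeasure ϖ] fun x => (semigroup κ τ w x - w x) / τ := fun w hw => by
    obtain ⟨hwm, hw2, hww⟩ := hsol w hw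
    exact hX.ae_generator_eq_of_isWeakSolution hX' hM h_smooth hg0 hgm hgi hqi hT hwm
      (hw2.integrable one_le_two) hww
  have hmean : ∀ w, IsSquareIntegrableSolution P X ϖ τ h w →
      ∫ x, w x ∂(densityMeasure ϖ) = ∫ x, g x ∂(densityMeasure ϖ) := fun w hw => by
    obtain ⟨hwm, hw2, hww⟩ := hsol w hw
    exact hM.integral_eq_of_isWeakSolution hww hτ hgi (hw2.integrable one_le_two)
  refine ⟨(integrable_densityMeasure_iff hm h0).1 (hqi.congr hroll.symm), ?_, ?_, ?_⟩
  · rw [← integral_densityMeasure hm h0, integral_congr_ae hroll]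
    constructor
    · rintro ⟨w, hw⟩
      obtain ⟨hwm, hw2, -⟩ := hsol w hw
      have hwi := hw2.integrable one_le_two
      -- Invariance of the measure makes P_τ w and w have the same mean, so the mean of the
      -- generator vanishes.
      rw [integral_congr_ae (hgen w hw), integral_div,
        integral_sub (hM.integrable_semigroup τ hwi) hwi, hM.integral_semigroup τ hwm hwi,
        sub_self, zero_div]
    · intro hq0
      obtain ⟨w, hwm, hw2, hww⟩ := hM.exists_isWeakSolution hd hgap.gap_pos hT hgm hg hqm hq hq0
        fun t Z hZ hZC => hX.integral_mul_sub_eq hX' hM h_smooth hg0 hgi hqi hq0 t hZ hZC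
      exact ⟨w, hwm, (memLp_two_densityMeasure_iff hm h0 hwm).1 hw2,
        (hM.isWeakSolution_iff hτ hgm hgi hwm (hw2.integrable one_le_two)).1 hww⟩
  · intro w w' hw hw'
    obtain ⟨hwm, hw2, -⟩ := hsol w hw
    obtain ⟨hwm', hw2', -⟩ := hsol w' hw'
    refine hM.ae_eq_of_semigroup_sub_eq hd hgap.gap_pos hT hwm hw2 hwm' hw2'
      ((hmean w hw).trans (hmean w' hw').symm) ?_
    filter_upwards [hgen w hw, hgen w' hw'] with x a b
    exact (div_left_inj' hτ.ne').1 (a.symm.trans b)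
  · intro w hw
    obtain ⟨hwm, hw2, -⟩ := hsol w hw
    rw [← integral_densityMeasure hm h0 w, ← integral_densityMeasure hm h0 g,
      ← integral_densityMeasure hm h0, ← integral_densityMeasure hm h0]
    exact ⟨hmean w hw, hM.integral_sq_le_of_semigroup_sub_eq hd hgap.gap_pos hT hwm hw2 hq
      (hgen w hw) (hmean w hw)⟩
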